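/- **Setting.** Let $\mathcal K$ be a long component Morse projection of an oriented link $K$, framed by the blackboard framing: an oriented $(1,1)$-tangle diagram in general position with respect to the height, whose first (long) component enters at the bottom and leaves at the top, both times upwards. Assume that no component is an overcrossing circle (every component passes under some crossing) and that the first crossing met from the bottom end is an undercrossing. Let $\omega$ be the writhe. A part arc runs from one crossing passage to the next, the top and bottom ends of the long component being joined, without counting an extremum for this. Its rotation number is the number of maxima minus the number of minima that it passes from left to right; here a crossing both of whose strands run to the right is first turned by a quarter turn anticlockwise, so that both strands run upwards. Let $\mathrm{rot}(\mathcal K)$ be the sum of all these rotation numbers. **The colored Jones polynomial.** Put $\{a\}=t^{a/2}-t^{-a/2}$, $\{a\}_b=\{a\}\{a-1\}\cdots\{a-b+1\}$, $\binom ab=\{a\}_b/\{b\}_b$. For $n\ge 0$, $J_n'(K)$ is the state-sum of the $R$-matrix of the $(n+1)$-dimensional irreducible representation: the sum over all colorings of the part arcs by $0,\dots,n$ with color $0$ on the long ends, of the product of $t^{\rho(2c-n)/2}$ over part arcs of color $c$ and rotation number $\rho$, and of the following weights of the crossings. If the over- and undercrossing incoming colors are $a,b$ and the outgoing colors are $a-r,b+r$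 with $r\ge 0$, the weight is $$(-1)^r t^{-((n-2a)(n-2b)+r(r-1))/4}\binom{b+r}{r}\{n+r-a\}_r$$ at a positive crossing, and $$t^{((n-2b-2r)(n-2a+2r)+r(r-1))/4}\binom{b+r}{r}\{n+r-a\}_r$$ at a negative one; all other weights are $0$. **The data.** Let $V$ be the set of overcrossing arcs; each is identified with the crossing at which it ends. For $v\in V$ let $\varepsilon(v)$ be the sign of this crossing, $\sigma(v)$ the overcrossing arc that follows $v$ there, and $\tau(v)$ the overcrossing arc that passes over there. Thus $\sigma$ is a bijection, and its cycles are the components. Each set $\tau^{-1}(u)$ is ordered by the order of the overcrossings along the arc $u$. Let $\mathfrak r_\sigma(v)$ be the rotation number of the arc $\sigma(v)$, and $\mathfrak r_\tau(v)$ the sum of the rotation numbers of the part arcs of $\tau(v)$ after the crossing $v$. Let $v^1$ be the arc that ends at the first undercrossing met from the bottom end. Choose a base vertex $v^\ell$ on every cycle $\ell=1,\dots,\mu$ of $\sigma$, namely $v^1$ on the cycle of the long component. **States.** $\mathcal F_n^*$ is the set of all $\mathbf j=((j_v)_{v\in V},(\beta_\ell)_{1\le \ell\le\mu})$ with values in $\{0,\dots,n\}$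 such that $\beta_1=0$, $j_{v^1}=0$, $j_w=0$ for $w\in\tau^{-1}(v^1)$, and the following hold. Write $j_{\tau^{-1}(v)}=\sum_{\tau(w)=v}j_w$, and let $k_v\ge 0$ be least with $\sigma^{-k_v}(v)=v^\ell$, where $\ell$ is the cycle of $v$. 1. (Cycle relations) For every cycle $\ell$, the sum of $j_v$ over the $v$ outside $\ell$ with $\tau(v)$ in $\ell$ equals the sum of $j_v$ over the $v$ in $\ell$ with $\tau(v)$ outside $\ell$. 2. For every $v\ne v^\ell$ in the cycle $\ell$, $$j_v\le \beta_\ell+j_{\tau^{-1}(v)}+\sum_{k=1}^{k_v-1}\bigl(j_{\tau^{-1}\sigma^{-k}(v)}-j_{\sigma^{-k}(v)}\bigr)\le n.$$ 3. $\beta_\ell+j_{v^\ell}\le n$ for every $\ell$. For $\mathbf j\in\mathcal F_n^*$ put, for $v$ in the cycle $\ell$, $$i_v=\beta_\ell+\sum_{k=0}^{k_v-1}\bigl(j_{\tau^{-1}\sigma^{-k}(v)}-j_{\sigma^{-k}(v)}\bigr),\qquad \tilde j_v=i_{\sigma^{-1}(\tau(v))}+\sum_{w\in\tau^{-1}(\tau(v)),\,w<v}j_w,$$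 $$\delta(\mathbf j)=-\sum_{v\ne v^1}\bigl(\varepsilon(v)i_v\tilde j_v+\mathfrak r_\tau(v)j_v+\mathfrak r_\sigma(v)i_v\bigr).$$ **Theorem.** With $\delta'(\mathcal K,n)=-\frac{n^2}{4}\omega+\frac n2\mathrm{rot}(\mathcal K)$, in $\mathbb Q(t^{1/4})$, $$J_n'(K)=t^{\delta'(\mathcal K,n)}\sum_{\mathbf j\in\mathcal F_n^*}t^{\delta(\mathbf j)}\prod_{v\in V,\ v\neq v^1}t^{n\varepsilon(v)i_v}\binom{i_v+j_v}{i_v}_{t^{-\varepsilon(v)}}\{n-\tilde j_v\}_{j_v,t^{\varepsilon(v)}},$$ where $\binom ab_s=\frac{(a)_s!}{(b)_s!\,(a-b)_s!}$ with $(a)_s!=\prod_{k=1}^a\frac{s^k-1}{s-1}$, and $\{a\}_{b,s}=\prod_{k=0}^{b-1}(1-s^{a-k})$. -/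

import Mathlib

open Finset
open scoped Classical

noncomputable section

/-- An elementary slice of a Morse projection: a local minimum (`cup`), a local maximum (`cap`), or
a crossing, at horizontal position `q` (positions are counted from the left, starting with `0`).
For `cross q b` the strands at positions `q` and `q + 1` cross; `b = true` means that the strand
joining bottom left to top right passes over the other one. -/
inductive Slice where
  | cup (q : ℕ)
  | cap (q : ℕ)
  | cross (q : ℕ) (b : Bool)

namespace Slice

/-- The horizontal position of a slice. -/
def pos : Slice → ℕ
  | cup q => q
  | cap q => q
  | cross q _ => q

def IsCrossing : Slice → Prop
  | cross _ _ => True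
  | _ => False

/-- For a crossing: does the strand joining bottom left to top right pass over? -/
def risingOver : Slice → Bool
  | cross _ b => b
  | _ => false

/-- The slice fits between a level with `w` strands and the next level, with `w'` strands. -/
def Fits (w w' : ℕ) : Slice → Prop
  | cup q => q ≤ w ∧ w' = w + 2
  | cap q => q ≤ w' ∧ w = w' + 2
  | cross q _ => q + 2 ≤ w ∧ w' = w

/-- The boundary points of a slice are the pairs `(false, p)` (bottom) and `(true, p)` (top).
`mate s e` is the other endpoint of the strand of `s` that has `e` as an endpoint. -/
def mate : Slice → Bool × ℕ → Bool × ℕ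
  | cup q, (false, p) => (true, if p < q then p else p + 2)
  | cup q, (true, p) =>
      if p < q then (false, p)
      else if p = q then (true, q + 1)
      else if p = q + 1 then (true, q)
      else (false, p - 2)
  | cap q, (true, p) => (false, if p < q then p else p + 2)
  | cap q, (false, p) =>
      if p < q then (true, p)
      else if p = q then (false, q + 1)
      else if p = q + 1 then (false, q)
      else (true, p - 2)
  | cross q _, (s, p) =>
      (!s, if p = q then q + 1 else if p = q + 1 then q else p)

theorem mate_mate {s : Slice} (e : Bool × ℕ) : s.mate (s.mate e) = e := by
  obtain ⟨b, p⟩ := e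
  cases s <;> cases b <;> simp only [mate] <;> grind [mate]

theorem mate_lt {s : Slice} {w w' : ℕ} (h : s.Fits w w') (e : Bool × ℕ)
    (he : e.2 < if e.1 then w' else w) :
    (s.mate e).2 < if (s.mate e).1 then w' else w := by
  obtain ⟨b, p⟩ := e
  cases s <;> cases b <;> simp only [Fits] at h <;> grind [mate]

end Slice

/-- A Morse projection of an oriented link with a long component (up to planar isotopy through
such projections), cut into slices between the levels `0, …, height`, each of which holds one
extremum or one crossing. `width k` is the number of strands at level `k`, and `up k p` says whether
the strand at position `p` of level `k` is directed upwards. The long component enters at the only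
point of level `0` and leaves at the only point of level `height`, both times upwards. -/
structure LongProjection where
  height : ℕ
  slice : ℕ → Slice
  width : ℕ → ℕ
  up : ℕ → ℕ → Bool
  width_bot : width 0 = 1
  width_top : width height = 1
  up_bot : up 0 0 = true
  up_top : up height 0 = true
  fits : ∀ k < height, (slice k).Fits (width k) (width (k + 1))
  /-- Every strand of a slice is coherently oriented. -/
  orient : ∀ k < height, ∀ e : Bool × ℕ, (e.2 < if e.1 then width (k + 1) else width k) →
    up (if ((slice k).mate e).1 then k + 1 else k) ((slice k).mate e).2 =
      if ((slice k).mate e).1 = e.1 then !(up (if e.1 then k + 1 else k) e.2)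
      else up (if e.1 then k + 1 else k) e.2

namespace LongProjection

variable (D : LongProjection)

/-- The points in which the projection meets the levels, written (level, position). -/
def Point : Type :=
  {x : ℕ × ℕ // x.1 ≤ D.height ∧ x.2 < D.width x.1}

instance : Finite D.Point := by
  have : Finite (Σ k : Fin (D.height + 1), Fin (D.width k)) := inferInstance
  refine Finite.of_injective
    (fun x : D.Point => (⟨⟨x.1.1, Nat.lt_succ_of_le x.2.1⟩, ⟨x.1.2, x.2.2⟩⟩ :
      Σ k : Fin (D.height + 1), Fin (D.width k))) ?_
  rintro ⟨⟨a, b⟩, h⟩ ⟨⟨c, d⟩, h'⟩ e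
  simp only [Sigma.mk.injEq, Fin.mk.injEq] at e
  obtain ⟨rfl, e⟩ := e
  simp only [heq_eq_eq, Fin.mk.injEq] at e
  subst e
  rfl

instance : Fintype D.Point := Fintype.ofFinite _

/-- The bottom end of the long component. -/
def bottom : D.Point := ⟨(0, 0), Nat.zero_le _, by simp [D.width_bot]⟩

/-- Is the projection directed upwards at this point? -/
def isUp (x : D.Point) : Bool := D.up x.1.1 x.1.2

/-- The boundary point `e` of the slice above level `k`, as a pair (level, position). -/
def place (k : ℕ) (e : Bool × ℕ) : ℕ × ℕ := (if e.1 then k + 1 else k, e.2)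

/-- The point reached by following the strand through `x` upwards (respectively downwards) through
one slice, the top and the bottom end of the long component being joined. -/
def travel (goUp : Bool) (x : ℕ × ℕ) : ℕ × ℕ :=
  if goUp then
    if x.1 = D.height then (0, 0) else place x.1 ((D.slice x.1).mate (false, x.2))
  else
    if x.1 = 0 then (D.height, 0) else place (x.1 - 1) ((D.slice (x.1 - 1)).mate (true, x.2))

theorem travel_valid (b : Bool) (x : ℕ × ℕ) (hx : x.1 ≤ D.height ∧ x.2 < D.width x.1) :
    (D.travel b x).1 ≤ D.height ∧ (D.travel b x).2 < D.width (D.travel b x).1 := by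
  obtain ⟨k, p⟩ := x
  obtain ⟨hk, hp⟩ := hx
  have h0 := D.width_bot
  have h1 := D.width_top
  simp only at hk hp
  cases b
  · by_cases hk0 : k = 0
    · simp [travel, hk0, h1]
    · obtain ⟨l, rfl⟩ : ∃ l, k = l + 1 := ⟨k - 1, by omega⟩
      have := Slice.mate_lt (D.fits l (by omega)) (true, p) (by simpa using hp)
      simp only [travel, place, Nat.add_sub_cancel]
      grind
  · by_cases hk0 : k = D.height
    · simp [travel, hk0, h0]
    · have := Slice.mate_lt (D.fits k (by omega)) (false, p) (by simpa using hp)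
      simp only [travel, place]
      grind

theorem travel_back (x : ℕ × ℕ) (hx : x.1 ≤ D.height ∧ x.2 < D.width x.1) :
    D.travel (!(D.up (D.travel (D.up x.1 x.2) x).1 (D.travel (D.up x.1 x.2) x).2))
      (D.travel (D.up x.1 x.2) x) = x := by
  obtain ⟨k, p⟩ := x
  obtain ⟨hk, hp⟩ := hx
  have h0 := D.width_bot
  have h1 := D.width_top
  have h2 := D.up_bot
  have h3 := D.up_top
  simp only at hk hp
  cases hb : D.up k p
  · have hk0 : k ≠ 0 := by
      rintro rfl
      have : p = 0 := by omega
      subst this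
      simp [h2] at hb
    obtain ⟨l, rfl⟩ : ∃ l, k = l + 1 := ⟨k - 1, by omega⟩
    have ho := D.orient l (by omega) (true, p) (by simpa using hp)
    have hm := Slice.mate_mate (s := D.slice l) (true, p)
    simp only [travel, place, Nat.add_sub_cancel] at ho hm ⊢
    generalize (D.slice l).mate (true, p) = e at *
    obtain ⟨c, q⟩ := e
    cases c
    · simp_all
      omega
    · simp_all
  · by_cases hk0 : k = D.height
    · subst hk0
      have : p = 0 := by omega
      subst this
      simp [travel, h2]
    · have ho := D.orient k (by omega) (false, p) (by simpa using hp)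
      have hm := Slice.mate_mate (s := D.slice k) (false, p)
      simp only [travel, place] at ho hm ⊢
      generalize (D.slice k).mate (false, p) = e at *
      obtain ⟨c, q⟩ := e
      cases c <;> simp_all

/-- The next point along the orientation (after the top end of the long component comes its bottom
end). -/
def next (x : D.Point) : D.Point :=
  ⟨D.travel (D.isUp x) x.1, D.travel_valid _ _ x.2⟩

theorem next_injective : Function.Injective D.next := by
  intro x y h
  have hx := D.travel_back x.1 x.2
  have hy := D.travel_back y.1 y.2
  have h' : D.travel (D.up x.1.1 x.1.2) x.1 = D.travel (D.up y.1.1 y.1.2) y.1 :=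
    congrArg Subtype.val h
  rw [h', hy] at hx
  exact Subtype.ext hx.symm

/-- The crossings of the projection. -/
def Crossing : Type := {k : Fin D.height // (D.slice k).IsCrossing}

instance : Fintype D.Crossing := by unfold Crossing; infer_instance

variable {D}

theorem Crossing.width_le (v : D.Crossing) :
    (D.slice v.1).pos + 2 ≤ D.width v.1 ∧ D.width (v.1 + 1) = D.width v.1 := by
  have h := D.fits v.1 v.1.2
  have h' := v.2
  generalize D.slice v.1 = s at *
  cases s <;> simp_all [Slice.IsCrossing, Slice.Fits, Slice.pos]

/-- The point at which the strand between bottom left and top right enters the crossing. -/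
def risingIn (v : D.Crossing) : D.Point :=
  if D.up v.1 (D.slice v.1).pos then
    ⟨(v.1, (D.slice v.1).pos), v.1.2.le, by have := v.width_le; grind⟩
  else ⟨(v.1 + 1, (D.slice v.1).pos + 1), v.1.2, by have := v.width_le; grind⟩

/-- The point at which the strand between bottom right and top left enters the crossing. -/
def fallingIn (v : D.Crossing) : D.Point :=
  if D.up v.1 ((D.slice v.1).pos + 1) then
    ⟨(v.1, (D.slice v.1).pos + 1), v.1.2.le, by have := v.width_le; grind⟩
  else ⟨(v.1 + 1, (D.slice v.1).pos), v.1.2, by have := v.width_le; grind⟩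

/-- The points just before and just after a crossing, on the overcrossing and on the undercrossing
strand. -/
def overIn (v : D.Crossing) : D.Point :=
  if (D.slice v.1).risingOver then risingIn v else fallingIn v

def underIn (v : D.Crossing) : D.Point :=
  if (D.slice v.1).risingOver then fallingIn v else risingIn v

def overOut (v : D.Crossing) : D.Point := D.next (overIn v)

def underOut (v : D.Crossing) : D.Point := D.next (underIn v)

/-- The sign of a crossing. -/
def sign (v : D.Crossing) : ℤ :=
  (if (D.slice v.1).risingOver then 1 else -1) *
    (if D.up v.1 (D.slice v.1).pos = D.up v.1 ((D.slice v.1).pos + 1) then 1 else -1)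

/-- Do both strands of the crossing run from left to right? -/
def RunsRight (v : D.Crossing) : Prop :=
  D.up v.1 (D.slice v.1).pos = true ∧ D.up v.1 ((D.slice v.1).pos + 1) = false

variable (D)

/-- The writhe. -/
def writhe : ℤ := ∑ v : D.Crossing, sign v

/-- The contribution of the point `x` to rotation numbers: `1` if `x` is followed by a maximum that
is passed from left to right, and `-1` if `x` is followed by a minimum that is passed from left to
right. A crossing both of whose strands run to the right is first turned by a quarter turn
anticlockwise, so that both strands run upwards; on its descending strand this creates a right
oriented minimum just before the crossing and a right oriented maximum just after it. -/
def pointRot (x : D.Point) : ℤ :=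
  (if x.1.1 < D.height ∧ D.isUp x = true ∧ D.slice x.1.1 = Slice.cap x.1.2 then 1 else 0)
  - (if 0 < x.1.1 ∧ D.isUp x = false ∧ D.slice (x.1.1 - 1) = Slice.cup x.1.2 then 1 else 0)
  - (∑ v : D.Crossing, if RunsRight v ∧ x = fallingIn v then 1 else 0)
  + (∑ v : D.Crossing, if RunsRight v ∧ x = D.next (fallingIn v) then 1 else 0)

/-- The rotation number of the projection. -/
def rotation : ℤ := ∑ x : D.Point, D.pointRot x

end LongProjection

/-! ### The colored Jones polynomial from the `R`-matrix

All values lie in the field `ℚ(t^{1/4})`; the variable of `RatFunc ℚ` is `t^{1/4}`. -/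

/-- `tq k` is `t^{k/4}`. -/
def tq (k : ℤ) : RatFunc ℚ := RatFunc.X ^ k

/-- `{a} = t^{a/2} - t^{-a/2}`. -/
def qBrace (a : ℤ) : RatFunc ℚ := tq (2 * a) - tq (-2 * a)

/-- `{a}_b = {a}{a-1}⋯{a-b+1}`. -/
def qPoch (a : ℤ) (b : ℕ) : RatFunc ℚ := ∏ s ∈ range b, qBrace (a - s)

/-- The symmetric quantum binomial `{a}_b / {b}_b`. -/
def qBinomSymm (a : ℤ) (b : ℕ) : RatFunc ℚ := qPoch a b / qPoch b b

/-- The `R`-matrix entry at a positive crossing. Here `i` and `j` are the colors of the incoming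
overcrossing and undercrossing part arcs, and the outgoing colors are `i - r` and `j + r`. -/
def fPos (n i j : ℤ) (r : ℕ) : RatFunc ℚ :=
  (-1) ^ r * tq (-((n - 2 * i) * (n - 2 * j) + r * (r - 1))) * qBinomSymm (j + r) r *
    qPoch (n + r - i) r

/-- The `R`-matrix entry at a negative crossing. Here `i` and `j` are the colors of the incoming
undercrossing and overcrossing part arcs, and the outgoing colors are `i + r` and `j - r`. -/
def fNeg (n i j : ℤ) (r : ℕ) : RatFunc ℚ :=
  tq ((n - 2 * i - 2 * r) * (n - 2 * j + 2 * r) + r * (r - 1)) * qBinomSymm (i + r) r *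
    qPoch (n + r - j) r

/-- The weight of a crossing of sign `ε` with the given colors of the overcrossing and the
undercrossing part arcs, before and after the crossing. It vanishes unless colors are preserved and
do not increase along the overcrossing. -/
def crossingWeight (n : ℕ) (ε : ℤ) (overBefore underBefore overAfter underAfter : ℕ) :
    RatFunc ℚ :=
  if overAfter ≤ overBefore ∧ overBefore + underBefore = overAfter + underAfter then
    if ε = 1 then fPos n overBefore underBefore (overBefore - overAfter)
    else fNeg n underBefore overBefore (overBefore - overAfter)
  else 0

namespace LongProjection

variable (D : LongProjection)

/-- The colorings of the part arcs by `0, …, n` that color the bottom end of the long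
component `0`; all points of a part arc have the same color. -/
def colorings (n : ℕ) : Finset (D.Point → Fin (n + 1)) :=
  univ.filter fun c => c D.bottom = 0 ∧
    ∀ x : D.Point, (∀ v : D.Crossing, x ≠ overIn v ∧ x ≠ underIn v) → c (D.next x) = c x

/-- The framed colored Jones polynomial `J'_n` of the link presented by `D`, with its blackboard
framing, as the state-sum of the ribbon functor for the irreducible representation of
dimension `n + 1`: the entry, for the lowest color, of the operator of the long component. Right
oriented maxima and minima of color `c` have the weights `t^{(2c-n)/2}` and `t^{-(2c-n)/2}`, left
oriented extrema have weight `1`. -/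
def coloredJones (n : ℕ) : RatFunc ℚ :=
  ∑ c ∈ D.colorings n,
    (∏ x : D.Point, tq (2 * D.pointRot x * (2 * (c x : ℤ) - n))) *
    ∏ v : D.Crossing, crossingWeight n (sign v)
      (c (overIn v)) (c (underIn v)) (c (overOut v)) (c (underOut v))

/-! ### The data of the arc graph -/

/-- Every component passes under some crossing. -/
def NoOvercrossingCircle : Prop :=
  ∀ x : D.Point, ∃ m : ℕ, ∃ v : D.Crossing, D.next^[m] x = underIn v

/-- The first crossing met from the bottom end of the long component is an undercrossing. -/
def StartsUnder : Prop :=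
  ∃ m : ℕ, (∃ v : D.Crossing, D.next^[m] D.bottom = underIn v) ∧
    ∀ l < m, ∀ w : D.Crossing, D.next^[l] D.bottom ≠ overIn w

variable {D}

theorem level_of_risingIn (v : D.Crossing) :
    (if D.isUp (risingIn v) then (risingIn v).1.1 else (risingIn v).1.1 - 1) = (v.1 : ℕ) := by
  have ho := D.orient v.1 v.1.2 (false, (D.slice v.1).pos) (by have := v.width_le; grind)
  have hm : (D.slice v.1).mate (false, (D.slice v.1).pos) = (true, (D.slice v.1).pos + 1) := by
    have h' := v.2
    generalize D.slice v.1 = s at *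
    cases s <;> simp_all [Slice.IsCrossing, Slice.mate, Slice.pos]
  rw [hm] at ho
  unfold risingIn isUp
  split_ifs <;> simp_all

theorem level_of_fallingIn (v : D.Crossing) :
    (if D.isUp (fallingIn v) then (fallingIn v).1.1 else (fallingIn v).1.1 - 1) = (v.1 : ℕ) := by
  have ho := D.orient v.1 v.1.2 (false, (D.slice v.1).pos + 1) (by have := v.width_le; grind)
  have hm : (D.slice v.1).mate (false, (D.slice v.1).pos + 1) = (true, (D.slice v.1).pos) := by
    have h' := v.2
    generalize D.slice v.1 = s at *
    cases s <;> simp_all [Slice.IsCrossing, Slice.mate, Slice.pos]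
  rw [hm] at ho
  unfold fallingIn isUp
  split_ifs <;> simp_all

theorem underIn_injective : Function.Injective (underIn : D.Crossing → D.Point) := by
  have key : ∀ v : D.Crossing,
      (if D.isUp (underIn v) then (underIn v).1.1 else (underIn v).1.1 - 1) = (v.1 : ℕ) := by
    intro v
    by_cases h : (D.slice v.1).risingOver = true
    · simpa only [underIn, h, if_true] using level_of_fallingIn v
    · simpa only [underIn, h, if_false, Bool.false_eq_true] using level_of_risingIn v
  intro v w e
  have hv := key v
  rw [e, key w] at hv
  exact Subtype.ext (Fin.ext hv.symm)

theorem overIn_injective : Function.Injective (overIn : D.Crossing → D.Point) := by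
  have key : ∀ v : D.Crossing,
      (if D.isUp (overIn v) then (overIn v).1.1 else (overIn v).1.1 - 1) = (v.1 : ℕ) := by
    intro v
    by_cases h : (D.slice v.1).risingOver = true
    · simpa only [overIn, h, if_true] using level_of_risingIn v
    · simpa only [overIn, h, if_false, Bool.false_eq_true] using level_of_fallingIn v
  intro v w e
  have hv := key v
  rw [e, key w] at hv
  exact Subtype.ext (Fin.ext hv.symm)

/-- The number of steps from `x` to the end of the overcrossing arc that contains `x`. -/
def stepsToEnd (h : D.NoOvercrossingCircle) (x : D.Point) : ℕ := Nat.find (h x)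

/-- The overcrossing arc containing `x`, named by the crossing at which it ends. -/
def arcOf (h : D.NoOvercrossingCircle) (x : D.Point) : D.Crossing := (Nat.find_spec (h x)).choose

theorem arcOf_spec (h : D.NoOvercrossingCircle) (x : D.Point) :
    D.next^[stepsToEnd h x] x = underIn (arcOf h x) := (Nat.find_spec (h x)).choose_spec

/-- The sum of the rotation numbers from `x` to the end of its overcrossing arc. -/
def rotToEnd (h : D.NoOvercrossingCircle) (x : D.Point) : ℤ :=
  ∑ k ∈ range (stepsToEnd h x + 1), D.pointRot (D.next^[k] x)

theorem arcOf_underOut_injective (h : D.NoOvercrossingCircle) :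
    Function.Injective fun v => arcOf h (underOut v) := by
  suffices H : ∀ v w : D.Crossing, arcOf h (underOut v) = arcOf h (underOut w) →
      stepsToEnd h (underOut v) ≤ stepsToEnd h (underOut w) → v = w by
    intro v w e
    rcases le_total (stepsToEnd h (underOut v)) (stepsToEnd h (underOut w)) with hl | hl
    · exact H v w e hl
    · exact (H w v e.symm hl).symm
  intro v w e hl
  have hv := arcOf_spec h (underOut v)
  have hw := arcOf_spec h (underOut w)
  rw [e, ← hw] at hv
  obtain ⟨d, hd⟩ := Nat.exists_eq_add_of_le hl
  rw [hd, Function.iterate_add_apply] at hv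
  have h1 := D.next_injective.iterate _ hv
  rcases d with _ | d
  · exact underIn_injective (D.next_injective h1)
  · rw [Function.iterate_succ_apply'] at h1
    have h2 := D.next_injective h1
    exact absurd ⟨v, h2.symm⟩ (Nat.find_min (h (underOut w)) (m := d)
      (by change d < stepsToEnd h (underOut w); omega))

theorem stepsToEnd_overOut_injective (h : D.NoOvercrossingCircle) {v w : D.Crossing}
    (e : arcOf h (overOut v) = arcOf h (overOut w))
    (e' : stepsToEnd h (overOut v) = stepsToEnd h (overOut w)) : v = w := by
  have hv := arcOf_spec h (overOut v)
  have hw := arcOf_spec h (overOut w)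
  rw [e, ← hw, e'] at hv
  exact overIn_injective (D.next_injective (D.next_injective.iterate _ hv))

end LongProjection

/-- The data `(V, ε, σ, τ, 𝔬, 𝔯)` of an arc graph: signs, undercrossing map, jump map, a total
order on each fibre of the jump map, and two functions of rotation numbers. -/
structure GraphSextuple where
  V : Type
  fintypeV : Fintype V
  ε : V → ℤ
  σ : Equiv.Perm V
  τ : V → V
  order : ∀ v, LinearOrder {w : V // τ w = v}
  rotσ : V → ℤ
  rotτ : V → ℤ

attribute [instance] GraphSextuple.fintypeV

/-- The sextuple of a projection. Vertices are the overcrossing arcs, each named by the crossing at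
which it ends. At the crossing `v` the arc `v` is followed by the arc `σ v`, and `τ v` is the arc
that passes over. The order of `τ⁻¹(u)` is the order of the overcrossings along the arc `u`. -/
def LongProjection.sextuple (D : LongProjection) (h : D.NoOvercrossingCircle) :
    GraphSextuple where
  V := D.Crossing
  fintypeV := inferInstance
  ε := LongProjection.sign
  σ := Equiv.ofBijective _
    (Finite.injective_iff_bijective.1 (LongProjection.arcOf_underOut_injective h))
  τ v := LongProjection.arcOf h (LongProjection.overOut v)
  order u := LinearOrder.lift'
    (fun w : {w : D.Crossing // LongProjection.arcOf h (LongProjection.overOut w) = u} =>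
      OrderDual.toDual (LongProjection.stepsToEnd h (LongProjection.overOut w.1)))
    (fun w w' e => Subtype.ext (LongProjection.stepsToEnd_overOut_injective h
      (w.2.trans w'.2.symm) (OrderDual.toDual.injective e)))
  rotσ v := LongProjection.rotToEnd h (LongProjection.underOut v)
  rotτ v := LongProjection.rotToEnd h (LongProjection.overOut v)

/-- The base vertex of the long component: the arc that ends at the first undercrossing met from
the bottom end. -/
def LongProjection.baseVertex (D : LongProjection) (h : D.NoOvercrossingCircle) :
    (D.sextuple h).V := LongProjection.arcOf h D.bottom

namespace GraphSextuple

variable (G : GraphSextuple)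

/-- The components, i.e. the cycles of the undercrossing map. -/
def Component : Type := Quotient (Equiv.Perm.SameCycle.setoid G.σ)

instance : Fintype G.Component := by unfold Component; exact Fintype.ofFinite _

variable {G}

/-- The component of a vertex. -/
def comp (v : G.V) : G.Component := Quotient.mk _ v

/-- A choice of a base vertex on each component, which is `v₁` on the component of `v₁`. -/
structure Basing (v₁ : G.V) where
  base : G.Component → G.V
  comp_base : ∀ ℓ, comp (base ℓ) = ℓ
  base_first : base (comp v₁) = v₁

variable {v₁ : G.V} (B : Basing v₁) (n : ℕ) (j : G.V → ℕ) (β : G.Component → ℕ)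

/-- `j_{τ⁻¹(v)}`. -/
def jumpInto (v : G.V) : ℤ := ∑ w with G.τ w = v, (j w : ℤ)

/-- The number `k_v`: the least `k` such that `σ^{-k}(v)` is the base vertex of the component
of `v`. -/
def depth (v : G.V) : ℕ := sInf {k : ℕ | (G.σ⁻¹ ^ k) v = B.base (comp v)}

/-- The blue color `i_v`, computed from the potential by following the component of `v` from its
base vertex. -/
def blue (v : G.V) : ℤ :=
  β (comp v) + ∑ k ∈ range (depth B v), (jumpInto j ((G.σ⁻¹ ^ k) v) - j ((G.σ⁻¹ ^ k) v))

/-- The cycle relations: on each component, the jumps at its overcrossings with other components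
and the jumps at its undercrossings with other components have the same sum. -/
def CycleRelations : Prop :=
  ∀ ℓ : G.Component,
    (∑ v with comp (G.τ v) = ℓ ∧ comp v ≠ ℓ, j v) = ∑ v with comp v = ℓ ∧ comp (G.τ v) ≠ ℓ, j v

/-- The inequalities for contributing states. -/
def Inequalities : Prop :=
  (∀ v : G.V, v ≠ B.base (comp v) →
    (j v : ℤ) ≤ β (comp v) + jumpInto j v +
      ∑ k ∈ Ico 1 (depth B v), (jumpInto j ((G.σ⁻¹ ^ k) v) - j ((G.σ⁻¹ ^ k) v)) ∧
    β (comp v) + jumpInto j v +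
      ∑ k ∈ Ico 1 (depth B v), (jumpInto j ((G.σ⁻¹ ^ k) v) - j ((G.σ⁻¹ ^ k) v)) ≤ (n : ℤ)) ∧
  ∀ ℓ : G.Component, β ℓ + j (B.base ℓ) ≤ n

/-- The contributing states: potentials `(j, β)` with values in `{0, …, n}`, vanishing at the base
vertex `v₁` of the long component, on `τ⁻¹(v₁)`, and as base value of the long component. -/
def states : Finset ((G.V → Fin (n + 1)) × (G.Component → Fin (n + 1))) :=
  univ.filter fun s =>
    s.2 (comp v₁) = 0 ∧ s.1 v₁ = 0 ∧ (∀ w, G.τ w = v₁ → s.1 w = 0) ∧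
    CycleRelations (fun v => (s.1 v : ℕ)) ∧
    Inequalities B n (fun v => (s.1 v : ℕ)) (fun ℓ => (s.2 ℓ : ℕ))

/-- `j̃_v`, the color with which the arc `τ(v)` arrives at the crossing `v`. -/
def jTilde (v : G.V) : ℤ :=
  (∑ w : {w : G.V // G.τ w = G.τ v} with (G.order (G.τ v)).lt w ⟨v, rfl⟩, (j w.1 : ℤ)) +
    blue B j β (G.σ⁻¹ (G.τ v))

/-- The excess of a state. -/
def excess : ℤ :=
  ∑ v with v ≠ v₁, G.ε v * blue B j β v * jTilde B j β v

/-- The rotation of a state. -/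
def stateRot : ℤ :=
  ∑ v with v ≠ v₁, (G.rotτ v * j v + G.rotσ v * blue B j β v)

/-- The exponent `δ` of a state. -/
def delta : ℤ := -(excess B j β + stateRot B j β)

end GraphSextuple

/-- `(1)_s (2)_s ⋯ (a)_s` with `(k)_s = (s^k - 1)/(s - 1)`. -/
def qFactorial (s : RatFunc ℚ) (a : ℕ) : RatFunc ℚ :=
  ∏ k ∈ range a, (s ^ (k + 1) - 1) / (s - 1)

/-- The quantum binomial `(a)_s! / ((b)_s! (a-b)_s!)`, for `b ≤ a`. -/
def qBinom (s : RatFunc ℚ) (a b : ℕ) : RatFunc ℚ :=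
  qFactorial s a / (qFactorial s b * qFactorial s (a - b))

/-- `{a}_{b,s} = (1 - s^a)(1 - s^{a-1})⋯(1 - s^{a-b+1})`. -/
def qPochSign (s : RatFunc ℚ) (a : ℤ) (b : ℕ) : RatFunc ℚ := ∏ k ∈ range b, (1 - s ^ (a - k))

/-- The contribution of the vertex `v`; the color `i_v` of a contributing state is not negative. -/
def GraphSextuple.vertexWeight {G : GraphSextuple} {v₁ : G.V} (B : GraphSextuple.Basing v₁) (n : ℕ)
    (j : G.V → ℕ) (β : G.Component → ℕ) (v : G.V) : RatFunc ℚ :=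
  tq (4 * (n * G.ε v * GraphSextuple.blue B j β v)) *
    qBinom (tq (-4 * G.ε v)) ((GraphSextuple.blue B j β v).toNat + j v)
      (GraphSextuple.blue B j β v).toNat *
    qPochSign (tq (4 * G.ε v)) (n - GraphSextuple.jTilde B j β v) (j v)

end

/-!
The colored Jones polynomial is turned into the state-sum of the arc graph in three steps.

*From the lowest to the highest color.* Read level by level, the state-sum is a matrix entry of a
product of operators, one for each slice. Every one of them commutes with the raising operator `E`
of quantum `sl₂`: for crossings with all orientations this follows from one identity for the
entries of the `R`-matrix (`crossW_pos_intertwines`, `crossW_neg_intertwines`), and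
`blockWeight_intertwines` carries it over from an extremum or crossing to the whole slice. Hence
`E` can be moved from the bottom to the top of the long component, which shows that the diagonal
entries of its operator agree (`levelSum_self`), as in Schur's lemma. In particular the long
component may be given the color `n` instead of `0`.

*Flows.* Write the colors as `n - f`. Then color passes from the under- to the overcrossing strand,
`f` vanishes at the ends of the long component, and up to a rescaling of the basis and a power of
`t` the weight of a crossing becomes that of a vertex of the arc graph (`crossW_complement`). The
rescaling factors cancel between consecutive crossings. In the exponent of `t` there remains, apart
from writhe and rotation number, the sum of `sign v * (f (overIn v) - f (underOut v))`: the
intersection number of the flow with the projection itself, pushed off to one side. It vanishes,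
since both are cycles in the plane; the proof (`IsFlow.sum_sign_mul`) sums the colors of a level,
weighted by the Alexander numbering of the regions, and lets the level rise.

*States.* A flow is determined by its jumps at the overcrossings and by its colors after the
undercrossings (`arcColor_self`). The latter are the blue colors: along a component they change
by the jumps, so they are determined by the color at one base vertex. Conversely the cycle
relations say exactly that the blue colors fit together at the base vertex (`cycleRelations_iff`),
and the inequalities say that all colors lie between `0` and `n` (`inequalities_iff`), as
colors are monotone along overcrossing arcs. Since the first crossing is an undercrossing, the flow
vanishes on the whole first arc (`IsFlow.vanishing`), which gives the vanishing conditions for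
states. The rotation of a flow is collected arc by arc (`sum_pointRot_mul_arcColor`).
-/

/-! ### Quantum integers and the `R`-matrix -/

theorem tq_add (a b : ℤ) : tq (a + b) = tq a * tq b := zpow_add₀ RatFunc.X_ne_zero a b

theorem tq_ne_zero (a : ℤ) : tq a ≠ 0 := zpow_ne_zero _ RatFunc.X_ne_zero

@[simp] theorem tq_zero : tq 0 = 1 := zpow_zero _

theorem tq_zpow (a b : ℤ) : tq a ^ b = tq (a * b) := (zpow_mul _ a b).symm

theorem tq_pow (a : ℤ) (b : ℕ) : tq a ^ b = tq (a * b) := by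
  rw [← tq_zpow, zpow_natCast]

theorem tq_sum {ι : Type*} (s : Finset ι) (f : ι → ℤ) : tq (∑ i ∈ s, f i) = ∏ i ∈ s, tq (f i) := by
  induction s using Finset.induction_on with
  | empty => simp
  | insert a s ha ih => rw [Finset.sum_insert ha, Finset.prod_insert ha, tq_add, ih]

theorem tq_eq_one {a : ℤ} : tq a = 1 ↔ a = 0 := by
  have key : ∀ k : ℕ, tq k = 1 → k = 0 := by
    intro k hk
    have h : algebraMap (Polynomial ℚ) (RatFunc ℚ) (Polynomial.X ^ k) =
        algebraMap (Polynomial ℚ) (RatFunc ℚ) 1 := by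
      rw [map_pow, RatFunc.algebraMap_X, map_one, ← hk, tq, zpow_natCast]
    have h' := RatFunc.algebraMap_injective ℚ h
    simpa using congrArg Polynomial.natDegree h'
  constructor
  · intro h
    rcases Int.eq_nat_or_neg a with ⟨k, rfl | rfl⟩
    · simpa using key k h
    · have h2 : tq (k : ℤ) = 1 := by
        have := tq_add (k : ℤ) (-k)
        rw [h] at this
        simpa using this.symm
      simpa using key k h2
  · rintro rfl
    simp

theorem qBrace_ne_zero {a : ℤ} (h : a ≠ 0) : qBrace a ≠ 0 := by
  intro h0
  have h1 : tq (2 * a) = tq (-2 * a) := sub_eq_zero.1 h0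
  have h2 : tq (2 * a - -2 * a) = 1 := by
    rw [sub_eq_add_neg, tq_add, h1, ← tq_add, add_neg_cancel, tq_zero]
  rw [tq_eq_one] at h2
  omega

@[simp] theorem qBrace_zero : qBrace 0 = 0 := by simp [qBrace]

@[simp] theorem qPoch_zero (a : ℤ) : qPoch a 0 = 1 := by simp [qPoch]

/-- Splitting off the last factor. -/
theorem qPoch_succ (a : ℤ) (b : ℕ) : qPoch a (b + 1) = qPoch a b * qBrace (a - b) :=
  Finset.prod_range_succ _ _

/-- Splitting off the first factor. -/
theorem qPoch_succ' (a : ℤ) (b : ℕ) : qPoch a (b + 1) = qBrace a * qPoch (a - 1) b := by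
  rw [qPoch, Finset.prod_range_succ', mul_comm]
  congr 1
  · simp
  · refine Finset.prod_congr rfl fun s _ => ?_
    congr 1
    push_cast
    ring

theorem qPoch_self_ne_zero (b : ℕ) : qPoch b b ≠ 0 := by
  refine Finset.prod_ne_zero_iff.2 fun s hs => qBrace_ne_zero ?_
  have := Finset.mem_range.1 hs
  omega

/-- The weight of a crossing, extended to integral colors. -/
noncomputable def crossW (n ε a b a' b' : ℤ) : RatFunc ℚ :=
  if a' ≤ a ∧ a + b = a' + b' then
    if ε = 1 then fPos n a b (a - a').toNat else fNeg n b a (a - a').toNat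
  else 0

theorem crossingWeight_eq (n : ℕ) (ε : ℤ) (a b a' b' : ℕ) :
    crossingWeight n ε a b a' b' = crossW n ε a b a' b' := by
  unfold crossingWeight crossW
  have h : ((a : ℤ) - a').toNat = a - a' := by omega
  rw [h]
  congr 1
  simp only [eq_iff_iff]
  omega

theorem crossW_pos (n a b : ℤ) (r : ℕ) : crossW n 1 a b (a - r) (b + r) = fPos n a b r := by
  rw [crossW, if_pos (And.intro (by omega) (by ring)), if_pos rfl,
    show (a - (a - r)).toNat = r by omega]

theorem crossW_neg (n a b : ℤ) (r : ℕ) : crossW n (-1) a b (a - r) (b + r) = fNeg n b a r := by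
  rw [crossW, if_pos (And.intro (by omega) (by ring)), if_neg (by norm_num),
    show (a - (a - r)).toNat = r by omega]

theorem crossW_eq_zero {n ε a b a' b' : ℤ} (h : ¬(a' ≤ a ∧ a + b = a' + b')) :
    crossW n ε a b a' b' = 0 := if_neg h

/-- The products of quantum integers in the four terms of the commutation relation at a crossing
have a common factor. -/
theorem cross_products (n a b : ℤ) (r : ℕ) (x₁ x₂ x₃ x₄ : RatFunc ℚ)
    (h : qBrace (a + 1) * qBrace (n - a) * x₁ + qBrace (r + 1) * x₂ =
      qBrace (a - r) * qBrace (n + r + 1 - a) * x₃ + qBrace (r + 1) * x₄) :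
    qBrace (a + 1) * (x₁ * qBinomSymm (b + r + 1) (r + 1) * qPoch (n + r - a) (r + 1)) +
      qBrace (b + 1) * (x₂ * qBinomSymm (b + r + 1) r * qPoch (n + r - a) r) =
    qBrace (a - r) * (x₃ * qBinomSymm (b + r + 1) (r + 1) * qPoch (n + r + 1 - a) (r + 1)) +
      qBrace (b + r + 1) * (x₄ * qBinomSymm (b + r) r * qPoch (n + r - a) r) := by
  have e1 : qBrace (b + 1) * qPoch (b + r + 1) r = qPoch (b + r + 1) (r + 1) := by
    rw [qPoch_succ, mul_comm]; ring_nf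
  have e2 : qBrace (b + r + 1) * qPoch (b + r) r = qPoch (b + r + 1) (r + 1) := by
    rw [qPoch_succ']; ring_nf
  have e3 : qPoch (n + r - a) (r + 1) = qPoch (n + r - a) r * qBrace (n - a) := by
    rw [qPoch_succ]; ring_nf
  have e4 : qPoch (n + r + 1 - a) (r + 1) = qBrace (n + r + 1 - a) * qPoch (n + r - a) r := by
    rw [qPoch_succ']; ring_nf
  have e5 : qPoch ((r + 1 : ℕ) : ℤ) (r + 1) = qBrace (r + 1) * qPoch r r := by
    rw [qPoch_succ']; push_cast; ring_nf
  have h0 := qPoch_self_ne_zero r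
  have h1 : qBrace ((r : ℤ) + 1) ≠ 0 := qBrace_ne_zero (by omega)
  simp only [qBinomSymm]
  rw [e5, e3, e4]
  field_simp
  linear_combination qPoch (n + r - a) r * (qPoch (b + r + 1) (r + 1) * h +
    x₂ * qBrace (r + 1) * e1 - x₄ * qBrace (r + 1) * e2)

/-- At a positive crossing with both strands directed upwards, the `R`-matrix commutes with the
raising operator `E`, where `E` acts on a color `c` by `{c + 1}` and the coproduct is
`E ⊗ K⁻¹ + 1 ⊗ E`. -/
theorem crossW_pos_intertwines (n a b a' b' : ℤ) (h : a + b + 1 = a' + b') :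
    qBrace (a + 1) * tq (-2 * (n - 2 * b)) * crossW n 1 (a + 1) b a' b' +
      qBrace (b + 1) * crossW n 1 a (b + 1) a' b' =
    qBrace a' * crossW n 1 a b (a' - 1) b' +
      qBrace b' * tq (-2 * (n - 2 * a')) * crossW n 1 a b a' (b' - 1) := by
  rcases lt_trichotomy a' (a + 1) with hlt | rfl | hlt
  · obtain ⟨r, hr⟩ := Int.le.dest (Int.lt_add_one_iff.1 hlt)
    obtain rfl : a' = a - r := by omega
    obtain rfl : b' = b + r + 1 := by omega
    have w1 := crossW_pos n (a + 1) b (r + 1)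
    have w2 := crossW_pos n a (b + 1) r
    have w3 := crossW_pos n a b (r + 1)
    have w4 := crossW_pos n a b r
    push_cast at w1 w3
    rw [show a + 1 - ((r : ℤ) + 1) = a - r by ring,
      show b + ((r : ℤ) + 1) = b + r + 1 by ring] at w1
    rw [show b + 1 + (r : ℤ) = b + r + 1 by ring] at w2
    rw [show a - ((r : ℤ) + 1) = a - r - 1 by ring,
      show b + ((r : ℤ) + 1) = b + r + 1 by ring] at w3
    rw [w1, w2, w3, show b + (r : ℤ) + 1 - 1 = b + r by ring, w4]
    have key := cross_products n a b r
      (tq (-2 * (n - 2 * b)) * ((-1) ^ (r + 1) *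
        tq (-((n - 2 * (a + 1)) * (n - 2 * b) + (r + 1) * (r + 1 - 1)))))
      ((-1) ^ r * tq (-((n - 2 * a) * (n - 2 * (b + 1)) + r * (r - 1))))
      ((-1) ^ (r + 1) * tq (-((n - 2 * a) * (n - 2 * b) + (r + 1) * (r + 1 - 1))))
      (tq (-2 * (n - 2 * (a - r))) * ((-1) ^ r *
        tq (-((n - 2 * a) * (n - 2 * b) + r * (r - 1))))) (by
        simp only [pow_succ, mul_left_comm (tq _), ← tq_add]
        set B := (n - 2 * a) * (n - 2 * b) + r * (r - 1) with hB
        have : qBrace (a + 1) * qBrace (n - a) * tq (-B - 2 * r) -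
            qBrace (r + 1) * tq (-B + 2 * (n - 2 * a)) =
            qBrace (a - r) * qBrace (n + r + 1 - a) * tq (-B - 2 * r) -
            qBrace (r + 1) * tq (-B - 2 * (n - 2 * a + 2 * r)) := by
          simp only [qBrace, mul_sub, sub_mul, ← tq_add]
          ring_nf
        rw [show -2 * (n - 2 * b) +
              -((n - 2 * (a + 1)) * (n - 2 * b) + ((r : ℤ) + 1) * (r + 1 - 1)) =
            -B - 2 * r by rw [hB]; ring,
          show -((n - 2 * a) * (n - 2 * (b + 1)) + (r : ℤ) * (r - 1)) = -B + 2 * (n - 2 * a) by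
            rw [hB]; ring,
          show -((n - 2 * a) * (n - 2 * b) + ((r : ℤ) + 1) * (r + 1 - 1)) = -B - 2 * r by
            rw [hB]; ring,
          show -2 * (n - 2 * (a - (r : ℤ))) + -B = -B - 2 * (n - 2 * a + 2 * r) by ring]
        linear_combination -(-1) ^ r * this)
    simp only [fPos]
    push_cast
    rw [show n + ((r : ℤ) + 1) - (a + 1) = n + r - a by ring,
      show n + ((r : ℤ) + 1) - a = n + r + 1 - a by ring,
      show b + ((r : ℤ) + 1) = b + r + 1 by ring, show b + 1 + (r : ℤ) = b + r + 1 by ring]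
    linear_combination key
  · obtain rfl : b' = b := by omega
    have w1 := crossW_pos n (a + 1) b' 0
    have w3 := crossW_pos n a b' 0
    simp only [Nat.cast_zero, sub_zero, add_zero] at w1 w3
    rw [w1, crossW_eq_zero (by omega), add_sub_cancel_right, w3, crossW_eq_zero (by omega)]
    simp only [fPos, qBinomSymm, qPoch_zero, Nat.cast_zero, zero_mul, add_zero]
    have : tq (-2 * (n - 2 * b')) * tq (-((n - 2 * (a + 1)) * (n - 2 * b'))) =
        tq (-((n - 2 * a) * (n - 2 * b'))) := by
      rw [← tq_add]; congr 1; ring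
    linear_combination qBrace (a + 1) * this
  · rw [crossW_eq_zero (by omega), crossW_eq_zero (by omega), crossW_eq_zero (by omega),
      crossW_eq_zero (by omega)]
    simp

/-- At a negative crossing with both strands directed upwards, the inverse `R`-matrix commutes with
the raising operator. -/
theorem crossW_neg_intertwines (n a b a' b' : ℤ) (h : a + b + 1 = a' + b') :
    qBrace (a + 1) * crossW n (-1) (a + 1) b a' b' +
      qBrace (b + 1) * tq (-2 * (n - 2 * a)) * crossW n (-1) a (b + 1) a' b' =
    qBrace a' * tq (-2 * (n - 2 * b')) * crossW n (-1) a b (a' - 1) b' +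
      qBrace b' * crossW n (-1) a b a' (b' - 1) := by
  rcases lt_trichotomy a' (a + 1) with hlt | rfl | hlt
  · obtain ⟨r, hr⟩ := Int.le.dest (Int.lt_add_one_iff.1 hlt)
    obtain rfl : a' = a - r := by omega
    obtain rfl : b' = b + r + 1 := by omega
    have w1 := crossW_neg n (a + 1) b (r + 1)
    have w2 := crossW_neg n a (b + 1) r
    have w3 := crossW_neg n a b (r + 1)
    have w4 := crossW_neg n a b r
    push_cast at w1 w3
    rw [show a + 1 - ((r : ℤ) + 1) = a - r by ring,
      show b + ((r : ℤ) + 1) = b + r + 1 by ring] at w1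
    rw [show b + 1 + (r : ℤ) = b + r + 1 by ring] at w2
    rw [show a - ((r : ℤ) + 1) = a - r - 1 by ring,
      show b + ((r : ℤ) + 1) = b + r + 1 by ring] at w3
    rw [w1, w2, w3, show b + (r : ℤ) + 1 - 1 = b + r by ring, w4]
    have key := cross_products n a b r
      (tq ((n - 2 * b - 2 * (r + 1)) * (n - 2 * (a + 1) + 2 * (r + 1)) + (r + 1) * (r + 1 - 1)))
      (tq (-2 * (n - 2 * a)) *
        tq ((n - 2 * (b + 1) - 2 * r) * (n - 2 * a + 2 * r) + r * (r - 1)))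
      (tq (-2 * (n - 2 * (b + r + 1))) *
        tq ((n - 2 * b - 2 * (r + 1)) * (n - 2 * a + 2 * (r + 1)) + (r + 1) * (r + 1 - 1)))
      (tq ((n - 2 * b - 2 * r) * (n - 2 * a + 2 * r) + r * (r - 1))) (by
        simp only [← tq_add]
        set B := (n - 2 * b - 2 * r) * (n - 2 * a + 2 * r) + r * (r - 1) with hB
        rw [show (n - 2 * b - 2 * ((r : ℤ) + 1)) * (n - 2 * (a + 1) + 2 * (r + 1)) +
              (r + 1) * (r + 1 - 1) = B - 2 * (n - 2 * a + 2 * r) + 2 * r by rw [hB]; ring,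
          show -2 * (n - 2 * a) + ((n - 2 * (b + 1) - 2 * (r : ℤ)) * (n - 2 * a + 2 * r) +
              r * (r - 1)) = B - 2 * (n - 2 * a) - 2 * (n - 2 * a + 2 * r) by rw [hB]; ring,
          show -2 * (n - 2 * (b + (r : ℤ) + 1)) + ((n - 2 * b - 2 * ((r : ℤ) + 1)) *
              (n - 2 * a + 2 * (r + 1)) + (r + 1) * (r + 1 - 1)) =
            B - 2 * (n - 2 * a + 2 * r) + 2 * r by rw [hB]; ring]
        simp only [qBrace, mul_sub, sub_mul, ← tq_add]
        ring_nf)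
    simp only [fNeg]
    push_cast
    rw [show n + ((r : ℤ) + 1) - (a + 1) = n + r - a by ring,
      show n + ((r : ℤ) + 1) - a = n + r + 1 - a by ring,
      show b + ((r : ℤ) + 1) = b + r + 1 by ring, show b + 1 + (r : ℤ) = b + r + 1 by ring]
    linear_combination key
  · obtain rfl : b' = b := by omega
    have w1 := crossW_neg n (a + 1) b' 0
    have w3 := crossW_neg n a b' 0
    simp only [Nat.cast_zero, sub_zero, add_zero] at w1 w3
    rw [w1, crossW_eq_zero (by omega), add_sub_cancel_right, w3, crossW_eq_zero (by omega)]
    simp only [fNeg, qBinomSymm, qPoch_zero, Nat.cast_zero, zero_mul, mul_zero, add_zero, sub_zero]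
    have : tq ((n - 2 * b') * (n - 2 * (a + 1))) =
        tq (-2 * (n - 2 * b')) * tq ((n - 2 * b') * (n - 2 * a)) := by
      rw [← tq_add]; congr 1; ring
    linear_combination qBrace (a + 1) * this
  · rw [crossW_eq_zero (by omega), crossW_eq_zero (by omega), crossW_eq_zero (by omega),
      crossW_eq_zero (by omega)]
    simp

/-! ### Extrema and crossings commute with the raising operator -/

/-- The action of `K⁻¹` on a strand of color `c`, directed upwards if `u` holds. -/
noncomputable def kap (n : ℤ) (u : Bool) (c : ℤ) : RatFunc ℚ :=
  tq (if u then -2 * (n - 2 * c) else 2 * (n - 2 * c))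

/-- The change of the color, read upwards, when `E` acts on a strand: along the orientation the
color increases by `1`. -/
def rise (u : Bool) : ℤ := if u then 1 else -1

/-- The coefficient with which `E` acts on a strand that has the color `x` below and the color
`x + rise u` above. On a descending strand this is the action on the dual representation. -/
noncomputable def ins (n : ℤ) (u : Bool) (x : ℤ) : RatFunc ℚ :=
  (if u then qBrace (x + 1) else -qBrace x) * tq (if u then 0 else 2 * (n - 2 * (x - 1)))

/-- The weight of a crossing with orientations `u₀`, `u₁` at the bottom left and at the bottom
right, and with colors `x₀`, `x₁` at the bottom and `y₀`, `y₁` at the top. -/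
noncomputable def crossCore (n : ℤ) (u₀ u₁ b : Bool) (x₀ x₁ y₀ y₁ : ℤ) : RatFunc ℚ :=
  if b then
    crossW n (1 * if u₀ = u₁ then 1 else -1) (if u₀ then x₀ else y₁) (if u₁ then x₁ else y₀)
      (if u₀ then y₁ else x₀) (if u₁ then y₀ else x₁)
  else
    crossW n (-1 * if u₀ = u₁ then 1 else -1) (if u₁ then x₁ else y₀) (if u₀ then x₀ else y₁)
      (if u₁ then y₀ else x₁) (if u₀ then y₁ else x₀)

/-- The weight of a crossing, including the rotation that comes from turning a crossing whose
strands run to the right. -/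
noncomputable def crossLoc (n : ℤ) (u₀ u₁ b : Bool) (x₀ x₁ y₀ y₁ : ℤ) : RatFunc ℚ :=
  crossCore n u₀ u₁ b x₀ x₁ y₀ y₁ * tq (if u₀ = true ∧ u₁ = false then 4 * (x₁ - y₀) else 0)

/-- The weight of a maximum whose left leg has the orientation `u`. -/
noncomputable def capLoc (n : ℤ) (u : Bool) (x₀ x₁ : ℤ) : RatFunc ℚ :=
  if x₀ = x₁ then tq (if u then 2 * (2 * x₀ - n) else 0) else 0

/-- The weight of a minimum whose left leg has the orientation `u`. -/
noncomputable def cupLoc (n : ℤ) (u : Bool) (y₀ y₁ : ℤ) : RatFunc ℚ :=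
  if y₀ = y₁ then tq (if u then 0 else -2 * (2 * y₀ - n)) else 0

/-- `crossW_pos_intertwines`, multiplied by a power of `t`: the form in which it occurs for the
other orientations of the strands. -/
theorem crossW_pos_intertwines_mul (F n a b a' b' : ℤ) (h : a + b + 1 = a' + b') :
    qBrace (a + 1) * crossW n 1 (a + 1) b a' b' * tq (F - 2 * (n - 2 * b)) +
      qBrace (b + 1) * crossW n 1 a (b + 1) a' b' * tq F -
      qBrace a' * crossW n 1 a b (a' - 1) b' * tq F -
      qBrace b' * crossW n 1 a b a' (b' - 1) * tq (F - 2 * (n - 2 * a')) = 0 := by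
  rw [show F - 2 * (n - 2 * b) = F + -2 * (n - 2 * b) by ring,
    show F - 2 * (n - 2 * a') = F + -2 * (n - 2 * a') by ring, tq_add, tq_add]
  linear_combination tq F * crossW_pos_intertwines n a b a' b' h

theorem crossW_neg_intertwines_mul (F n a b a' b' : ℤ) (h : a + b + 1 = a' + b') :
    qBrace (a + 1) * crossW n (-1) (a + 1) b a' b' * tq F +
      qBrace (b + 1) * crossW n (-1) a (b + 1) a' b' * tq (F - 2 * (n - 2 * a)) -
      qBrace a' * crossW n (-1) a b (a' - 1) b' * tq (F - 2 * (n - 2 * b')) -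
      qBrace b' * crossW n (-1) a b a' (b' - 1) * tq F = 0 := by
  rw [show F - 2 * (n - 2 * a) = F + -2 * (n - 2 * a) by ring,
    show F - 2 * (n - 2 * b') = F + -2 * (n - 2 * b') by ring, tq_add, tq_add]
  linear_combination tq F * crossW_neg_intertwines n a b a' b' h

/-- Crossings with any orientations commute with `E`. -/
theorem crossLoc_intertwines (n : ℤ) (u₀ u₁ b : Bool) (x₀ x₁ y₀ y₁ : ℤ) :
    ins n u₀ x₀ * kap n u₁ x₁ * crossLoc n u₀ u₁ b (x₀ + rise u₀) x₁ y₀ y₁ +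
      ins n u₁ x₁ * crossLoc n u₀ u₁ b x₀ (x₁ + rise u₁) y₀ y₁ =
    ins n u₁ (y₀ - rise u₁) * kap n u₀ y₁ * crossLoc n u₀ u₁ b x₀ x₁ (y₀ - rise u₁) y₁ +
      ins n u₀ (y₁ - rise u₀) * crossLoc n u₀ u₁ b x₀ x₁ y₀ (y₁ - rise u₀) := by
  have e3 : ∀ (P W : RatFunc ℚ) (i j k : ℤ),
      (P * tq i) * tq j * (W * tq k) = P * W * tq (i + j + k) := by
    intro P W i j k; rw [tq_add, tq_add]; ring
  have e2 : ∀ (P W : RatFunc ℚ) (i k : ℤ), (P * tq i) * (W * tq k) = P * W * tq (i + k) := by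
    intro P W i k; rw [tq_add]; ring
  rw [← sub_eq_zero]
  unfold ins kap crossLoc crossCore
  rw [e3, e3, e2, e2]
  -- All four weights vanish unless the inserted `E` makes up for the difference of the colors.
  by_cases h : (if u₀ then x₀ else y₁) + (if u₁ then x₁ else y₀) + 1 =
      (if u₀ then y₁ else x₀) + (if u₁ then y₀ else x₁)
  · cases u₀ <;> cases u₁ <;>
      simp only [rise, if_true, if_false, Bool.false_eq_true, and_false, and_true, and_self,
        Bool.true_eq_false, mul_one, one_mul] at h ⊢
    · obtain rfl : x₀ = y₁ + y₀ + 1 - x₁ := by omega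
      cases b <;> simp only [if_true, if_false, Bool.false_eq_true]
      · have := crossW_neg_intertwines_mul (2 * (n - 2 * y₁) + 2 * (n - 2 * y₀)) n y₀ y₁ x₁
          (y₁ + y₀ + 1 - x₁) (by ring)
        ring_nf at this ⊢
        linear_combination this
      · have := crossW_pos_intertwines_mul (2 * (n - 2 * y₁) + 2 * (n - 2 * y₀)) n y₁ y₀
          (y₁ + y₀ + 1 - x₁) x₁ (by ring)
        ring_nf at this ⊢
        linear_combination this
    · obtain rfl : x₀ = y₁ + x₁ + 1 - y₀ := by omega
      cases b <;> simp only [if_true, if_false, Bool.false_eq_true]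
      · have := crossW_pos_intertwines_mul (2 * (n - 2 * y₁)) n x₁ y₁ y₀
          (y₁ + x₁ + 1 - y₀) (by ring)
        ring_nf at this ⊢
        linear_combination this
      · have := crossW_neg_intertwines_mul (2 * (n - 2 * y₁)) n y₁ x₁
          (y₁ + x₁ + 1 - y₀) y₀ (by ring)
        ring_nf at this ⊢
        linear_combination this
    · obtain rfl : x₁ = x₀ + y₀ + 1 - y₁ := by omega
      cases b <;> simp only [if_true, if_false, Bool.false_eq_true]
      · have := crossW_pos_intertwines_mul (2 * (n - 2 * y₀) - 2 * (n - 2 * y₁) +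
          4 * (x₀ - y₁) + 2 * (n - 2 * x₀)) n y₀ x₀ (x₀ + y₀ + 1 - y₁) y₁ (by ring)
        ring_nf at this ⊢
        linear_combination this
      · have := crossW_neg_intertwines_mul (2 * n - 4 * y₀) n x₀ y₀ y₁ (x₀ + y₀ + 1 - y₁) (by ring)
        ring_nf at this ⊢
        linear_combination this
    · obtain rfl : y₁ = x₀ + x₁ + 1 - y₀ := by omega
      cases b <;> simp only [if_true, if_false, Bool.false_eq_true]
      · have := crossW_neg_intertwines_mul 0 n x₁ x₀ y₀ (x₀ + x₁ + 1 - y₀) (by ring)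
        ring_nf at this ⊢
        linear_combination this
      · have := crossW_pos_intertwines_mul 0 n x₀ x₁ (x₀ + x₁ + 1 - y₀) y₀ (by ring)
        ring_nf at this ⊢
        linear_combination this
  · cases u₀ <;> cases u₁ <;>
      simp only [rise, if_true, if_false, Bool.false_eq_true] at h ⊢ <;>
      cases b <;> simp only [if_true, if_false, Bool.false_eq_true] <;>
      rw [crossW_eq_zero (by omega), crossW_eq_zero (by omega), crossW_eq_zero (by omega),
        crossW_eq_zero (by omega)] <;> simp

/-- Colors are preserved at a crossing of nonzero weight. -/
theorem crossLoc_balance {n : ℤ} {u₀ u₁ b : Bool} {x₀ x₁ y₀ y₁ : ℤ}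
    (h : crossLoc n u₀ u₁ b x₀ x₁ y₀ y₁ ≠ 0) :
    (if u₀ then x₀ else y₁) + (if u₁ then x₁ else y₀) =
      (if u₀ then y₁ else x₀) + (if u₁ then y₀ else x₁) := by
  by_contra hc
  refine h ?_
  unfold crossLoc crossCore
  split_ifs at hc ⊢ <;> rw [crossW_eq_zero (by omega), zero_mul]

/-- Crossings commute with `K`. -/
theorem crossLoc_kap {n : ℤ} {u₀ u₁ b : Bool} {x₀ x₁ y₀ y₁ : ℤ}
    (h : crossLoc n u₀ u₁ b x₀ x₁ y₀ y₁ ≠ 0) :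
    kap n u₀ x₀ * kap n u₁ x₁ = kap n u₁ y₀ * kap n u₀ y₁ := by
  have := crossLoc_balance h
  unfold kap
  rw [← tq_add, ← tq_add]
  congr 1
  cases u₀ <;> cases u₁ <;> simp only [if_true, if_false, Bool.false_eq_true] at this ⊢ <;> linarith

/-- Maxima are invariant under `E`. -/
theorem capLoc_intertwines (n : ℤ) (u : Bool) (x₀ x₁ : ℤ) :
    ins n u x₀ * kap n (!u) x₁ * capLoc n u (x₀ + rise u) x₁ +
      ins n (!u) x₁ * capLoc n u x₀ (x₁ + rise (!u)) = 0 := by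
  unfold ins kap capLoc
  cases u <;> simp only [rise, if_true, if_false, Bool.false_eq_true, Bool.not_true, Bool.not_false]
  · by_cases h : x₀ = x₁ + 1
    · subst h
      simp only [show x₁ + 1 + -1 = x₁ by ring, if_true, add_sub_cancel_right, mul_assoc, ← tq_add]
      ring_nf
    · rw [if_neg (by omega), if_neg h]
      simp
  · by_cases h : x₁ = x₀ + 1
    · subst h
      simp only [show x₀ + 1 + -1 = x₀ by ring, if_true, add_sub_cancel_right, mul_assoc, ← tq_add]
      ring_nf
    · rw [if_neg (by omega), if_neg (by omega)]
      simp

/-- Minima are invariant under `E`. -/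
theorem cupLoc_intertwines (n : ℤ) (u : Bool) (y₀ y₁ : ℤ) :
    ins n u (y₀ - rise u) * kap n (!u) y₁ * cupLoc n u (y₀ - rise u) y₁ +
      ins n (!u) (y₁ - rise (!u)) * cupLoc n u y₀ (y₁ - rise (!u)) = 0 := by
  unfold ins kap cupLoc
  cases u <;> simp only [rise, if_true, if_false, Bool.false_eq_true, Bool.not_true, Bool.not_false]
  · by_cases h : y₁ = y₀ + 1
    · subst h
      simp only [sub_neg_eq_add, if_true, add_sub_cancel_right, mul_assoc, ← tq_add]
      ring_nf
    · rw [if_neg (by omega), if_neg (by omega)]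
      simp
  · by_cases h : y₀ = y₁ + 1
    · subst h
      simp only [sub_neg_eq_add, if_true, add_sub_cancel_right, mul_assoc, ← tq_add]
      ring_nf
    · rw [if_neg (by omega), if_neg (by omega)]
      simp

theorem kap_mul_kap_not (n : ℤ) (u : Bool) (c : ℤ) : kap n u c * kap n (!u) c = 1 := by
  unfold kap
  rw [← tq_add]
  cases u <;> simp

/-! ### The raising operator on a level -/

/-- The product of the actions of `K⁻¹` on the strands at the positions `a, …, b - 1`. -/
noncomputable def kapProd (n : ℤ) (u : ℕ → Bool) (x : ℕ → ℤ) (a b : ℕ) : RatFunc ℚ :=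
  ∏ p ∈ Ico a b, kap n (u p) (x p)

theorem kapProd_mul (n : ℤ) (u : ℕ → Bool) (x : ℕ → ℤ) {a b c : ℕ} (h : a ≤ b) (h' : b ≤ c) :
    kapProd n u x a b * kapProd n u x b c = kapProd n u x a c :=
  Finset.prod_Ico_consecutive _ h h'

theorem kapProd_congr {n : ℤ} {u u' : ℕ → Bool} {x x' : ℕ → ℤ} {a b : ℕ}
    (h : ∀ p, a ≤ p → p < b → u p = u' p ∧ x p = x' p) :
    kapProd n u x a b = kapProd n u' x' a b := by
  refine Finset.prod_congr rfl fun p hp => ?_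
  have := Finset.mem_Ico.1 hp
  rw [(h p this.1 this.2).1, (h p this.1 this.2).2]

theorem kapProd_shift {n : ℤ} {u u' : ℕ → Bool} {x x' : ℕ → ℤ} {a b a' b' : ℕ} (s : ℕ) {i : ℕ}
    (ha : a = b + i) (ha' : a' = b' + i)
    (h : ∀ j < s, u (b + j) = u' (b' + j)) (hx : ∀ j, i ≤ j → j < s → x (b + j) = x' (b' + j)) :
    kapProd n u x a (b + s) = kapProd n u' x' a' (b' + s) := by
  subst ha ha'
  unfold kapProd
  rw [Finset.prod_Ico_eq_prod_range, Finset.prod_Ico_eq_prod_range]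
  refine Finset.prod_congr (by congr 1; omega) fun k hk => ?_
  have hk := Finset.mem_range.1 hk
  rw [add_assoc, add_assoc, h _ (by omega), hx _ (by omega) (by omega)]

/-- The weight of a slice whose extremum or crossing, of weight `loc`, joins `b` bottom legs and `t`
top legs with `q` vertical strands on the left and `s` vertical strands on the right: it vanishes
unless the colors are constant along the vertical strands. -/
noncomputable def blockWeight (q b t s : ℕ) (loc : (ℕ → ℤ) → (ℕ → ℤ) → RatFunc ℚ) (x y : ℕ → ℤ) :
    RatFunc ℚ :=
  if (∀ p < q, x p = y p) ∧ ∀ i < s, x (q + b + i) = y (q + t + i) then loc x y else 0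

/-- The coefficient of the term in which `E` acts on the strand at position `p` of a level with `w`
strands. The function `x` gives the color of this strand below `E`, and the colors of the strands
to its right. -/
noncomputable def insCoeff (n : ℤ) (u : ℕ → Bool) (x : ℕ → ℤ) (w p : ℕ) : RatFunc ℚ :=
  ins n (u p) (x p) * kapProd n u x (p + 1) w

/-- The action of `E` at the position `p`, on colors read upwards. -/
def raiseAt (u : ℕ → Bool) (p : ℕ) (x : ℕ → ℤ) : ℕ → ℤ := Function.update x p (x p + rise (u p))

/-- The inverse of `raiseAt`. -/
def lowerAt (u : ℕ → Bool) (p : ℕ) (x : ℕ → ℤ) : ℕ → ℤ := Function.update x p (x p - rise (u p))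

@[simp] theorem raiseAt_same (u : ℕ → Bool) (p : ℕ) (x : ℕ → ℤ) :
    raiseAt u p x p = x p + rise (u p) := Function.update_self ..

@[simp] theorem lowerAt_same (u : ℕ → Bool) (p : ℕ) (x : ℕ → ℤ) :
    lowerAt u p x p = x p - rise (u p) := Function.update_self ..

theorem raiseAt_of_ne (u : ℕ → Bool) {p p' : ℕ} (h : p' ≠ p) (x : ℕ → ℤ) :
    raiseAt u p x p' = x p' := Function.update_of_ne h ..

theorem lowerAt_of_ne (u : ℕ → Bool) {p p' : ℕ} (h : p' ≠ p) (x : ℕ → ℤ) :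
    lowerAt u p x p' = x p' := Function.update_of_ne h ..

/-- If the local weight of a slice commutes with `E` and with `K`, then so does the slice. -/
theorem blockWeight_intertwines (n : ℤ) (q b t s : ℕ) (loc : (ℕ → ℤ) → (ℕ → ℤ) → RatFunc ℚ)
    (u u' : ℕ → Bool) (hu : ∀ p < q, u p = u' p) (hu' : ∀ i < s, u (q + b + i) = u' (q + t + i))
    (hx : ∀ x x' y, (∀ p, q ≤ p → p < q + b → x p = x' p) → loc x y = loc x' y)
    (hy : ∀ x y y', (∀ p, q ≤ p → p < q + t → y p = y' p) → loc x y = loc x y')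
    (hE : ∀ x y, ∑ i ∈ range b, insCoeff n u x (q + b) (q + i) * loc (raiseAt u (q + i) x) y =
      ∑ i ∈ range t, insCoeff n u' (lowerAt u' (q + i) y) (q + t) (q + i) *
        loc x (lowerAt u' (q + i) y))
    (hK : ∀ x y, loc x y ≠ 0 → kapProd n u x q (q + b) = kapProd n u' y q (q + t))
    (x y : ℕ → ℤ) :
    ∑ p ∈ range (q + b + s),
        insCoeff n u x (q + b + s) p * blockWeight q b t s loc (raiseAt u p x) y =
      ∑ p ∈ range (q + t + s), insCoeff n u' (lowerAt u' p y) (q + t + s) p *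
        blockWeight q b t s loc x (lowerAt u' p y) := by
  rw [Finset.sum_range_add, Finset.sum_range_add, Finset.sum_range_add _ (q + t),
    Finset.sum_range_add _ q t]
  congr 1
  · congr 1
    · -- `E` acts on a strand to the left: by `hK`, passing the extremum or crossing does not change
      -- the product of the actions of `K⁻¹` to its right.
      refine Finset.sum_congr rfl fun p hp => ?_
      have hp := Finset.mem_range.1 hp
      have hl : loc (raiseAt u p x) y = loc x y :=
        hx _ _ _ fun p' h _ => raiseAt_of_ne u (by omega) x
      have hl' : loc x (lowerAt u' p y) = loc x y :=
        hy _ _ _ fun p' h _ => lowerAt_of_ne u' (by omega) y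
      unfold blockWeight
      rw [hl, hl']
      by_cases hc : ((∀ p₁ < q, raiseAt u p x p₁ = y p₁) ∧
          ∀ i < s, raiseAt u p x (q + b + i) = y (q + t + i)) ∧ loc x y ≠ 0
      · obtain ⟨⟨h1, h2⟩, h0⟩ := hc
        have hxp : x p = y p - rise (u p) := by
          have := h1 p hp
          rw [raiseAt_same] at this
          linarith
        have h1' : ∀ p₁ < q, p₁ ≠ p → x p₁ = y p₁ := by
          intro p₁ h hne
          rw [← h1 p₁ h, raiseAt_of_ne u hne]
        have h2' : ∀ i < s, x (q + b + i) = y (q + t + i) := by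
          intro i hi
          rw [← h2 i hi, raiseAt_of_ne u (by omega)]
        rw [if_pos ⟨h1, h2⟩, if_pos]
        · congr 1
          unfold insCoeff
          rw [lowerAt_same, ← hu p hp, ← hxp]
          congr 1
          rw [← kapProd_mul n u x (b := q) (by omega) (by omega),
            ← kapProd_mul n u x (a := q) (b := q + b) (by omega) (by omega),
            ← kapProd_mul n u' _ (b := q) (by omega) (by omega),
            ← kapProd_mul n u' _ (a := q) (b := q + t) (by omega) (by omega), hK x y h0]
          congr 1
          · refine kapProd_congr fun p' h h' => ⟨hu p' h', ?_⟩
            rw [lowerAt_of_ne u' (by omega), h1' p' h' (by omega)]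
          · congr 1
            · refine kapProd_congr fun p' h h' => ⟨rfl, ?_⟩
              rw [lowerAt_of_ne u' (by omega)]
            · refine kapProd_shift s (i := 0) rfl rfl hu' fun j _ hj => ?_
              rw [lowerAt_of_ne u' (by omega), h2' j hj]
        · refine ⟨fun p' h' => ?_, fun i hi => ?_⟩
          · by_cases h : p' = p
            · subst h
              rw [lowerAt_same, hxp, hu p' hp]
            · rw [lowerAt_of_ne u' h, h1' p' h' h]
          · rw [lowerAt_of_ne u' (by omega), h2' i hi]
      · by_cases h0 : loc x y = 0
        · simp [h0]
        · rw [if_neg (fun h => hc ⟨h, h0⟩), if_neg, mul_zero, mul_zero]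
          rintro ⟨h1, h2⟩
          refine hc ⟨⟨fun p' h' => ?_, fun i hi => ?_⟩, h0⟩
          · by_cases h : p' = p
            · subst h
              have := h1 p' hp
              rw [lowerAt_same] at this
              rw [raiseAt_same, this, hu p' hp]
              ring
            · rw [raiseAt_of_ne u h, h1 p' h', lowerAt_of_ne u' h]
          · rw [raiseAt_of_ne u (by omega), h2 i hi, lowerAt_of_ne u' (by omega)]
    · -- `E` acts on a leg of the extremum or crossing: this is `hE`, up to the common factor from
      -- the strands to the right.
      by_cases hc : (∀ p < q, x p = y p) ∧ ∀ i < s, x (q + b + i) = y (q + t + i)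
      · have hb : ∀ i ∈ range b, insCoeff n u x (q + b + s) (q + i) *
              blockWeight q b t s loc (raiseAt u (q + i) x) y =
            kapProd n u x (q + b) (q + b + s) *
              (insCoeff n u x (q + b) (q + i) * loc (raiseAt u (q + i) x) y) := by
          intro i hi
          have hi := Finset.mem_range.1 hi
          unfold blockWeight insCoeff
          rw [if_pos, ← kapProd_mul n u x (b := q + b) (by omega) (by omega)]
          · ring
          · refine ⟨fun p' h' => ?_, fun j hj => ?_⟩
            · rw [raiseAt_of_ne u (by omega), hc.1 p' h']
            · rw [raiseAt_of_ne u (by omega), hc.2 j hj]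
        have ht : ∀ i ∈ range t, insCoeff n u' (lowerAt u' (q + i) y) (q + t + s) (q + i) *
              blockWeight q b t s loc x (lowerAt u' (q + i) y) =
            kapProd n u x (q + b) (q + b + s) *
              (insCoeff n u' (lowerAt u' (q + i) y) (q + t) (q + i) *
                loc x (lowerAt u' (q + i) y)) := by
          intro i hi
          have hi := Finset.mem_range.1 hi
          have hk : kapProd n u x (q + b) (q + b + s) =
              kapProd n u' (lowerAt u' (q + i) y) (q + t) (q + t + s) := by
            refine kapProd_shift s (i := 0) rfl rfl hu' fun j _ hj => ?_
            rw [lowerAt_of_ne u' (by omega), hc.2 j hj]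
          unfold blockWeight insCoeff
          rw [if_pos, ← kapProd_mul n u' _ (b := q + t) (by omega) (by omega), hk]
          · ring
          · refine ⟨fun p' h' => ?_, fun j hj => ?_⟩
            · rw [lowerAt_of_ne u' (by omega), hc.1 p' h']
            · rw [lowerAt_of_ne u' (by omega), hc.2 j hj]
        rw [Finset.sum_congr rfl hb, Finset.sum_congr rfl ht, ← Finset.mul_sum, ← Finset.mul_sum,
          hE x y]
      · rw [Finset.sum_eq_zero, Finset.sum_eq_zero]
        · intro i hi
          have hi := Finset.mem_range.1 hi
          unfold blockWeight
          rw [if_neg, mul_zero]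
          refine fun h => hc ⟨fun p' h' => ?_, fun j hj => ?_⟩
          · rw [h.1 p' h', lowerAt_of_ne u' (by omega)]
          · rw [h.2 j hj, lowerAt_of_ne u' (by omega)]
        · intro i hi
          have hi := Finset.mem_range.1 hi
          unfold blockWeight
          rw [if_neg, mul_zero]
          refine fun h => hc ⟨fun p' h' => ?_, fun j hj => ?_⟩
          · rw [← h.1 p' h', raiseAt_of_ne u (by omega)]
          · rw [← h.2 j hj, raiseAt_of_ne u (by omega)]
  · -- strands on the right
    refine Finset.sum_congr rfl fun i hi => ?_
    have hi := Finset.mem_range.1 hi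
    have hl : loc (raiseAt u (q + b + i) x) y = loc x y :=
      hx _ _ _ fun p' _ h => raiseAt_of_ne u (by omega) x
    have hl' : loc x (lowerAt u' (q + t + i) y) = loc x y :=
      hy _ _ _ fun p' _ h => lowerAt_of_ne u' (by omega) y
    unfold blockWeight
    rw [hl, hl']
    by_cases hc : (∀ p₁ < q, raiseAt u (q + b + i) x p₁ = y p₁) ∧
        ∀ j < s, raiseAt u (q + b + i) x (q + b + j) = y (q + t + j)
    · obtain ⟨h1, h2⟩ := hc
      have hxp : x (q + b + i) = y (q + t + i) - rise (u (q + b + i)) := by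
        have := h2 i hi
        rw [raiseAt_same] at this
        linarith
      have h1' : ∀ p₁ < q, x p₁ = y p₁ := by
        intro p₁ h
        rw [← h1 p₁ h, raiseAt_of_ne u (by omega)]
      have h2' : ∀ j < s, j ≠ i → x (q + b + j) = y (q + t + j) := by
        intro j hj hne
        rw [← h2 j hj, raiseAt_of_ne u (by omega)]
      rw [if_pos ⟨h1, h2⟩, if_pos]
      · congr 1
        unfold insCoeff
        rw [lowerAt_same, ← hu' i hi, ← hxp]
        congr 1
        refine kapProd_shift s (i := i + 1) (by ring) (by ring) hu' fun j hj hj' => ?_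
        rw [lowerAt_of_ne u' (by omega), h2' j hj' (by omega)]
      · refine ⟨fun p' h' => ?_, fun j hj => ?_⟩
        · rw [lowerAt_of_ne u' (by omega), h1' p' h']
        · by_cases h : j = i
          · subst h
            rw [lowerAt_same, hxp, hu' j hi]
          · rw [lowerAt_of_ne u' (by omega), h2' j hj h]
    · rw [if_neg hc, if_neg, mul_zero, mul_zero]
      rintro ⟨h1, h2⟩
      refine hc ⟨fun p' h' => ?_, fun j hj => ?_⟩
      · rw [raiseAt_of_ne u (by omega), h1 p' h', lowerAt_of_ne u' (by omega)]
      · by_cases h : j = i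
        · subst h
          have := h2 j hi
          rw [lowerAt_same] at this
          rw [raiseAt_same, this, hu' j hi]
          ring
        · rw [raiseAt_of_ne u (by omega), h2 j hj, lowerAt_of_ne u' (by omega)]

/-! ### The operators of the slices -/

/-- The weight of a crossing vanishes when the overcrossing strand arrives with the color `n + 1`:
the product of quantum integers contains the factor `{0}`. -/
theorem crossW_eq_zero_of_over {n ε a b a' b' : ℤ} (ha : a = n + 1) (ha' : a' ≤ n) :
    crossW n ε a b a' b' = 0 := by
  unfold crossW
  split_ifs with h1 h2
  · have : qPoch (n + (a - a').toNat - a) (a - a').toNat = 0 := by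
      refine Finset.prod_eq_zero (i := (a - a').toNat - 1) (Finset.mem_range.2 (by omega)) ?_
      rw [show n + ((a - a').toNat : ℤ) - a - (((a - a').toNat - 1 : ℕ) : ℤ) = 0 by omega,
        qBrace_zero]
    rw [fPos, this, mul_zero]
  · have : qPoch (n + (a - a').toNat - a) (a - a').toNat = 0 := by
      refine Finset.prod_eq_zero (i := (a - a').toNat - 1) (Finset.mem_range.2 (by omega)) ?_
      rw [show n + ((a - a').toNat : ℤ) - a - (((a - a').toNat - 1 : ℕ) : ℤ) = 0 by omega,
        qBrace_zero]
    rw [fNeg, this, mul_zero]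
  · rfl

/-- The color of the undercrossing strand cannot decrease. -/
theorem crossW_eq_zero_of_under {n ε a b a' b' : ℤ} (hb : b = n + 1) (hb' : b' ≤ n) :
    crossW n ε a b a' b' = 0 := crossW_eq_zero (by omega)

namespace LongProjection

variable (D : LongProjection)

/-- The weight of the slice above level `k`, for colors `x` of level `k` and `y` of level
`k + 1`. -/
noncomputable def sliceWeight (n : ℤ) (k : ℕ) : (ℕ → ℤ) → (ℕ → ℤ) → RatFunc ℚ :=
  match D.slice k with
  | Slice.cup q => blockWeight q 0 2 (D.width k - q)
      fun _ y => cupLoc n (D.up (k + 1) q) (y q) (y (q + 1))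
  | Slice.cap q => blockWeight q 2 0 (D.width (k + 1) - q)
      fun x _ => capLoc n (D.up k q) (x q) (x (q + 1))
  | Slice.cross q b => blockWeight q 2 2 (D.width k - q - 2)
      fun x y => crossLoc n (D.up k q) (D.up k (q + 1)) b (x q) (x (q + 1)) (y q) (y (q + 1))

variable {D}

theorem sliceWeight_cup {n : ℤ} {k q : ℕ} (hs : D.slice k = Slice.cup q) :
    D.sliceWeight n k = blockWeight q 0 2 (D.width k - q)
      fun _ y => cupLoc n (D.up (k + 1) q) (y q) (y (q + 1)) := by
  rw [sliceWeight, hs]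

theorem sliceWeight_cap {n : ℤ} {k q : ℕ} (hs : D.slice k = Slice.cap q) :
    D.sliceWeight n k = blockWeight q 2 0 (D.width (k + 1) - q)
      fun x _ => capLoc n (D.up k q) (x q) (x (q + 1)) := by
  rw [sliceWeight, hs]

theorem sliceWeight_cross {n : ℤ} {k q : ℕ} {b : Bool} (hs : D.slice k = Slice.cross q b) :
    D.sliceWeight n k = blockWeight q 2 2 (D.width k - q - 2)
      fun x y => crossLoc n (D.up k q) (D.up k (q + 1)) b (x q) (x (q + 1)) (y q) (y (q + 1)) := by
  rw [sliceWeight, hs]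

/-- Widths and orientations above and below a minimum. -/
theorem up_cup {k q : ℕ} (hk : k < D.height) (hs : D.slice k = Slice.cup q) :
    D.width k = q + (D.width k - q) ∧ D.width (k + 1) = q + 2 + (D.width k - q) ∧
    (∀ p < q, D.up k p = D.up (k + 1) p) ∧
    (∀ i < D.width k - q, D.up k (q + i) = D.up (k + 1) (q + 2 + i)) ∧
    D.up (k + 1) (q + 1) = !D.up (k + 1) q := by
  have hf := D.fits k hk
  have ho := D.orient k hk
  rw [hs] at hf ho
  obtain ⟨h1, h2⟩ := hf
  refine ⟨by omega, by omega, fun p hp => ?_, fun i hi => ?_, ?_⟩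
  · have := ho (false, p) (by simp; omega)
    simpa [Slice.mate, hp] using this.symm
  · have := ho (false, q + i) (by simp; omega)
    rw [show q + 2 + i = q + i + 2 by ring]
    simpa [Slice.mate] using this.symm
  · have := ho (true, q) (by simp; omega)
    simpa [Slice.mate] using this

/-- Widths and orientations above and below a maximum. -/
theorem up_cap {k q : ℕ} (hk : k < D.height) (hs : D.slice k = Slice.cap q) :
    D.width k = q + 2 + (D.width (k + 1) - q) ∧ D.width (k + 1) = q + (D.width (k + 1) - q) ∧
    (∀ p < q, D.up k p = D.up (k + 1) p) ∧
    (∀ i < D.width (k + 1) - q, D.up k (q + 2 + i) = D.up (k + 1) (q + i)) ∧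
    D.up k (q + 1) = !D.up k q := by
  have hf := D.fits k hk
  have ho := D.orient k hk
  rw [hs] at hf ho
  obtain ⟨h1, h2⟩ := hf
  refine ⟨by omega, by omega, fun p hp => ?_, fun i hi => ?_, ?_⟩
  · have := ho (true, p) (by simp; omega)
    simpa [Slice.mate, hp] using this
  · have := ho (true, q + i) (by simp; omega)
    rw [show q + 2 + i = q + i + 2 by ring]
    simpa [Slice.mate] using this
  · have := ho (false, q) (by simp; omega)
    simpa [Slice.mate] using this

/-- Widths and orientations above and below a crossing. -/
theorem up_cross {k q : ℕ} {b : Bool} (hk : k < D.height) (hs : D.slice k = Slice.cross q b) :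
    D.width k = q + 2 + (D.width k - q - 2) ∧ D.width (k + 1) = q + 2 + (D.width k - q - 2) ∧
    (∀ p < q, D.up k p = D.up (k + 1) p) ∧
    (∀ i < D.width k - q - 2, D.up k (q + 2 + i) = D.up (k + 1) (q + 2 + i)) ∧
    D.up (k + 1) (q + 1) = D.up k q ∧ D.up (k + 1) q = D.up k (q + 1) := by
  have hf := D.fits k hk
  have ho := D.orient k hk
  rw [hs] at hf ho
  obtain ⟨h1, h2⟩ := hf
  refine ⟨by omega, by omega, fun p hp => ?_, fun i hi => ?_, ?_, ?_⟩
  · have := ho (false, p) (by simp; omega)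
    simpa [Slice.mate, hp.ne, (show p ≠ q + 1 by omega)] using this.symm
  · have := ho (false, q + 2 + i) (by simp; omega)
    simpa [Slice.mate, (show q + 2 + i ≠ q by omega), (show q + 2 + i ≠ q + 1 by omega)]
      using this.symm
  · have := ho (false, q) (by simp; omega)
    simpa [Slice.mate] using this
  · have := ho (false, q + 1) (by simp; omega)
    simpa [Slice.mate] using this

theorem insCoeff_two_left (n : ℤ) (u : ℕ → Bool) (x : ℕ → ℤ) (q : ℕ) :
    insCoeff n u x (q + 2) (q + 0) = ins n (u q) (x q) * kap n (u (q + 1)) (x (q + 1)) := by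
  simp [insCoeff, kapProd]

theorem insCoeff_two_right (n : ℤ) (u : ℕ → Bool) (x : ℕ → ℤ) (q : ℕ) :
    insCoeff n u x (q + 2) (q + 1) = ins n (u (q + 1)) (x (q + 1)) := by
  simp [insCoeff, kapProd]

theorem kapProd_two (n : ℤ) (u : ℕ → Bool) (x : ℕ → ℤ) (q : ℕ) :
    kapProd n u x q (q + 2) = kap n (u q) (x q) * kap n (u (q + 1)) (x (q + 1)) := by
  rw [kapProd, Finset.prod_Ico_succ_top (by omega), Finset.prod_Ico_succ_top (by omega)]
  simp

theorem kapProd_self (n : ℤ) (u : ℕ → Bool) (x : ℕ → ℤ) (q : ℕ) : kapProd n u x q q = 1 := by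
  simp [kapProd]

/-- Every slice commutes with `E`. -/
theorem sliceWeight_intertwines (n : ℤ) {k : ℕ} (hk : k < D.height) (x y : ℕ → ℤ) :
    ∑ p ∈ range (D.width k),
        insCoeff n (D.up k) x (D.width k) p * D.sliceWeight n k (raiseAt (D.up k) p x) y =
      ∑ p ∈ range (D.width (k + 1)),
        insCoeff n (D.up (k + 1)) (lowerAt (D.up (k + 1)) p y) (D.width (k + 1)) p *
          D.sliceWeight n k x (lowerAt (D.up (k + 1)) p y) := by
  rcases hs : D.slice k with q | q | ⟨q, b⟩
  · obtain ⟨h1, h2, h3, h4, h5⟩ := up_cup hk hs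
    rw [sliceWeight_cup hs]
    generalize D.width k - q = s at *
    rw [h1, h2]
    refine blockWeight_intertwines n q 0 2 s
      (fun _ y => cupLoc n (D.up (k + 1) q) (y q) (y (q + 1))) _ _ h3 h4 (fun _ _ _ _ => rfl)
      (fun _ y y' h => ?_) (fun x y => ?_) (fun x y h => ?_) x y
    · simp only [h q le_rfl (by omega), h (q + 1) (by omega) (by omega)]
    · rw [Finset.sum_range_zero, Finset.sum_range_succ, Finset.sum_range_one, insCoeff_two_left,
        insCoeff_two_right, add_zero, lowerAt_same, lowerAt_same,
        lowerAt_of_ne _ (show q + 1 ≠ q by omega), lowerAt_of_ne _ (show q ≠ q + 1 by omega), h5,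
        cupLoc_intertwines]
    · have h : cupLoc n (D.up (k + 1) q) (y q) (y (q + 1)) ≠ 0 := h
      have : y q = y (q + 1) := by
        by_contra hc
        exact h (if_neg hc)
      rw [add_zero, kapProd_self, kapProd_two, h5, ← this, kap_mul_kap_not]
  · obtain ⟨h1, h2, h3, h4, h5⟩ := up_cap hk hs
    rw [sliceWeight_cap hs]
    generalize D.width (k + 1) - q = s at *
    rw [h1, h2]
    refine blockWeight_intertwines n q 2 0 s
      (fun x _ => capLoc n (D.up k q) (x q) (x (q + 1))) _ _ h3 h4 (fun x x' _ h => ?_)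
      (fun _ _ _ _ => rfl) (fun x y => ?_) (fun x y h => ?_) x y
    · simp only [h q le_rfl (by omega), h (q + 1) (by omega) (by omega)]
    · rw [Finset.sum_range_zero, Finset.sum_range_succ, Finset.sum_range_one, insCoeff_two_left,
        insCoeff_two_right, add_zero, raiseAt_same, raiseAt_same,
        raiseAt_of_ne _ (show q + 1 ≠ q by omega), raiseAt_of_ne _ (show q ≠ q + 1 by omega), h5,
        capLoc_intertwines]
    · have h : capLoc n (D.up k q) (x q) (x (q + 1)) ≠ 0 := h
      have : x q = x (q + 1) := by
        by_contra hc
        exact h (if_neg hc)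
      rw [add_zero, kapProd_self, kapProd_two, h5, ← this, kap_mul_kap_not]
  · obtain ⟨h1, h2, h3, h4, h5, h6⟩ := up_cross hk hs
    rw [sliceWeight_cross hs]
    generalize D.width k - q - 2 = s at *
    rw [h1, h2]
    refine blockWeight_intertwines n q 2 2 s
      (fun x y => crossLoc n (D.up k q) (D.up k (q + 1)) b (x q) (x (q + 1)) (y q) (y (q + 1)))
      _ _ h3 h4 (fun x x' _ h => ?_)
      (fun _ y y' h => ?_) (fun x y => ?_) (fun x y h => ?_) x y
    · simp only [h q le_rfl (by omega), h (q + 1) (by omega) (by omega)]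
    · simp only [h q le_rfl (by omega), h (q + 1) (by omega) (by omega)]
    · rw [Finset.sum_range_succ, Finset.sum_range_one, Finset.sum_range_succ, Finset.sum_range_one,
        insCoeff_two_left, insCoeff_two_right, insCoeff_two_left, insCoeff_two_right, add_zero,
        lowerAt_same, lowerAt_same, raiseAt_same, raiseAt_same,
        lowerAt_of_ne _ (show q + 1 ≠ q by omega), lowerAt_of_ne _ (show q ≠ q + 1 by omega),
        raiseAt_of_ne _ (show q + 1 ≠ q by omega), raiseAt_of_ne _ (show q ≠ q + 1 by omega),
        h5, h6, crossLoc_intertwines]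
    · rw [kapProd_two, kapProd_two, h5, h6]
      exact crossLoc_kap h

/-- The color `n + 1` cannot enter a slice from below. -/
theorem sliceWeight_eq_zero_of_bottom {n : ℤ} {k p : ℕ} (hk : k < D.height) (hp : p < D.width k)
    (hu : D.up k p = true) {x y : ℕ → ℤ} (hxp : x p = n + 1) (hx : ∀ p' ≠ p, x p' ≤ n)
    (hy : ∀ p', y p' ≤ n) : D.sliceWeight n k x y = 0 := by
  have hxy : ∀ p', x p ≠ y p' := fun p' h => by have := hy p'; omega
  unfold sliceWeight
  rcases hs : D.slice k with q | q | ⟨q, b⟩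
  · obtain ⟨h1, h2, h3, h4, h5⟩ := up_cup hk hs
    refine if_neg fun ⟨h, h'⟩ => ?_
    rcases lt_or_ge p q with hq | hq
    · exact hxy _ (h p hq)
    · obtain ⟨i, rfl⟩ := Nat.exists_eq_add_of_le hq
      exact hxy _ (h' i (by omega))
  · obtain ⟨h1, h2, h3, h4, h5⟩ := up_cap hk hs
    simp only [blockWeight]
    split_ifs with hc
    · obtain ⟨h, h'⟩ := hc
      rcases lt_or_ge p q with hq | hq
      · exact absurd (h p hq) (hxy _)
      · rcases lt_or_ge p (q + 2) with hq2 | hq2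
        · refine if_neg fun he => ?_
          obtain rfl | rfl : p = q ∨ p = q + 1 := by omega
          · have := hx (p + 1) (by omega)
            omega
          · have := hx q (by omega)
            omega
        · obtain ⟨i, rfl⟩ := Nat.exists_eq_add_of_le hq2
          exact absurd (h' i (by omega)) (hxy _)
    · rfl
  · obtain ⟨h1, h2, h3, h4, h5⟩ := up_cross hk hs
    simp only [blockWeight]
    split_ifs with hc
    · obtain ⟨h, h'⟩ := hc
      rcases lt_or_ge p q with hq | hq
      · exact absurd (h p hq) (hxy _)
      · rcases lt_or_ge p (q + 2) with hq2 | hq2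
        · have hy0 := hy q
          have hy1 := hy (q + 1)
          obtain rfl | rfl : p = q ∨ p = q + 1 := by omega
          · unfold crossLoc crossCore
            rw [hu]
            simp only [if_true]
            split_ifs <;>
              first
              | rw [crossW_eq_zero_of_over hxp hy1, zero_mul]
              | rw [crossW_eq_zero_of_under hxp hy1, zero_mul]
          · unfold crossLoc crossCore
            rw [hu]
            simp only [if_true]
            cases b <;> simp only [if_true, if_false, Bool.false_eq_true] <;>
              first
              | rw [crossW_eq_zero_of_over hxp hy0, zero_mul]
              | rw [crossW_eq_zero_of_under hxp hy0, zero_mul]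
        · obtain ⟨i, rfl⟩ := Nat.exists_eq_add_of_le hq2
          exact absurd (h' i (by omega)) (hxy _)
    · rfl

/-- The color `n + 1` cannot enter a slice from above. -/
theorem sliceWeight_eq_zero_of_top {n : ℤ} {k p : ℕ} (hk : k < D.height)
    (hp : p < D.width (k + 1)) (hu : D.up (k + 1) p = false) {x y : ℕ → ℤ} (hyp : y p = n + 1)
    (hy : ∀ p' ≠ p, y p' ≤ n) (hx : ∀ p', x p' ≤ n) : D.sliceWeight n k x y = 0 := by
  have hxy : ∀ p', x p' ≠ y p := fun p' h => by have := hx p'; omega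
  unfold sliceWeight
  rcases hs : D.slice k with q | q | ⟨q, b⟩
  · obtain ⟨h1, h2, h3, h4, h5⟩ := up_cup hk hs
    simp only [blockWeight]
    split_ifs with hc
    · obtain ⟨h, h'⟩ := hc
      rcases lt_or_ge p q with hq | hq
      · exact absurd (h p hq) (hxy _)
      · rcases lt_or_ge p (q + 2) with hq2 | hq2
        · refine if_neg fun he => ?_
          obtain rfl | rfl : p = q ∨ p = q + 1 := by omega
          · have := hy (p + 1) (by omega)
            omega
          · have := hy q (by omega)
            omega
        · obtain ⟨i, rfl⟩ := Nat.exists_eq_add_of_le hq2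
          exact absurd (h' i (by omega)) (hxy _)
    · rfl
  · obtain ⟨h1, h2, h3, h4, h5⟩ := up_cap hk hs
    refine if_neg fun ⟨h, h'⟩ => ?_
    rcases lt_or_ge p q with hq | hq
    · exact hxy _ (h p hq)
    · obtain ⟨i, rfl⟩ := Nat.exists_eq_add_of_le hq
      exact hxy _ (h' i (by omega))
  · obtain ⟨h1, h2, h3, h4, h5, h6⟩ := up_cross hk hs
    simp only [blockWeight]
    split_ifs with hc
    · obtain ⟨h, h'⟩ := hc
      rcases lt_or_ge p q with hq | hq
      · exact absurd (h p hq) (hxy _)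
      · rcases lt_or_ge p (q + 2) with hq2 | hq2
        · have hx0 := hx q
          have hx1 := hx (q + 1)
          obtain rfl | rfl : p = q ∨ p = q + 1 := by omega
          · rw [h6] at hu
            unfold crossLoc crossCore
            rw [hu]
            cases b <;> simp only [if_true, if_false, Bool.false_eq_true] <;>
              first
              | rw [crossW_eq_zero_of_over hyp hx1, zero_mul]
              | rw [crossW_eq_zero_of_under hyp hx1, zero_mul]
          · rw [h5] at hu
            unfold crossLoc crossCore
            rw [hu]
            cases b <;> simp only [if_true, if_false, Bool.false_eq_true] <;>
              first
              | rw [crossW_eq_zero_of_over hyp hx0, zero_mul]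
              | rw [crossW_eq_zero_of_under hyp hx0, zero_mul]
        · obtain ⟨i, rfl⟩ := Nat.exists_eq_add_of_le hq2
          exact absurd (h' i (by omega)) (hxy _)
    · rfl

end LongProjection

/-! ### The operator of the long component -/

/-- A sum over a finite set does not change when the summand is shifted by a permutation, if the
summand vanishes wherever the permutation leads out of the set or into it. -/
theorem sum_comp_perm_of_vanish {α M : Type*} [AddCommMonoid M] (S : Finset α) (e : Equiv.Perm α)
    (F : α → M) (h1 : ∀ c ∈ S, e.symm c ∉ S → F (e.symm c) = 0)
    (h2 : ∀ c ∈ S, e c ∉ S → F c = 0) : ∑ c ∈ S, F (e.symm c) = ∑ c ∈ S, F c := by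
  refine Finset.sum_bij_ne_zero (fun c _ _ => e.symm c) (fun c hc h0 => ?_)
    (fun c _ _ c' _ _ h => e.symm.injective h) (fun c hc h0 => ?_) (fun _ _ _ => rfl)
  · by_contra hn
    exact h0 (h1 c hc hn)
  · refine ⟨e c, ?_, by simpa using h0, by simp⟩
    by_contra hn
    exact h0 (h2 c hc hn)

namespace LongProjection

variable (D : LongProjection)

/-- The top end of the long component. -/
def top : D.Point := ⟨(D.height, 0), le_rfl, by simp [D.width_top]⟩

/-- The point at position `p` of level `k`. -/
def pointAt (k p : ℕ) (h : k ≤ D.height ∧ p < D.width k) : D.Point := ⟨(k, p), h⟩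

variable {D}

/-- The colors of a coloring, level by level. -/
noncomputable def levels (c : D.Point → ℤ) (k p : ℕ) : ℤ :=
  if h : k ≤ D.height ∧ p < D.width k then c (D.pointAt k p h) else 0

theorem levels_apply (c : D.Point → ℤ) (x : D.Point) : levels c x.1.1 x.1.2 = c x := by
  rw [levels, dif_pos x.2]
  rfl

theorem levels_update (c : D.Point → ℤ) (x : D.Point) (v : ℤ) :
    levels (Function.update c x v) =
      Function.update (levels c) x.1.1 (Function.update (levels c x.1.1) x.1.2 v) := by
  funext k p
  by_cases hk : k = x.1.1
  · subst hk
    rw [Function.update_self]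
    by_cases hp : p = x.1.2
    · subst hp
      rw [Function.update_self, levels_apply, Function.update_self]
    · rw [Function.update_of_ne hp]
      unfold levels
      split_ifs with h
      · refine Function.update_of_ne (fun e : D.pointAt _ p h = x => hp ?_) v c
        exact congrArg (fun z : D.Point => z.1.2) e
      · rfl
  · rw [Function.update_of_ne hk]
    unfold levels
    split_ifs with h
    · refine Function.update_of_ne (fun e : D.pointAt k p h = x => hk ?_) v c
      exact congrArg (fun z : D.Point => z.1.1) e
    · rfl

/-- The action of `E` at the point `x`, on colors read upwards. -/
noncomputable def raisePoint (x : D.Point) : Equiv.Perm (D.Point → ℤ) where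
  toFun c := Function.update c x (c x + rise (D.isUp x))
  invFun c := Function.update c x (c x - rise (D.isUp x))
  left_inv c := by simp
  right_inv c := by simp

theorem levels_raisePoint (c : D.Point → ℤ) (x : D.Point) :
    levels (raisePoint x c) =
      Function.update (levels c) x.1.1 (raiseAt (D.up x.1.1) x.1.2 (levels c x.1.1)) := by
  change levels (Function.update _ _ _) = _
  rw [levels_update, raiseAt, levels_apply]
  rfl

theorem levels_raisePoint_symm (c : D.Point → ℤ) (x : D.Point) :
    levels ((raisePoint x).symm c) =
      Function.update (levels c) x.1.1 (lowerAt (D.up x.1.1) x.1.2 (levels c x.1.1)) := by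
  change levels (Function.update _ _ _) = _
  rw [levels_update, lowerAt, levels_apply]
  rfl

variable (D)

/-- The product of the weights of all slices, where `ξ` holds the colors of the levels as seen from
below and `η` those as seen from above. -/
noncomputable def transfer (n : ℤ) (ξ η : ℕ → ℕ → ℤ) : RatFunc ℚ :=
  ∏ k ∈ range D.height, D.sliceWeight n k (η k) (ξ (k + 1))

/-- The colorings of all points by `0, …, n` with the given colors of the two ends of the long
component. -/
noncomputable def boxed (n a b : ℤ) : Finset (D.Point → ℤ) :=
  (Fintype.piFinset fun _ => Icc 0 n).filter fun c => c D.bottom = a ∧ c D.top = b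

/-- The matrix entry of the operator of the long component. -/
noncomputable def levelSum (n a b : ℤ) : RatFunc ℚ :=
  ∑ c ∈ D.boxed n a b, D.transfer n (levels c) (levels c)

/-- The matrix entry between `a` and `a + 1` of the operator of the long component with `E` inserted
at level `k`; the colorings show the colors below `E`. -/
noncomputable def insertSum (n a : ℤ) (k : ℕ) : RatFunc ℚ :=
  ∑ c ∈ D.boxed n a (a + 1), ∑ p ∈ range (D.width k),
    insCoeff n (D.up k) (levels c k) (D.width k) p *
      D.transfer n (levels c) (Function.update (levels c) k (raiseAt (D.up k) p (levels c k)))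

/-- The same entry, in terms of the colors above `E`. -/
noncomputable def insertSumAbove (n a : ℤ) (k : ℕ) : RatFunc ℚ :=
  ∑ c ∈ D.boxed n a (a + 1), ∑ p ∈ range (D.width k),
    insCoeff n (D.up k) (lowerAt (D.up k) p (levels c k)) (D.width k) p *
      D.transfer n (Function.update (levels c) k (lowerAt (D.up k) p (levels c k))) (levels c)

variable {D}

theorem transfer_update_right (n : ℤ) (ξ η : ℕ → ℕ → ℤ) {k : ℕ} (hk : k < D.height) (x : ℕ → ℤ) :
    D.transfer n ξ (Function.update η k x) = D.sliceWeight n k x (ξ (k + 1)) *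
      ∏ l ∈ (range D.height).erase k, D.sliceWeight n l (η l) (ξ (l + 1)) := by
  unfold transfer
  rw [← Finset.mul_prod_erase _ _ (Finset.mem_range.2 hk), Function.update_self]
  congr 1
  refine Finset.prod_congr rfl fun l hl => ?_
  rw [Function.update_of_ne (Finset.ne_of_mem_erase hl)]

theorem transfer_update_left (n : ℤ) (ξ η : ℕ → ℕ → ℤ) {k : ℕ} (hk : k < D.height) (y : ℕ → ℤ) :
    D.transfer n (Function.update ξ (k + 1) y) η = D.sliceWeight n k (η k) y *
      ∏ l ∈ (range D.height).erase k, D.sliceWeight n l (η l) (ξ (l + 1)) := by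
  unfold transfer
  rw [← Finset.mul_prod_erase _ _ (Finset.mem_range.2 hk), Function.update_self]
  congr 1
  refine Finset.prod_congr rfl fun l hl => ?_
  have := Finset.ne_of_mem_erase hl
  rw [Function.update_of_ne (by omega)]

/-- `E` may be moved through a slice. -/
theorem insertSum_eq_above (n a : ℤ) {k : ℕ} (hk : k < D.height) :
    D.insertSum n a k = D.insertSumAbove n a (k + 1) := by
  refine Finset.sum_congr rfl fun c _ => ?_
  simp only [transfer_update_right _ _ _ hk, transfer_update_left _ _ _ hk, ← mul_assoc]
  rw [← Finset.sum_mul, ← Finset.sum_mul, sliceWeight_intertwines n hk]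

theorem mem_boxed {n a b : ℤ} {c : D.Point → ℤ} :
    c ∈ D.boxed n a b ↔ (∀ x, 0 ≤ c x ∧ c x ≤ n) ∧ c D.bottom = a ∧ c D.top = b := by
  simp [boxed, Fintype.mem_piFinset]

theorem levels_le {n : ℤ} (hn : 0 ≤ n) {c : D.Point → ℤ} (h : ∀ x, 0 ≤ c x ∧ c x ≤ n) (k p : ℕ) :
    levels c k p ≤ n := by
  unfold levels
  split_ifs
  · exact (h _).2
  · exact hn

/-- `E` does not lead from the color `-1` to the color `0`. -/
theorem ins_eq_zero {n : ℤ} {u : Bool} {x : ℤ} (h : x = if u then -1 else 0) : ins n u x = 0 := by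
  unfold ins
  cases u <;> simp_all

/-- At an inner level, the colors below `E` and those above `E` may be used to index the same sum:
by the two vanishing lemmas for slices and by `ins_eq_zero`, the terms for which one of the colors
lies outside `0, …, n` are zero. -/
theorem insertSumAbove_eq (n a : ℤ) (hn : 0 ≤ n) {k : ℕ} (hk : k + 1 < D.height) :
    D.insertSumAbove n a (k + 1) = D.insertSum n a (k + 1) := by
  unfold insertSumAbove insertSum
  rw [Finset.sum_comm, Finset.sum_comm (s := D.boxed n a (a + 1))]
  refine Finset.sum_congr rfl fun p hp => ?_
  have hp := Finset.mem_range.1 hp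
  obtain ⟨x, hx⟩ : ∃ x : D.Point, x.1 = (k + 1, p) := ⟨⟨(k + 1, p), by omega, hp⟩, rfl⟩
  have hx1 : x.1.1 = k + 1 := by rw [hx]
  have hx2 : x.1.2 = p := by rw [hx]
  have hxb : D.bottom ≠ x := by
    rintro rfl
    simp [bottom] at hx1
  have hxt : D.top ≠ x := by
    rintro rfl
    simp [top] at hx1
    omega
  have hlev : ∀ c : D.Point → ℤ, levels c (k + 1) p = c x := by
    intro c
    rw [← levels_apply c x, hx1, hx2]
  set F : (D.Point → ℤ) → RatFunc ℚ := fun c =>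
    insCoeff n (D.up (k + 1)) (levels c (k + 1)) (D.width (k + 1)) p *
      D.transfer n (levels c) (levels (raisePoint x c)) with hF
  have hl : ∀ c, levels ((raisePoint x).symm c) = Function.update (levels c) (k + 1)
      (lowerAt (D.up (k + 1)) p (levels c (k + 1))) := by
    intro c
    rw [levels_raisePoint_symm, hx1, hx2]
  have hr : ∀ c, levels (raisePoint x c) = Function.update (levels c) (k + 1)
      (raiseAt (D.up (k + 1)) p (levels c (k + 1))) := by
    intro c
    rw [levels_raisePoint, hx1, hx2]
  have hup : D.up (k + 1) p = D.isUp x := by rw [isUp, hx1, hx2]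
  calc _ = ∑ c ∈ D.boxed n a (a + 1), F ((raisePoint x).symm c) := by
        refine Finset.sum_congr rfl fun c _ => ?_
        simp only [hF, Equiv.apply_symm_apply]
        rw [hl, Function.update_self]
    _ = ∑ c ∈ D.boxed n a (a + 1), F c := by
        refine sum_comp_perm_of_vanish _ _ _ (fun c hc hn' => ?_) (fun c hc hn' => ?_)
        · rw [mem_boxed] at hc hn'
          have hv : (raisePoint x).symm c = Function.update c x (c x - rise (D.isUp x)) := rfl
          have hout : ¬(0 ≤ c x - rise (D.isUp x) ∧ c x - rise (D.isUp x) ≤ n) := by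
            refine fun hin => hn' ⟨fun z => ?_, ?_, ?_⟩
            · rw [hv]
              by_cases hz : z = x
              · subst hz
                rwa [Function.update_self]
              · rw [Function.update_of_ne hz]
                exact hc.1 z
            · rw [hv, Function.update_of_ne hxb]
              exact hc.2.1
            · rw [hv, Function.update_of_ne hxt]
              exact hc.2.2
          have hcx := hc.1 x
          rcases hu : D.isUp x
          · rw [hu] at hout
            simp only [rise, Bool.false_eq_true, if_false] at hout
            simp only [hF, Equiv.apply_symm_apply]
            rw [hl, transfer_update_left _ _ _ (by omega),
              sliceWeight_eq_zero_of_top (p := p) (by omega) hp (hup.trans hu), zero_mul, mul_zero]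
            · rw [lowerAt_same, hlev, hup, hu, rise, if_neg Bool.false_ne_true]
              omega
            · intro p' hp'
              rw [lowerAt_of_ne _ hp']
              exact levels_le hn hc.1 _ _
            · intro p'
              exact levels_le hn hc.1 _ _
          · rw [hu] at hout
            simp only [rise, if_true] at hout
            simp only [hF]
            rw [insCoeff, hl, Function.update_self, lowerAt_same, hlev, hup, hu, ins_eq_zero,
              zero_mul, zero_mul]
            simp only [rise, if_true]
            omega
        · rw [mem_boxed] at hc hn'
          have hv : raisePoint x c = Function.update c x (c x + rise (D.isUp x)) := rfl
          have hout : ¬(0 ≤ c x + rise (D.isUp x) ∧ c x + rise (D.isUp x) ≤ n) := by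
            refine fun hin => hn' ⟨fun z => ?_, ?_, ?_⟩
            · rw [hv]
              by_cases hz : z = x
              · subst hz
                rwa [Function.update_self]
              · rw [Function.update_of_ne hz]
                exact hc.1 z
            · rw [hv, Function.update_of_ne hxb]
              exact hc.2.1
            · rw [hv, Function.update_of_ne hxt]
              exact hc.2.2
          have hcx := hc.1 x
          rcases hu : D.isUp x
          · rw [hu] at hout
            simp only [rise, Bool.false_eq_true, if_false] at hout
            simp only [hF]
            rw [insCoeff, hlev, hup, hu, ins_eq_zero, zero_mul, zero_mul]
            simp only [Bool.false_eq_true, if_false]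
            omega
          · rw [hu] at hout
            simp only [rise, if_true] at hout
            simp only [hF]
            rw [hr, transfer_update_right _ _ _ hk,
              sliceWeight_eq_zero_of_bottom (p := p) hk hp (hup.trans hu), zero_mul, mul_zero]
            · rw [raiseAt_same, hlev, hup, hu, rise, if_pos rfl]
              omega
            · intro p' hp'
              rw [raiseAt_of_ne _ hp']
              exact levels_le hn hc.1 _ _
            · intro p'
              exact levels_le hn hc.1 _ _
    _ = _ := by
        refine Finset.sum_congr rfl fun c _ => ?_
        simp only [hF]
        rw [hr]

theorem insCoeff_one (n : ℤ) {u : ℕ → Bool} (hu : u 0 = true) (x : ℕ → ℤ) :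
    insCoeff n u x 1 0 = qBrace (x 0 + 1) := by
  simp [insCoeff, ins, kapProd, hu]

theorem levels_bottom (c : D.Point → ℤ) : levels c 0 0 = c D.bottom := levels_apply c D.bottom

theorem levels_top (c : D.Point → ℤ) : levels c D.height 0 = c D.top := levels_apply c D.top

/-- `E` at the bottom end acts on the single strand there. -/
theorem insertSum_zero (n a : ℤ) (hh : 0 < D.height) (ha : 0 ≤ a) (han : a + 1 ≤ n) :
    D.insertSum n a 0 = qBrace (a + 1) * D.levelSum n (a + 1) (a + 1) := by
  have htb : D.top ≠ D.bottom := by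
    intro h
    have : D.height = 0 := congrArg (fun x : D.Point => x.1.1) h
    omega
  unfold insertSum levelSum
  rw [D.width_bot, Finset.mul_sum]
  simp only [Finset.sum_range_one, insCoeff_one n D.up_bot, levels_bottom]
  have hup : D.isUp D.bottom = true := D.up_bot
  refine Finset.sum_nbij' (raisePoint D.bottom) (raisePoint D.bottom).symm
    (fun c hc => ?_) (fun c hc => ?_) (fun c _ => by simp) (fun c _ => by simp) (fun c hc => ?_)
  · rw [mem_boxed] at hc ⊢
    have hv : raisePoint D.bottom c = Function.update c D.bottom (c D.bottom + 1) := by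
      change Function.update _ _ _ = _
      rw [hup]
      rfl
    rw [hv, Function.update_self, Function.update_of_ne htb]
    refine ⟨fun z => ?_, by omega, hc.2.2⟩
    by_cases hz : z = D.bottom
    · subst hz
      rw [Function.update_self]
      omega
    · rw [Function.update_of_ne hz]
      exact hc.1 z
  · rw [mem_boxed] at hc ⊢
    have hv : (raisePoint D.bottom).symm c = Function.update c D.bottom (c D.bottom - 1) := by
      change Function.update _ _ _ = _
      rw [hup]
      rfl
    rw [hv, Function.update_self, Function.update_of_ne htb]
    refine ⟨fun z => ?_, by omega, hc.2.2⟩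
    by_cases hz : z = D.bottom
    · subst hz
      rw [Function.update_self]
      omega
    · rw [Function.update_of_ne hz]
      exact hc.1 z
  · rw [mem_boxed] at hc
    rw [hc.2.1]
    congr 1
    rw [levels_raisePoint]
    refine Finset.prod_congr rfl fun k _ => ?_
    rw [Function.update_of_ne (a := k + 1)]
    · rfl
    · exact Nat.succ_ne_zero k

/-- `E` at the top end acts on the single strand there. -/
theorem insertSumAbove_height (n a : ℤ) (hh : 0 < D.height) (ha : 0 ≤ a) (han : a + 1 ≤ n) :
    D.insertSumAbove n a D.height = qBrace (a + 1) * D.levelSum n a a := by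
  have htb : D.bottom ≠ D.top := by
    intro h
    have : 0 = D.height := congrArg (fun x : D.Point => x.1.1) h
    omega
  unfold insertSumAbove levelSum
  rw [D.width_top, Finset.mul_sum]
  simp only [Finset.sum_range_one, insCoeff_one n D.up_top, levels_top, lowerAt_same, D.up_top]
  have hup : D.isUp D.top = true := D.up_top
  refine Finset.sum_nbij' (raisePoint D.top).symm (raisePoint D.top)
    (fun c hc => ?_) (fun c hc => ?_) (fun c _ => by simp) (fun c _ => by simp) (fun c hc => ?_)
  · rw [mem_boxed] at hc ⊢
    have hv : (raisePoint D.top).symm c = Function.update c D.top (c D.top - 1) := by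
      change Function.update _ _ _ = _
      rw [hup]
      rfl
    rw [hv, Function.update_self, Function.update_of_ne htb]
    refine ⟨fun z => ?_, hc.2.1, by omega⟩
    by_cases hz : z = D.top
    · subst hz
      rw [Function.update_self]
      omega
    · rw [Function.update_of_ne hz]
      exact hc.1 z
  · rw [mem_boxed] at hc ⊢
    have hv : raisePoint D.top c = Function.update c D.top (c D.top + 1) := by
      change Function.update _ _ _ = _
      rw [hup]
      rfl
    rw [hv, Function.update_self, Function.update_of_ne htb]
    refine ⟨fun z => ?_, hc.2.1, by omega⟩
    by_cases hz : z = D.top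
    · subst hz
      rw [Function.update_self]
      omega
    · rw [Function.update_of_ne hz]
      exact hc.1 z
  · rw [mem_boxed] at hc
    rw [hc.2.2, levels_raisePoint_symm]
    congr 1
    · simp [rise]
    · refine Finset.prod_congr rfl fun k hk => ?_
      have := Finset.mem_range.1 hk
      rw [Function.update_of_ne (a := k)]
      · rfl
      · exact this.ne

/-- Since the operator of the long component commutes with `E`, neighbouring diagonal entries
agree. -/
theorem levelSum_succ (n a : ℤ) (hh : 0 < D.height) (ha : 0 ≤ a) (han : a + 1 ≤ n) :
    D.levelSum n (a + 1) (a + 1) = D.levelSum n a a := by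
  have key : ∀ k, k + 1 ≤ D.height → D.insertSum n a 0 = D.insertSumAbove n a (k + 1) := by
    intro k
    induction k with
    | zero => exact fun h => insertSum_eq_above n a h
    | succ k ih =>
      intro h
      rw [ih (by omega), insertSumAbove_eq n a (by omega) (by omega),
        insertSum_eq_above n a (by omega)]
  obtain ⟨m, hm⟩ := Nat.exists_eq_add_of_le' hh
  have h1 := key m (by omega)
  rw [insertSum_zero n a hh ha han, ← hm, insertSumAbove_height n a hh ha han] at h1
  exact mul_left_cancel₀ (qBrace_ne_zero (by omega)) h1

/-- The operator of the long component acts on the highest color as on the lowest one. -/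
theorem levelSum_self (n : ℕ) (hh : 0 < D.height) : D.levelSum n n n = D.levelSum n 0 0 := by
  have key : ∀ a : ℕ, a ≤ n → D.levelSum n a a = D.levelSum n 0 0 := by
    intro a
    induction a with
    | zero => exact fun _ => rfl
    | succ a ih =>
      intro h
      rw [← ih (by omega)]
      push_cast
      exact levelSum_succ n a hh (by omega) (by omega)
  exact key n le_rfl

end LongProjection

/-! ### Colorings, level by level -/

namespace LongProjection

variable {D : LongProjection}

/-- The index of the slice that the strand through `x` enters at `x`. -/
def nextSlice (x : D.Point) : ℕ := if D.isUp x then x.1.1 else x.1.1 - 1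

theorem point_eq_bottom {x : D.Point} (h : x.1.1 = 0) : x = D.bottom := by
  have h2 := x.2.2
  rw [h, D.width_bot] at h2
  exact Subtype.ext (Prod.ext h (by simpa [bottom] using h2))

theorem point_eq_top {x : D.Point} (h : x.1.1 = D.height) : x = D.top := by
  have h2 := x.2.2
  rw [h, D.width_top] at h2
  exact Subtype.ext (Prod.ext h (by simpa [top] using h2))

theorem level_pos {x : D.Point} (h : D.isUp x = false) : 0 < x.1.1 := by
  rcases Nat.eq_zero_or_pos x.1.1 with h0 | h0
  · rw [point_eq_bottom h0] at h
    exact absurd (h.symm.trans D.up_bot) (by simp)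
  · exact h0

theorem place_nextSlice (x : D.Point) : x.1 = place (nextSlice x) (!D.isUp x, x.1.2) := by
  unfold nextSlice place
  rcases h : D.isUp x
  · have := level_pos h
    exact Prod.ext (by simp; omega) rfl
  · simp

theorem nextSlice_le (x : D.Point) : nextSlice x ≤ D.height := by
  have := x.2.1
  unfold nextSlice
  split_ifs <;> omega

theorem nextSlice_eq_height {x : D.Point} (h : nextSlice x = D.height) : x = D.top := by
  have h1 := x.2.1
  unfold nextSlice at h
  split_ifs at h with hu
  · exact point_eq_top h
  · have := level_pos (by simpa using hu)
    omega

theorem next_coe (x : D.Point) : (D.next x).1 = D.travel (D.isUp x) x.1 := rfl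

theorem next_top : D.next D.top = D.bottom := by
  have : D.isUp D.top = true := D.up_top
  apply Subtype.ext
  rw [next_coe, this]
  simp [travel, top, bottom]

theorem next_val {x : D.Point} (h : nextSlice x < D.height) :
    (D.next x).1 = place (nextSlice x) ((D.slice (nextSlice x)).mate (!D.isUp x, x.1.2)) := by
  rw [next_coe]
  unfold travel
  unfold nextSlice at h ⊢
  rcases hu : D.isUp x
  · have := level_pos hu
    simp [show x.1.1 ≠ 0 by omega]
  · rw [hu] at h
    simp only [if_true] at h
    simp [h.ne]

/-- The width of the level on which the boundary point `e` of the slice above level `k` lies. -/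
def widthAt (D : LongProjection) (k : ℕ) (e : Bool × ℕ) : ℕ :=
  if e.1 then D.width (k + 1) else D.width k

/-- The boundary point `e` of the slice above level `k` is a leg of a crossing. -/
def IsLeg (D : LongProjection) (k : ℕ) (e : Bool × ℕ) : Prop :=
  (D.slice k).IsCrossing ∧ (e.2 = (D.slice k).pos ∨ e.2 = (D.slice k).pos + 1)

theorem nextSlice_risingIn (v : D.Crossing) : nextSlice (risingIn v) = v.1 := level_of_risingIn v

theorem nextSlice_fallingIn (v : D.Crossing) : nextSlice (fallingIn v) = v.1 := level_of_fallingIn v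

theorem overIn_cases (v : D.Crossing) : overIn v = risingIn v ∧ underIn v = fallingIn v ∨
    overIn v = fallingIn v ∧ underIn v = risingIn v := by
  unfold overIn underIn
  split_ifs <;> simp

theorem slice_of_crossing (v : D.Crossing) :
    D.slice v.1 = Slice.cross (D.slice v.1).pos (D.slice v.1).risingOver := by
  have := v.2
  revert this
  cases D.slice v.1 <;> simp [Slice.IsCrossing, Slice.pos, Slice.risingOver]

theorem isLeg_risingIn (v : D.Crossing) : D.IsLeg v.1 (!D.isUp (risingIn v), (risingIn v).1.2) := by
  refine ⟨v.2, ?_⟩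
  rcases h : D.up v.1 (D.slice v.1).pos
  · right
    rw [risingIn, h]
    rfl
  · left
    rw [risingIn, h]
    rfl

theorem isLeg_fallingIn (v : D.Crossing) :
    D.IsLeg v.1 (!D.isUp (fallingIn v), (fallingIn v).1.2) := by
  refine ⟨v.2, ?_⟩
  rcases h : D.up v.1 ((D.slice v.1).pos + 1)
  · left
    rw [fallingIn, h]
    rfl
  · right
    rw [fallingIn, h]
    rfl

/-- A point is followed by a crossing if and only if it is a leg of the slice that it enters. -/
theorem isLeg_iff {x : D.Point} (h : nextSlice x < D.height) :
    D.IsLeg (nextSlice x) (!D.isUp x, x.1.2) ↔ ∃ v : D.Crossing, x = overIn v ∨ x = underIn v := by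
  constructor
  · rintro ⟨h1, h2⟩
    refine ⟨⟨⟨nextSlice x, h⟩, h1⟩, ?_⟩
    set v : D.Crossing := ⟨⟨nextSlice x, h⟩, h1⟩ with hv
    obtain ⟨-, -, -, -, h5, h6⟩ := up_cross h (slice_of_crossing v)
    have hx : x = risingIn v ∨ x = fallingIn v := by
      have hp := place_nextSlice x
      have hu : D.up x.1.1 x.1.2 = D.isUp x := rfl
      rcases hb : D.isUp x <;> rw [hb] at hp hu
      · rcases h2 with h2 | h2
        · right
          have h2' : x.1.2 = (D.slice v.1).pos := h2
          have hx : x.1 = ((v.1 : ℕ) + 1, (D.slice v.1).pos) := by rw [hp, ← h2']; rfl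
          rw [hx] at hu
          have hu : D.up (v.1 + 1) (D.slice v.1).pos = false := hu
          have h6' : D.up (v.1 + 1) (D.slice v.1).pos = D.up v.1 ((D.slice v.1).pos + 1) := h6
          rw [h6'] at hu
          apply Subtype.ext
          rw [hx, fallingIn, hu]
          rfl
        · left
          have h2' : x.1.2 = (D.slice v.1).pos + 1 := h2
          have hx : x.1 = ((v.1 : ℕ) + 1, (D.slice v.1).pos + 1) := by rw [hp, ← h2']; rfl
          rw [hx] at hu
          have hu : D.up (v.1 + 1) ((D.slice v.1).pos + 1) = false := hu
          have h5' : D.up (v.1 + 1) ((D.slice v.1).pos + 1) = D.up v.1 (D.slice v.1).pos := h5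
          rw [h5'] at hu
          apply Subtype.ext
          rw [hx, risingIn, hu]
          rfl
      · rcases h2 with h2 | h2
        · left
          have h2' : x.1.2 = (D.slice v.1).pos := h2
          have hx : x.1 = ((v.1 : ℕ), (D.slice v.1).pos) := by rw [hp, ← h2']; rfl
          rw [hx] at hu
          have hu : D.up v.1 (D.slice v.1).pos = true := hu
          apply Subtype.ext
          rw [hx, risingIn, hu]
          rfl
        · right
          have h2' : x.1.2 = (D.slice v.1).pos + 1 := h2
          have hx : x.1 = ((v.1 : ℕ), (D.slice v.1).pos + 1) := by rw [hp, ← h2']; rfl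
          rw [hx] at hu
          have hu : D.up v.1 ((D.slice v.1).pos + 1) = true := hu
          apply Subtype.ext
          rw [hx, fallingIn, hu]
          rfl
    rcases overIn_cases v with ⟨e1, e2⟩ | ⟨e1, e2⟩ <;> rw [e1, e2] <;> tauto
  · rintro ⟨v, hv⟩
    have hx : x = risingIn v ∨ x = fallingIn v := by
      rcases overIn_cases v with ⟨e1, e2⟩ | ⟨e1, e2⟩ <;> rw [e1, e2] at hv <;> tauto
    rcases hx with rfl | rfl
    · rw [nextSlice_risingIn]
      exact isLeg_risingIn v
    · rw [nextSlice_fallingIn]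
      exact isLeg_fallingIn v

/-- The coloring is constant along the part arcs. -/
def IsColoring (c : D.Point → ℤ) : Prop :=
  ∀ x : D.Point, (∀ v : D.Crossing, x ≠ overIn v ∧ x ≠ underIn v) → c (D.next x) = c x

/-- The coloring is constant along the strands of the slice above level `k` that are not involved in
a crossing. -/
def ConstantAt (c : D.Point → ℤ) (k : ℕ) : Prop :=
  ∀ e : Bool × ℕ, e.2 < D.widthAt k e → ¬D.IsLeg k e →
    levels c (place k ((D.slice k).mate e)).1 (place k ((D.slice k).mate e)).2 =
      levels c (place k e).1 (place k e).2

theorem isLeg_mate {k : ℕ} {e : Bool × ℕ} (h : D.IsLeg k ((D.slice k).mate e)) : D.IsLeg k e := by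
  obtain ⟨h1, h2⟩ := h
  refine ⟨h1, ?_⟩
  obtain ⟨b, p⟩ := e
  rcases hs : D.slice k with q | q | ⟨q, b⟩ <;> rw [hs] at h1 h2
  · exact h1.elim
  · exact h1.elim
  · simp only [Slice.mate, Slice.pos] at h2 ⊢
    grind

/-- To be constant along the part arcs can be checked slice by slice, and at the point at infinity
where the ends of the long component are joined. -/
theorem isColoring_iff (c : D.Point → ℤ) :
    IsColoring c ↔ c D.bottom = c D.top ∧ ∀ k < D.height, ConstantAt c k := by
  constructor
  · intro h
    refine ⟨?_, fun k hk e he hl => ?_⟩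
    · rw [← next_top]
      refine h _ fun v => ?_
      have h0 := v.1.2
      have hn : ∀ x : D.Point, nextSlice x = v.1 → D.top ≠ x := by
        rintro x hx rfl
        have : D.isUp D.top = true := D.up_top
        rw [nextSlice, if_pos this] at hx
        simp only [top] at hx
        omega
      rcases overIn_cases v with ⟨e1, e2⟩ | ⟨e1, e2⟩ <;> rw [e1, e2]
      · exact ⟨hn _ (nextSlice_risingIn v), hn _ (nextSlice_fallingIn v)⟩
      · exact ⟨hn _ (nextSlice_fallingIn v), hn _ (nextSlice_risingIn v)⟩
    · -- One of the two ends of a strand is the one at which the strand enters the slice.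
      have key : ∀ e : Bool × ℕ, e.2 < D.widthAt k e → ¬D.IsLeg k e →
          D.up (place k e).1 (place k e).2 = !e.1 →
          levels c (place k ((D.slice k).mate e)).1 (place k ((D.slice k).mate e)).2 =
            levels c (place k e).1 (place k e).2 := by
        intro e he hl hu
        obtain ⟨x, hx⟩ : ∃ x : D.Point, x.1 = place k e := by
          refine ⟨⟨place k e, ?_, ?_⟩, rfl⟩
          · unfold place
            split_ifs <;> simp <;> omega
          · unfold place
            unfold widthAt at he
            split_ifs at he ⊢ <;> exact he
        have hux : D.isUp x = !e.1 := by rw [isUp, hx, hu]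
        have hs : nextSlice x = k := by
          rw [nextSlice, hux, hx, place]
          cases e.1 <;> simp
        have he' : (!D.isUp x, x.1.2) = e := by
          rw [hux, hx, place]
          simp
        have hnv := next_val (x := x) (by omega)
        rw [hs, he'] at hnv
        rw [← hx, ← hnv, levels_apply, levels_apply]
        refine h x fun v => ?_
        have := (isLeg_iff (x := x) (by omega)).not.1 (by rwa [hs, he'])
        push Not at this
        exact this v
      by_cases hu : D.up (place k e).1 (place k e).2 = !e.1
      · exact key e he hl hu
      · have ho := D.orient k hk e he
        have hm := Slice.mate_mate (s := D.slice k) e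
        have hml := Slice.mate_lt (D.fits k hk) e he
        rw [← key ((D.slice k).mate e) hml (fun h' => hl (isLeg_mate h')), hm]
        have ho' : D.up (place k ((D.slice k).mate e)).1 (place k ((D.slice k).mate e)).2 = _ := ho
        rw [ho']
        have hu' : D.up (if e.1 then k + 1 else k) e.2 = e.1 := by
          have : D.up (if e.1 then k + 1 else k) e.2 ≠ !e.1 := hu
          revert this
          cases D.up (if e.1 then k + 1 else k) e.2 <;> cases e.1 <;> simp
        rw [hu']
        cases ((D.slice k).mate e).1 <;> cases e.1 <;> simp
  · rintro ⟨h0, h⟩ x hx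
    rcases (nextSlice_le x).lt_or_eq with hlt | heq
    · have hl : ¬D.IsLeg (nextSlice x) (!D.isUp x, x.1.2) := by
        rw [isLeg_iff hlt]
        push Not
        exact hx
      have := h _ hlt (!D.isUp x, x.1.2) ?_ hl
      · rwa [← next_val hlt, ← place_nextSlice, levels_apply, levels_apply] at this
      · have h2 := x.2.2
        rw [place_nextSlice x] at h2
        unfold widthAt
        unfold place at h2
        rcases hu : D.isUp x <;> simpa [hu] using h2
    · rw [nextSlice_eq_height heq, next_top]
      exact h0

theorem constantAt_cup {c : D.Point → ℤ} {k q : ℕ} (hk : k < D.height)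
    (hs : D.slice k = Slice.cup q) :
    ConstantAt c k ↔ ((∀ p < q, levels c k p = levels c (k + 1) p) ∧
      ∀ i < D.width k - q, levels c k (q + 0 + i) = levels c (k + 1) (q + 2 + i)) ∧
      levels c (k + 1) q = levels c (k + 1) (q + 1) := by
  obtain ⟨h1, h2, -⟩ := up_cup hk hs
  unfold ConstantAt widthAt IsLeg
  rw [hs]
  simp only [Slice.IsCrossing, false_and, not_false_eq_true, forall_const, add_zero]
  constructor
  · intro h
    refine ⟨⟨fun p hp => ?_, fun i hi => ?_⟩, ?_⟩
    · have := h (false, p) (by simp; omega)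
      simpa [Slice.mate, hp, place] using this.symm
    · have := h (false, q + i) (by simp; omega)
      rw [show q + 2 + i = q + i + 2 by ring]
      simpa [Slice.mate, place] using this.symm
    · have := h (true, q + 1) (by simp; omega)
      simpa [Slice.mate, place] using this
  · rintro ⟨⟨h3, h4⟩, h5⟩
    have key : ∀ p < D.width k, levels c (k + 1) (if p < q then p else p + 2) = levels c k p := by
      rintro p hp
      split_ifs with hpq
      · exact (h3 p hpq).symm
      · have := h4 (p - q) (by omega)
        rw [show q + (p - q) = p by omega, show q + 2 + (p - q) = p + 2 by omega] at this
        exact this.symm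
    rintro ⟨b, p⟩ he
    rcases b
    · simpa [Slice.mate, place] using key p (by simpa using he)
    · have he : p < D.width (k + 1) := by simpa using he
      by_cases hp : p < q
      · simpa [Slice.mate, place, hp] using h3 p hp
      · by_cases hp' : p = q
        · subst hp'
          simpa [Slice.mate, place] using h5.symm
        · by_cases hp'' : p = q + 1
          · subst hp''
            simpa [Slice.mate, place] using h5
          · have := key (p - 2) (by omega)
            rw [if_neg (by omega), show p - 2 + 2 = p by omega] at this
            simpa [Slice.mate, place, hp, hp', hp''] using this.symm

theorem constantAt_cap {c : D.Point → ℤ} {k q : ℕ} (hk : k < D.height)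
    (hs : D.slice k = Slice.cap q) :
    ConstantAt c k ↔ ((∀ p < q, levels c k p = levels c (k + 1) p) ∧
      ∀ i < D.width (k + 1) - q, levels c k (q + 2 + i) = levels c (k + 1) (q + 0 + i)) ∧
      levels c k q = levels c k (q + 1) := by
  obtain ⟨h1, h2, -⟩ := up_cap hk hs
  unfold ConstantAt widthAt IsLeg
  rw [hs]
  simp only [Slice.IsCrossing, false_and, not_false_eq_true, forall_const, add_zero]
  constructor
  · intro h
    refine ⟨⟨fun p hp => ?_, fun i hi => ?_⟩, ?_⟩
    · have := h (true, p) (by simp; omega)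
      simpa [Slice.mate, hp, place] using this
    · have := h (true, q + i) (by simp; omega)
      rw [show q + 2 + i = q + i + 2 by ring]
      simpa [Slice.mate, place] using this
    · have := h (false, q + 1) (by simp; omega)
      simpa [Slice.mate, place] using this
  · rintro ⟨⟨h3, h4⟩, h5⟩
    have key : ∀ p < D.width (k + 1),
        levels c k (if p < q then p else p + 2) = levels c (k + 1) p := by
      rintro p hp
      split_ifs with hpq
      · exact h3 p hpq
      · have := h4 (p - q) (by omega)
        rw [show q + (p - q) = p by omega, show q + 2 + (p - q) = p + 2 by omega] at this
        exact this
    rintro ⟨b, p⟩ he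
    rcases b
    · have he : p < D.width k := by simpa using he
      by_cases hp : p < q
      · simpa [Slice.mate, place, hp] using (h3 p hp).symm
      · by_cases hp' : p = q
        · subst hp'
          simpa [Slice.mate, place] using h5.symm
        · by_cases hp'' : p = q + 1
          · subst hp''
            simpa [Slice.mate, place] using h5
          · have := key (p - 2) (by omega)
            rw [if_neg (by omega), show p - 2 + 2 = p by omega] at this
            simpa [Slice.mate, place, hp, hp', hp''] using this.symm
    · simpa [Slice.mate, place] using key p (by simpa using he)

theorem constantAt_cross {c : D.Point → ℤ} {k q : ℕ} {b : Bool} (hk : k < D.height)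
    (hs : D.slice k = Slice.cross q b) :
    ConstantAt c k ↔ (∀ p < q, levels c k p = levels c (k + 1) p) ∧
      ∀ i < D.width k - q - 2, levels c k (q + 2 + i) = levels c (k + 1) (q + 2 + i) := by
  obtain ⟨h1, h2, -⟩ := up_cross hk hs
  unfold ConstantAt widthAt IsLeg
  rw [hs]
  simp only [Slice.IsCrossing, true_and, Slice.pos]
  constructor
  · intro h
    refine ⟨fun p hp => ?_, fun i hi => ?_⟩
    · have := h (false, p) (by simp; omega) (by simp; omega)
      simpa [Slice.mate, hp.ne, (show p ≠ q + 1 by omega), place] using this.symm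
    · have := h (false, q + 2 + i) (by simp; omega) (by simp; omega)
      simpa [Slice.mate, place, (show q + 2 + i ≠ q by omega), (show q + 2 + i ≠ q + 1 by omega)]
        using this.symm
  · rintro ⟨h3, h4⟩ ⟨b, p⟩ he hl
    simp only [not_or] at hl
    have hpp : levels c k p = levels c (k + 1) p := by
      rcases lt_or_ge p q with hp | hp
      · exact h3 p hp
      · have hw : p < q + 2 + (D.width k - q - 2) := by
          rcases b <;> simp at he <;> omega
        have := h4 (p - q - 2) (by omega)
        rwa [show q + 2 + (p - q - 2) = p by omega] at this
    simp only [Slice.mate, place, hl.1, hl.2, if_false]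
    rcases b
    · simpa using hpp.symm
    · simpa using hpp

end LongProjection

/-! ### The state-sum, slice by slice -/

namespace LongProjection

variable {D : LongProjection}

theorem levels_of_coe (c : D.Point → ℤ) {x : D.Point} {k p : ℕ} (h : x.1 = (k, p)) :
    levels c k p = c x := by
  rw [← levels_apply c x, h]

theorem risingIn_coe (v : D.Crossing) : (risingIn v).1 =
    if D.up v.1 (D.slice v.1).pos then ((v.1 : ℕ), (D.slice v.1).pos)
    else ((v.1 : ℕ) + 1, (D.slice v.1).pos + 1) := by
  unfold risingIn
  rcases D.up v.1 (D.slice v.1).pos <;> rfl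

theorem fallingIn_coe (v : D.Crossing) : (fallingIn v).1 =
    if D.up v.1 ((D.slice v.1).pos + 1) then ((v.1 : ℕ), (D.slice v.1).pos + 1)
    else ((v.1 : ℕ) + 1, (D.slice v.1).pos) := by
  unfold fallingIn
  rcases D.up v.1 ((D.slice v.1).pos + 1) <;> rfl

theorem isUp_risingIn (v : D.Crossing) : D.isUp (risingIn v) = D.up v.1 (D.slice v.1).pos := by
  obtain ⟨-, -, -, -, h5, h6⟩ := up_cross v.1.2 (slice_of_crossing v)
  have h5 : D.up (v.1 + 1) ((D.slice v.1).pos + 1) = D.up v.1 (D.slice v.1).pos := h5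
  rw [isUp, risingIn_coe]
  rcases h : D.up v.1 (D.slice v.1).pos
  · simpa [h] using h5
  · simpa using h

theorem isUp_fallingIn (v : D.Crossing) :
    D.isUp (fallingIn v) = D.up v.1 ((D.slice v.1).pos + 1) := by
  obtain ⟨-, -, -, -, h5, h6⟩ := up_cross v.1.2 (slice_of_crossing v)
  have h6 : D.up (v.1 + 1) (D.slice v.1).pos = D.up v.1 ((D.slice v.1).pos + 1) := h6
  rw [isUp, fallingIn_coe]
  rcases h : D.up v.1 ((D.slice v.1).pos + 1)
  · simpa [h] using h6
  · simpa using h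

theorem mate_crossing (v : D.Crossing) (s : Bool) (p : ℕ) : (D.slice v.1).mate (s, p) =
    (!s, if p = (D.slice v.1).pos then (D.slice v.1).pos + 1
      else if p = (D.slice v.1).pos + 1 then (D.slice v.1).pos else p) := by
  rw [show (D.slice v.1).mate (s, p) = (Slice.cross _ _).mate (s, p) from
    congrArg (fun z : Slice => z.mate (s, p)) (slice_of_crossing v)]
  rfl

theorem next_risingIn_coe (v : D.Crossing) : (D.next (risingIn v)).1 =
    if D.up v.1 (D.slice v.1).pos then ((v.1 : ℕ) + 1, (D.slice v.1).pos + 1)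
    else ((v.1 : ℕ), (D.slice v.1).pos) := by
  have h := next_val (x := risingIn v) (by rw [nextSlice_risingIn]; exact v.1.2)
  rw [nextSlice_risingIn, isUp_risingIn, risingIn_coe] at h
  rw [h, mate_crossing]
  rcases D.up v.1 (D.slice v.1).pos <;> simp [place]

theorem next_fallingIn_coe (v : D.Crossing) : (D.next (fallingIn v)).1 =
    if D.up v.1 ((D.slice v.1).pos + 1) then ((v.1 : ℕ) + 1, (D.slice v.1).pos)
    else ((v.1 : ℕ), (D.slice v.1).pos + 1) := by
  have h := next_val (x := fallingIn v) (by rw [nextSlice_fallingIn]; exact v.1.2)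
  rw [nextSlice_fallingIn, isUp_fallingIn, fallingIn_coe] at h
  rw [h, mate_crossing]
  rcases D.up v.1 ((D.slice v.1).pos + 1) <;> simp [place]

theorem apply_risingIn (c : D.Point → ℤ) (v : D.Crossing) : c (risingIn v) =
    if D.up v.1 (D.slice v.1).pos then levels c v.1 (D.slice v.1).pos
    else levels c (v.1 + 1) ((D.slice v.1).pos + 1) := by
  rw [← levels_apply c (risingIn v), risingIn_coe]
  split_ifs <;> rfl

theorem apply_fallingIn (c : D.Point → ℤ) (v : D.Crossing) : c (fallingIn v) =
    if D.up v.1 ((D.slice v.1).pos + 1) then levels c v.1 ((D.slice v.1).pos + 1)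
    else levels c (v.1 + 1) (D.slice v.1).pos := by
  rw [← levels_apply c (fallingIn v), fallingIn_coe]
  split_ifs <;> rfl

theorem apply_next_risingIn (c : D.Point → ℤ) (v : D.Crossing) : c (D.next (risingIn v)) =
    if D.up v.1 (D.slice v.1).pos then levels c (v.1 + 1) ((D.slice v.1).pos + 1)
    else levels c v.1 (D.slice v.1).pos := by
  rw [← levels_apply c (D.next (risingIn v)), next_risingIn_coe]
  split_ifs <;> rfl

theorem apply_next_fallingIn (c : D.Point → ℤ) (v : D.Crossing) : c (D.next (fallingIn v)) =
    if D.up v.1 ((D.slice v.1).pos + 1) then levels c (v.1 + 1) (D.slice v.1).pos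
    else levels c v.1 ((D.slice v.1).pos + 1) := by
  rw [← levels_apply c (D.next (fallingIn v)), next_fallingIn_coe]
  split_ifs <;> rfl

theorem slice_cases (D : LongProjection) (k : ℕ) : (∃ q, D.slice k = Slice.cup q) ∨
    (∃ q, D.slice k = Slice.cap q) ∨ ∃ q b, D.slice k = Slice.cross q b := by
  cases D.slice k <;> simp

/-- The crossing in the slice above level `k`. -/
def crossingAt (k : ℕ) (h : ∃ _ : k < D.height, (D.slice k).IsCrossing) : D.Crossing :=
  ⟨⟨k, h.1⟩, h.2⟩

/-- A product over the crossings as a product over the slices. -/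
theorem prod_crossing {M : Type*} [CommMonoid M] (f : D.Crossing → M) :
    ∏ v, f v = ∏ k ∈ range D.height,
      if h : ∃ _ : k < D.height, (D.slice k).IsCrossing then f (crossingAt k h) else 1 := by
  rw [Finset.prod_range (fun k => if h : ∃ _ : k < D.height, (D.slice k).IsCrossing then
    f (crossingAt k h) else 1)]
  rw [← Finset.prod_filter_mul_prod_filter_not univ
    (fun k : Fin D.height => (D.slice k).IsCrossing)]
  rw [Finset.prod_eq_one (s := univ.filter fun k : Fin D.height => ¬(D.slice k).IsCrossing),
    mul_one]
  · refine Finset.prod_bij (fun v _ => v.1) (fun v _ => ?_) (fun v _ w _ h => Subtype.ext h)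
      (fun k hk => ?_) (fun v _ => ?_)
    · simpa using v.2
    · exact ⟨⟨k, by simpa using hk⟩, mem_univ _, rfl⟩
    · rw [dif_pos ⟨v.1.2, v.2⟩]
      rfl
  · intro k hk
    rw [dif_neg]
    rintro ⟨_, h⟩
    simp at hk
    exact hk h

/-- A sum over the crossings as a sum over the slices. -/
theorem sum_crossing {M : Type*} [AddCommMonoid M] (f : D.Crossing → M) :
    ∑ v, f v = ∑ k ∈ range D.height,
      if h : ∃ _ : k < D.height, (D.slice k).IsCrossing then f (crossingAt k h) else 0 :=
  prod_crossing (M := Multiplicative M) f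

/-- The part of `∑ x, pointRot x * g x` that comes from the slice above level `k`. -/
noncomputable def sliceRot (g : D.Point → ℤ) (k : ℕ) : ℤ :=
  match D.slice k with
  | Slice.cup q => if D.up (k + 1) q then 0 else -levels g (k + 1) q
  | Slice.cap q => if D.up k q then levels g k q else 0
  | Slice.cross q _ => if D.up k q = true ∧ D.up k (q + 1) = false then
      levels g k (q + 1) - levels g (k + 1) q else 0

/-- The rotation of a coloring, collected by slices. -/
theorem sum_pointRot_mul (g : D.Point → ℤ) :
    ∑ x, D.pointRot x * g x = ∑ k ∈ range D.height, sliceRot g k := by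
  have hcap : ∑ x : D.Point, (if x.1.1 < D.height ∧ D.isUp x = true ∧
        D.slice x.1.1 = Slice.cap x.1.2 then g x else 0) =
      ∑ k ∈ range D.height, ∑ x : D.Point, if x.1.1 = k ∧ D.isUp x = true ∧
        D.slice k = Slice.cap x.1.2 then g x else 0 := by
    rw [Finset.sum_comm]
    refine Finset.sum_congr rfl fun x _ => ?_
    by_cases h : x.1.1 < D.height
    · rw [Finset.sum_eq_single x.1.1]
      · simp [h]
      · intro k _ hk
        rw [if_neg]
        exact fun h' => hk h'.1.symm
      · intro h'
        exact absurd (Finset.mem_range.2 h) h'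
    · rw [if_neg (fun h' => h h'.1), Finset.sum_eq_zero]
      intro k hk
      rw [if_neg]
      rintro ⟨rfl, -⟩
      exact h (Finset.mem_range.1 hk)
  have hcup : ∑ x : D.Point, (if 0 < x.1.1 ∧ D.isUp x = false ∧
        D.slice (x.1.1 - 1) = Slice.cup x.1.2 then g x else 0) =
      ∑ k ∈ range D.height, ∑ x : D.Point, if x.1.1 = k + 1 ∧ D.isUp x = false ∧
        D.slice k = Slice.cup x.1.2 then g x else 0 := by
    rw [Finset.sum_comm]
    refine Finset.sum_congr rfl fun x _ => ?_
    by_cases h : 0 < x.1.1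
    · have hx := x.2.1
      rw [Finset.sum_eq_single (x.1.1 - 1)]
      · rw [show x.1.1 - 1 + 1 = x.1.1 by omega]
        simp [h]
      · intro k _ hk
        rw [if_neg]
        rintro ⟨h', -⟩
        omega
      · intro h'
        exact absurd (Finset.mem_range.2 (by omega)) h'
    · rw [if_neg (fun h' => h h'.1), Finset.sum_eq_zero]
      intro k hk
      rw [if_neg]
      rintro ⟨h', -⟩
      omega
  have hin : ∑ x : D.Point, (∑ v : D.Crossing, if RunsRight v ∧ x = fallingIn v then (1 : ℤ) else 0)
      * g x = ∑ v : D.Crossing, if RunsRight v then g (fallingIn v) else 0 := by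
    simp only [Finset.sum_mul]
    rw [Finset.sum_comm]
    refine Finset.sum_congr rfl fun v _ => ?_
    by_cases h : RunsRight v <;> simp [h]
  have hout : ∑ x : D.Point, (∑ v : D.Crossing,
      if RunsRight v ∧ x = D.next (fallingIn v) then (1 : ℤ) else 0) * g x =
      ∑ v : D.Crossing, if RunsRight v then g (D.next (fallingIn v)) else 0 := by
    simp only [Finset.sum_mul]
    rw [Finset.sum_comm]
    refine Finset.sum_congr rfl fun v _ => ?_
    by_cases h : RunsRight v <;> simp [h]
  unfold pointRot
  simp only [add_mul, sub_mul, Finset.sum_add_distrib, Finset.sum_sub_distrib, hin, hout]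
  simp only [ite_mul, one_mul, zero_mul]
  rw [hcap, hcup, sum_crossing, sum_crossing, ← Finset.sum_sub_distrib, ← Finset.sum_sub_distrib,
    ← Finset.sum_add_distrib]
  refine Finset.sum_congr rfl fun k hk => ?_
  have hk := Finset.mem_range.1 hk
  unfold sliceRot
  rcases D.slice_cases k with ⟨q, hs⟩ | ⟨q, hs⟩ | ⟨q, b, hs⟩
  · obtain ⟨h1, h2, -⟩ := up_cup hk hs
    have hn : ¬∃ _ : k < D.height, (D.slice k).IsCrossing := by simp [hs, Slice.IsCrossing]
    rw [dif_neg hn, dif_neg hn]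
    simp only [hs, reduceCtorEq, and_false, if_false, Finset.sum_const_zero, Slice.cup.injEq]
    rw [Finset.sum_eq_single (D.pointAt (k + 1) q ⟨by omega, by omega⟩)]
    · have e1 : D.isUp (D.pointAt (k + 1) q ⟨by omega, by omega⟩) = D.up (k + 1) q := rfl
      rw [levels_of_coe g (x := D.pointAt (k + 1) q ⟨by omega, by omega⟩) rfl, e1]
      rcases D.up (k + 1) q <;> simp [pointAt]
    · intro x _ hx
      rw [if_neg]
      rintro ⟨h, -, h'⟩
      exact hx (Subtype.ext (Prod.ext h h'.symm))
    · simp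
  · obtain ⟨h1, h2, -⟩ := up_cap hk hs
    have hn : ¬∃ _ : k < D.height, (D.slice k).IsCrossing := by simp [hs, Slice.IsCrossing]
    rw [dif_neg hn, dif_neg hn]
    simp only [hs, reduceCtorEq, and_false, if_false, Finset.sum_const_zero, Slice.cap.injEq]
    rw [Finset.sum_eq_single (D.pointAt k q ⟨by omega, by omega⟩)]
    · have e1 : D.isUp (D.pointAt k q ⟨by omega, by omega⟩) = D.up k q := rfl
      rw [levels_of_coe g (x := D.pointAt k q ⟨by omega, by omega⟩) rfl, e1]
      rcases D.up k q <;> simp [pointAt]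
    · intro x _ hx
      rw [if_neg]
      rintro ⟨h, -, h'⟩
      exact hx (Subtype.ext (Prod.ext h h'.symm))
    · simp
  · have hc : ∃ _ : k < D.height, (D.slice k).IsCrossing := ⟨hk, by rw [hs]; trivial⟩
    rw [dif_pos hc, dif_pos hc, apply_fallingIn g, apply_next_fallingIn g]
    have e : ((crossingAt k hc).1 : ℕ) = k := rfl
    simp only [reduceCtorEq, and_false, if_false, Finset.sum_const_zero, RunsRight, e, hs,
      Slice.pos]
    split_ifs with h h' <;> simp_all
    ring

theorem levels_affine (c : D.Point → ℤ) (a b : ℤ) {k p : ℕ}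
    (h : k ≤ D.height ∧ p < D.width k) :
    levels (fun x => a * c x + b) k p = a * levels c k p + b := by
  unfold levels
  rw [dif_pos h, dif_pos h]

/-- The product of all weights of a coloring. -/
noncomputable def jonesWeight (n : ℤ) (c : D.Point → ℤ) : RatFunc ℚ :=
  (∏ x : D.Point, tq (2 * D.pointRot x * (2 * c x - n))) *
    ∏ v : D.Crossing, crossW n (sign v) (c (overIn v)) (c (underIn v)) (c (overOut v))
      (c (underOut v))

/-- The weight of a crossing, for an arbitrary slice. -/
noncomputable def sliceCross (n : ℤ) (c : D.Point → ℤ) (k : ℕ) : RatFunc ℚ :=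
  match D.slice k with
  | Slice.cup _ => 1
  | Slice.cap _ => 1
  | Slice.cross q b => crossCore n (D.up k q) (D.up k (q + 1)) b (levels c k q)
      (levels c k (q + 1)) (levels c (k + 1) q) (levels c (k + 1) (q + 1))

theorem crossW_eq_crossCore (n : ℤ) (c : D.Point → ℤ) (v : D.Crossing) :
    crossW n (sign v) (c (overIn v)) (c (underIn v)) (c (overOut v)) (c (underOut v)) =
      crossCore n (D.up v.1 (D.slice v.1).pos) (D.up v.1 ((D.slice v.1).pos + 1))
        (D.slice v.1).risingOver (levels c v.1 (D.slice v.1).pos)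
        (levels c v.1 ((D.slice v.1).pos + 1)) (levels c (v.1 + 1) (D.slice v.1).pos)
        (levels c (v.1 + 1) ((D.slice v.1).pos + 1)) := by
  unfold overOut underOut overIn underIn sign crossCore
  rcases (D.slice v.1).risingOver
  · simp only [Bool.false_eq_true, if_false]
    rw [apply_fallingIn c, apply_risingIn c, apply_next_risingIn c, apply_next_fallingIn c]
  · simp only [if_true]
    rw [apply_fallingIn c, apply_risingIn c, apply_next_risingIn c, apply_next_fallingIn c]

theorem prod_crossW (n : ℤ) (c : D.Point → ℤ) :
    ∏ v : D.Crossing, crossW n (sign v) (c (overIn v)) (c (underIn v)) (c (overOut v))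
      (c (underOut v)) = ∏ k ∈ range D.height, sliceCross n c k := by
  rw [prod_crossing]
  refine Finset.prod_congr rfl fun k hk => ?_
  have hk := Finset.mem_range.1 hk
  unfold sliceCross
  rcases D.slice_cases k with ⟨q, hs⟩ | ⟨q, hs⟩ | ⟨q, b, hs⟩
  · rw [dif_neg (by simp [hs, Slice.IsCrossing])]
    simp only [hs]
  · rw [dif_neg (by simp [hs, Slice.IsCrossing])]
    simp only [hs]
  · have hc : ∃ _ : k < D.height, (D.slice k).IsCrossing := ⟨hk, by rw [hs]; trivial⟩
    have e : ((crossingAt k hc).1 : ℕ) = k := rfl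
    rw [dif_pos hc, crossW_eq_crossCore n c]
    simp only [e, hs, Slice.pos, Slice.risingOver]

theorem sliceWeight_levels (n : ℤ) (c : D.Point → ℤ) {k : ℕ} (hk : k < D.height) :
    D.sliceWeight n k (levels c k) (levels c (k + 1)) = if ConstantAt c k then
      tq (sliceRot (fun x => 4 * c x + -2 * n) k) * sliceCross n c k else 0 := by
  unfold sliceRot sliceCross
  rcases D.slice_cases k with ⟨q, hs⟩ | ⟨q, hs⟩ | ⟨q, b, hs⟩
  · obtain ⟨h1, h2, -⟩ := up_cup hk hs
    rw [sliceWeight_cup hs, blockWeight, cupLoc, ← ite_and, constantAt_cup hk hs]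
    simp only [hs]
    rw [levels_affine _ _ _ ⟨by omega, by omega⟩, mul_one]
    congr 2
    split_ifs <;> ring
  · obtain ⟨h1, h2, -⟩ := up_cap hk hs
    rw [sliceWeight_cap hs, blockWeight, capLoc, ← ite_and, constantAt_cap hk hs]
    simp only [hs]
    rw [levels_affine _ _ _ ⟨by omega, by omega⟩, mul_one]
    congr 2
    split_ifs <;> ring
  · obtain ⟨h1, h2, -⟩ := up_cross hk hs
    rw [sliceWeight_cross hs, blockWeight, crossLoc, constantAt_cross hk hs]
    simp only [hs]
    rw [levels_affine _ _ _ ⟨by omega, by omega⟩, levels_affine _ _ _ ⟨by omega, by omega⟩,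
      mul_comm]
    congr 3
    split_ifs <;> ring

/-- The product of the slice weights is the product of all weights of a coloring, and it vanishes
for other assignments of colors to points. -/
theorem transfer_levels (n : ℤ) (c : D.Point → ℤ) :
    D.transfer n (levels c) (levels c) =
      if ∀ k < D.height, ConstantAt c k then jonesWeight n c else 0 := by
  unfold transfer
  rw [Finset.prod_congr rfl fun k hk => sliceWeight_levels n c (Finset.mem_range.1 hk)]
  split_ifs with h
  · rw [Finset.prod_congr rfl fun k hk => if_pos (h k (Finset.mem_range.1 hk)),
      Finset.prod_mul_distrib, ← tq_sum, ← sum_pointRot_mul, tq_sum, ← prod_crossW, jonesWeight]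
    congr 1
    refine Finset.prod_congr rfl fun x _ => ?_
    congr 1
    ring
  · push Not at h
    obtain ⟨k, hk, hn⟩ := h
    exact Finset.prod_eq_zero (Finset.mem_range.2 hk) (if_neg hn)

variable (D)

/-- The state-sum over the colorings that give the ends of the long component the color `a`. -/
noncomputable def jonesAt (n : ℕ) (a : Fin (n + 1)) : RatFunc ℚ :=
  ∑ c : D.Point → Fin (n + 1) with c D.bottom = a ∧ IsColoring (fun x => (c x : ℤ)),
    jonesWeight n fun x => (c x : ℤ)

variable {D}

theorem coloredJones_eq_jonesAt (n : ℕ) : D.coloredJones n = D.jonesAt n 0 := by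
  unfold coloredJones jonesAt jonesWeight colorings
  refine Finset.sum_congr (Finset.filter_congr fun c _ => ?_) fun c _ => ?_
  · unfold IsColoring
    simp only [Nat.cast_inj, Fin.val_inj]
  · congr 1
    exact Finset.prod_congr rfl fun v _ => crossingWeight_eq _ _ _ _ _ _

theorem jonesAt_eq_levelSum (n : ℕ) (a : Fin (n + 1)) : D.jonesAt n a = D.levelSum n a a := by
  unfold jonesAt levelSum
  simp only [transfer_levels]
  rw [← Finset.sum_filter]
  refine Finset.sum_bij (fun c _ => fun x => (c x : ℤ)) (fun c hc => ?_) (fun c _ c' _ h => ?_)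
    (fun c hc => ?_) (fun _ _ => rfl)
  · simp only [Finset.mem_filter, Finset.mem_univ, true_and] at hc
    have h := (isColoring_iff _).1 hc.2
    rw [Finset.mem_filter, mem_boxed]
    refine ⟨⟨fun x => ⟨by omega, by omega⟩, by rw [hc.1], ?_⟩, h.2⟩
    rw [← h.1, hc.1]
  · funext x
    have := congrFun h x
    simp only [Nat.cast_inj] at this
    exact Fin.ext this
  · rw [Finset.mem_filter, mem_boxed] at hc
    obtain ⟨⟨h1, h2, h3⟩, h4⟩ := hc
    have hx : ∀ x, ((c x).toNat : ℤ) = c x := fun x => Int.toNat_of_nonneg (h1 x).1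
    refine ⟨fun x => ⟨(c x).toNat, by have := h1 x; omega⟩, ?_, ?_⟩
    · simp only [Finset.mem_filter, Finset.mem_univ, true_and, hx]
      refine ⟨Fin.ext ?_, (isColoring_iff _).2 ⟨h2.trans h3.symm, h4⟩⟩
      simp [h2]
    · funext x
      exact hx x

/-- The state-sum may be computed with the highest color on the long component. -/
theorem coloredJones_eq_jonesAt_last (n : ℕ) (hh : 0 < D.height) :
    D.coloredJones n = D.jonesAt n (Fin.last n) := by
  rw [coloredJones_eq_jonesAt, jonesAt_eq_levelSum, jonesAt_eq_levelSum]
  simpa using (levelSum_self n hh).symm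

end LongProjection

/-! ### The weight of a crossing in terms of the complementary colors -/

theorem qPoch_add (a : ℤ) (b c : ℕ) : qPoch a (b + c) = qPoch a b * qPoch (a - b) c := by
  unfold qPoch
  rw [Finset.prod_range_add]
  congr 1
  refine Finset.prod_congr rfl fun s _ => ?_
  congr 1
  push_cast
  ring

theorem qPoch_mul_factorial (a r : ℕ) :
    qPoch ((a : ℤ) + r) r * qPoch a a = qPoch ((a : ℤ) + r) (a + r) := by
  rw [add_comm a r, qPoch_add, add_sub_cancel_right]

theorem qFactorial_tq {ε : ℤ} (hε : ε = 1 ∨ ε = -1) (a : ℕ) :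
    qFactorial (tq (-4 * ε)) a = tq (-ε * (a * (a - 1))) * qPoch a a / qBrace 1 ^ a := by
  have h1 : qBrace 1 ≠ 0 := qBrace_ne_zero one_ne_zero
  have hs : tq (-4 * ε) - 1 ≠ 0 := by
    rw [sub_ne_zero, Ne, tq_eq_one]
    omega
  have hf : ∀ k : ℕ, (tq (-4 * ε) ^ (k + 1) - 1) / (tq (-4 * ε) - 1) =
      tq (-2 * ε * k) * qBrace (k + 1) / qBrace 1 := by
    intro k
    rw [div_eq_div_iff hs h1, tq_pow]
    unfold qBrace
    rcases hε with rfl | rfl <;> push_cast <;>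
      simp only [mul_sub, sub_mul, ← tq_add, mul_one, one_mul] <;> ring_nf
  induction a with
  | zero => simp [qFactorial]
  | succ a ih =>
    rw [qFactorial, Finset.prod_range_succ, ← qFactorial, ih, hf, qPoch_succ', pow_succ]
    push_cast
    rw [add_sub_cancel_right,
      show -ε * (((a : ℤ) + 1) * a) = -ε * (a * (a - 1)) + -2 * ε * a by ring, tq_add]
    field_simp

theorem qBinom_tq {ε : ℤ} (hε : ε = 1 ∨ ε = -1) (i r : ℕ) :
    qBinom (tq (-4 * ε)) (i + r) i =
      tq (-2 * ε * (i * r)) * qPoch ((i : ℤ) + r) (i + r) / (qPoch i i * qPoch r r) := by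
  have h1 : qBrace 1 ≠ 0 := qBrace_ne_zero one_ne_zero
  have h2 := qPoch_self_ne_zero i
  have h3 := qPoch_self_ne_zero r
  have t1 := tq_ne_zero (-ε * (i * (i - 1)))
  have t2 := tq_ne_zero (-ε * (r * (r - 1)))
  rw [qBinom, add_tsub_cancel_left, qFactorial_tq hε, qFactorial_tq hε, qFactorial_tq hε]
  push_cast
  rw [show -ε * (((i : ℤ) + r) * (i + r - 1)) =
    -2 * ε * (i * r) + -ε * (i * (i - 1)) + -ε * (r * (r - 1)) by ring, tq_add, tq_add, pow_add]
  field_simp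

theorem qPochSign_tq {ε : ℤ} (hε : ε = 1 ∨ ε = -1) (a : ℤ) (r : ℕ) :
    qPochSign (tq (4 * ε)) a r =
      (if ε = 1 then (-1) ^ r else 1) * tq (ε * (2 * r * a - r * (r - 1))) * qPoch a r := by
  have hf : ∀ x : ℤ, 1 - tq (4 * ε) ^ x =
      (if ε = 1 then -1 else 1) * tq (2 * ε * x) * qBrace x := by
    intro x
    rw [tq_zpow]
    unfold qBrace
    rcases hε with rfl | rfl
    · rw [if_pos rfl, mul_assoc (-1 : RatFunc ℚ), mul_sub, ← tq_add, ← tq_add]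
      ring_nf
      simp
      ring
    · rw [if_neg (by norm_num), mul_assoc (1 : RatFunc ℚ), mul_sub, ← tq_add, ← tq_add]
      ring_nf
      simp
      ring
  induction r with
  | zero => simp [qPochSign]
  | succ r ih =>
    rw [qPochSign, Finset.prod_range_succ, ← qPochSign, ih, hf, qPoch_succ]
    push_cast
    rw [show ε * (2 * ((r : ℤ) + 1) * a - (r + 1) * (r + 1 - 1)) =
      ε * (2 * r * a - r * (r - 1)) + 2 * ε * (a - r) by ring, tq_add]
    rcases hε with rfl | rfl
    · simp only [if_true]
      ring
    · simp only [show ¬((-1 : ℤ) = 1) by norm_num, if_false]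
      ring

/-- The factor by which the basis vector of color `x` is rescaled. -/
noncomputable def colorScale (n x : ℤ) : RatFunc ℚ :=
  tq (-x ^ 2) * qPoch x x.toNat * qPoch (n - x) (n - x).toNat

theorem colorScale_ne_zero {n x : ℤ} (h : 0 ≤ x) (h' : x ≤ n) : colorScale n x ≠ 0 := by
  have e1 := qPoch_self_ne_zero x.toNat
  have e2 := qPoch_self_ne_zero (n - x).toNat
  rw [Int.toNat_of_nonneg (by omega)] at e1 e2
  exact mul_ne_zero (mul_ne_zero (tq_ne_zero _) e1) e2

/-- The weight of a crossing whose outgoing undercrossing color is `i`, whose incoming overcrossing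
color is `j` and at which the color `r` passes from the under- to the overcrossing strand. -/
noncomputable def stateWeight (n ε i j : ℤ) (r : ℕ) : RatFunc ℚ :=
  tq (4 * (n * ε * i)) * qBinom (tq (-4 * ε)) (i.toNat + r) i.toNat *
    qPochSign (tq (4 * ε)) (n - j) r

/-- With the colors `c` replaced by `n - c` and after a rescaling of the basis, the entries of the
`R`-matrix take the form in which they appear in the state-sum of the arc graph, up to a power of
`t` whose product over all crossings is trivial. -/
theorem crossW_complement {ε : ℤ} (hε : ε = 1 ∨ ε = -1) (n i j r : ℕ) (hi : i + r ≤ n)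
    (hj : j + r ≤ n) :
    crossW n ε (n - j) (n - (i + r)) (n - (j + r)) (n - i) *
        (colorScale n j * colorScale n (i + r)) =
      tq (-(n : ℤ) ^ 2 * ε) * tq (2 * n * ε * (j - i)) * tq (-4 * (ε * i * j)) *
        stateWeight n ε i j r * (colorScale n (j + r) * colorScale n i) := by
  have q1 := qPoch_mul_factorial (n - i - r) r
  have q2 := qPoch_mul_factorial j r
  have q3 := qPoch_mul_factorial (n - j - r) r
  have c1 : ((n - i - r : ℕ) : ℤ) = n - i - r := by omega
  have c2 : ((n - j - r : ℕ) : ℤ) = n - j - r := by omega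
  rw [c1, sub_add_cancel, show n - i - r + r = n - i by omega] at q1
  rw [c2, sub_add_cancel, show n - j - r + r = n - j by omega] at q3
  have r0 := qPoch_self_ne_zero r
  have i0 := qPoch_self_ne_zero i
  unfold stateWeight colorScale
  rw [qBinom_tq hε, qPochSign_tq hε, show (n : ℤ) - i = n - (i + r) + r by ring,
    show (n : ℤ) - (j + r) = n - j - r by ring]
  have hc : crossW n ε (n - j) (n - (i + r)) (n - j - r) (n - (i + r) + r) =
      (if ε = 1 then (-1) ^ r else 1) * tq (if ε = 1 then
          -((2 * j - n) * (2 * i + 2 * r - n) + r * (r - 1))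
        else (2 * i - n) * (2 * j + 2 * r - n) + r * (r - 1)) *
        (qPoch (n - (i + r) + r) r / qPoch r r) * qPoch (j + r) r := by
    rcases hε with rfl | rfl
    · rw [crossW_pos, fPos, qBinomSymm]
      simp only [if_true]
      rw [show (n : ℤ) + r - (n - j) = j + r by ring]
      congr 3
      ring_nf
    · rw [crossW_neg, fNeg, qBinomSymm]
      simp only [show ¬((-1 : ℤ) = 1) by norm_num, if_false, one_mul]
      rw [show (n : ℤ) + r - (n - j) = j + r by ring]
      congr 3
      ring_nf
  rw [hc]
  rw [show ((i : ℤ) + r).toNat = i + r by omega,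
    show ((n : ℤ) - (i + r)).toNat = n - i - r by omega,
    show ((n : ℤ) - (i + r) + r).toNat = n - i by omega, show ((j : ℤ) + r).toNat = j + r by omega,
    show ((n : ℤ) - j - r).toNat = n - j - r by omega, show ((n : ℤ) - j).toNat = n - j by omega,
    Int.toNat_natCast, Int.toNat_natCast, ← sub_sub, sub_add_cancel]
  rw [← q1, ← q2, ← q3]
  have key : tq (if ε = 1 then -((2 * j - n) * (2 * i + 2 * r - n) + r * (r - 1))
        else (2 * i - n) * (2 * j + 2 * r - n) + r * (r - 1)) *
      (tq (-(j : ℤ) ^ 2) * tq (-((i : ℤ) + r) ^ 2)) =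
      tq (-(n : ℤ) ^ 2 * ε) * tq (2 * n * ε * (j - i)) * tq (-4 * (ε * i * j)) *
        (tq (4 * (n * ε * i)) * tq (-2 * ε * (i * r)) *
          tq (ε * (2 * r * (n - j) - r * (r - 1)))) *
        (tq (-((j : ℤ) + r) ^ 2) * tq (-(i : ℤ) ^ 2)) := by
    simp only [← tq_add]
    congr 1
    rcases hε with rfl | rfl
    · rw [if_pos rfl]; ring
    · rw [if_neg (by norm_num)]; ring
  generalize (if ε = 1 then (-1 : RatFunc ℚ) ^ r else 1) = s
  generalize qPoch ((n : ℤ) - i) r = A at *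
  generalize qPoch ((n : ℤ) - i - r) (n - i - r) = A'
  generalize qPoch ((j : ℤ) + r) r = B at *
  generalize qPoch (j : ℤ) j = B'
  generalize qPoch ((n : ℤ) - j) r = C at *
  generalize qPoch ((n : ℤ) - j - r) (n - j - r) = C'
  generalize qPoch ((i : ℤ) + r) (i + r) = E'
  field_simp
  linear_combination s * A * A' * B * B' * C * C' * E' * key

/-! ### Flows -/

/-- The Alexander numbering: the number of strands to the left of the position `p`, counted with the
signs of their orientations. -/
def alexander (u : ℕ → Bool) (p : ℕ) : ℤ := ∑ p' ∈ range p, rise (u p')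

/-- The coefficient in `alexanderSum`: the sum of the two Alexander numbers next to the strand,
multiplied with the sign of its orientation. -/
def alexanderCoeff (u : ℕ → Bool) (p : ℕ) : ℤ := 2 * rise (u p) * alexander u p + 1

/-- The sum of the colors of a level, weighted by the Alexander numbering. -/
def alexanderSum (u : ℕ → Bool) (x : ℕ → ℤ) (w : ℕ) : ℤ := ∑ p ∈ range w, alexanderCoeff u p * x p

theorem alexander_succ (u : ℕ → Bool) (p : ℕ) : alexander u (p + 1) = alexander u p + rise (u p) :=
  Finset.sum_range_succ _ _

theorem alexander_congr {u u' : ℕ → Bool} {q : ℕ} (h : ∀ p < q, u p = u' p) {p : ℕ} (hp : p ≤ q) :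
    alexander u p = alexander u' p := by
  refine Finset.sum_congr rfl fun p' hp' => ?_
  rw [h p' (by have := Finset.mem_range.1 hp'; omega)]

theorem rise_not (u : Bool) : rise (!u) = -rise u := by cases u <;> simp [rise]

theorem rise_mul_self (u : Bool) : rise u * rise u = 1 := by cases u <;> simp [rise]

/-- The change of `alexanderSum` in a slice only depends on the extremum or crossing. -/
theorem alexanderSum_block {u u' : ℕ → Bool} {x y : ℕ → ℤ} {q b t s : ℕ}
    (hu : ∀ p < q, u p = u' p) (hu' : ∀ i < s, u (q + b + i) = u' (q + t + i))
    (hx : ∀ p < q, x p = y p) (hx' : ∀ i < s, x (q + b + i) = y (q + t + i))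
    (ha : alexander u (q + b) = alexander u' (q + t)) :
    alexanderSum u' y (q + t + s) - alexanderSum u x (q + b + s) =
      ∑ i ∈ range t, alexanderCoeff u' (q + i) * y (q + i) -
        ∑ i ∈ range b, alexanderCoeff u (q + i) * x (q + i) := by
  unfold alexanderSum
  rw [Finset.sum_range_add, Finset.sum_range_add, Finset.sum_range_add _ (q + b),
    Finset.sum_range_add _ q b]
  have h1 : ∑ p ∈ range q, alexanderCoeff u' p * y p = ∑ p ∈ range q, alexanderCoeff u p * x p := by
    refine Finset.sum_congr rfl fun p hp => ?_
    have hp := Finset.mem_range.1 hp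
    rw [alexanderCoeff, alexanderCoeff, hu p hp, hx p hp, alexander_congr hu hp.le]
  have h2 : ∑ i ∈ range s, alexanderCoeff u' (q + t + i) * y (q + t + i) =
      ∑ i ∈ range s, alexanderCoeff u (q + b + i) * x (q + b + i) := by
    refine Finset.sum_congr rfl fun i hi => ?_
    have hi := Finset.mem_range.1 hi
    have h3 : alexander u' (q + t + i) = alexander u (q + b + i) := by
      unfold alexander at ha ⊢
      rw [Finset.sum_range_add, Finset.sum_range_add _ (q + b), ha]
      congr 1
      refine Finset.sum_congr rfl fun j hj => ?_
      rw [hu' j (by have := Finset.mem_range.1 hj; omega)]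
    rw [alexanderCoeff, alexanderCoeff, hu' i hi, hx' i hi, h3]
  rw [h1, h2]
  ring

namespace LongProjection

variable {D : LongProjection}

/-- A flow: a coloring of the part arcs that is preserved at crossings, where color passes from the
under- to the overcrossing strand. -/
structure IsFlow (f : D.Point → ℤ) : Prop where
  coloring : IsColoring f
  le : ∀ v : D.Crossing, f (overIn v) ≤ f (overOut v)
  conserve : ∀ v : D.Crossing, f (overIn v) + f (underIn v) = f (overOut v) + f (underOut v)

theorem sum_range_two_shift (g : ℕ → ℤ) (q : ℕ) :
    ∑ i ∈ range 2, g (q + i) = g q + g (q + 1) := by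
  simp [Finset.sum_range_succ]

theorem alexanderCoeff_succ (u : ℕ → Bool) (q : ℕ) : alexanderCoeff u (q + 1) =
    2 * rise (u (q + 1)) * (alexander u q + rise (u q)) + 1 := by
  rw [alexanderCoeff, alexander_succ]

/-- `alexanderSum` does not change at extrema, and it changes at a crossing by twice the
difference of colors that enters the intersection number. -/
theorem alexanderSum_levels_succ {f : D.Point → ℤ} (hf : IsFlow f) {k : ℕ} (hk : k < D.height) :
    alexanderSum (D.up (k + 1)) (levels f (k + 1)) (D.width (k + 1)) -
      alexanderSum (D.up k) (levels f k) (D.width k) =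
    if h : ∃ _ : k < D.height, (D.slice k).IsCrossing then
      2 * (sign (crossingAt k h) * (f (overIn (crossingAt k h)) - f (underOut (crossingAt k h))))
    else 0 := by
  have hc := ((isColoring_iff f).1 hf.coloring).2 k hk
  rcases D.slice_cases k with ⟨q, hs⟩ | ⟨q, hs⟩ | ⟨q, b, hs⟩
  · obtain ⟨h1, h2, h3, h4, h5⟩ := up_cup hk hs
    rw [dif_neg (by simp [hs, Slice.IsCrossing])]
    obtain ⟨⟨h6, h7⟩, h8⟩ := (constantAt_cup hk hs).1 hc
    generalize D.width k - q = s at *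
    rw [h1, h2]
    refine (alexanderSum_block (b := 0) h3 h4 h6 h7 ?_).trans ?_
    · rw [add_zero, alexander_succ, alexander_succ, h5, rise_not, alexander_congr h3 le_rfl]
      ring
    · rw [sum_range_two_shift fun p => alexanderCoeff (D.up (k + 1)) p * levels f (k + 1) p,
        Finset.sum_range_zero, ← h8, alexanderCoeff_succ, alexanderCoeff, h5, rise_not]
      linear_combination -2 * levels f (k + 1) q * rise_mul_self (D.up (k + 1) q)
  · obtain ⟨h1, h2, h3, h4, h5⟩ := up_cap hk hs
    rw [dif_neg (by simp [hs, Slice.IsCrossing])]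
    obtain ⟨⟨h6, h7⟩, h8⟩ := (constantAt_cap hk hs).1 hc
    generalize D.width (k + 1) - q = s at *
    rw [h1, h2]
    refine (alexanderSum_block (t := 0) h3 h4 h6 h7 ?_).trans ?_
    · rw [add_zero, alexander_succ, alexander_succ, h5, rise_not, alexander_congr h3 le_rfl]
      ring
    · rw [sum_range_two_shift fun p => alexanderCoeff (D.up k) p * levels f k p,
        Finset.sum_range_zero, ← h8, alexanderCoeff_succ, alexanderCoeff, h5, rise_not]
      linear_combination 2 * levels f k q * rise_mul_self (D.up k q)
  · obtain ⟨h1, h2, h3, h4, h5, h6⟩ := up_cross hk hs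
    have hv : ∃ _ : k < D.height, (D.slice k).IsCrossing := ⟨hk, by rw [hs]; trivial⟩
    rw [dif_pos hv]
    obtain ⟨h7, h8⟩ := (constantAt_cross hk hs).1 hc
    have e : ((crossingAt k hv).1 : ℕ) = k := rfl
    have hcons := hf.conserve (crossingAt k hv)
    generalize D.width k - q - 2 = s at *
    rw [h1, h2]
    refine (alexanderSum_block (b := 2) h3 h4 h7 h8 ?_).trans ?_
    · rw [alexander_succ, alexander_succ, alexander_succ, alexander_succ, h5, h6,
        alexander_congr h3 le_rfl]
      ring
    · rw [sum_range_two_shift fun p => alexanderCoeff (D.up (k + 1)) p * levels f (k + 1) p,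
        sum_range_two_shift fun p => alexanderCoeff (D.up k) p * levels f k p,
        alexanderCoeff_succ, alexanderCoeff_succ, alexanderCoeff, alexanderCoeff, h5, h6,
        alexander_congr h3 le_rfl]
      unfold overOut underOut at hcons
      unfold underOut
      unfold overIn underIn at hcons ⊢
      unfold sign
      generalize alexander (D.up (k + 1)) q = N
      simp only [e, hs, Slice.pos, Slice.risingOver] at hcons ⊢
      cases b <;> simp only [if_true, if_false, Bool.false_eq_true] at hcons ⊢ <;>
        rw [apply_fallingIn f, apply_risingIn f, apply_next_risingIn f,
          apply_next_fallingIn f] at hcons <;>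
        simp only [apply_fallingIn f, apply_risingIn f, apply_next_risingIn f,
          apply_next_fallingIn f] <;>
        simp only [e, hs, Slice.pos] at hcons ⊢ <;>
        generalize D.up k q = u at hcons ⊢ <;> generalize D.up k (q + 1) = u' at hcons ⊢ <;>
        cases u <;> cases u' <;>
        simp only [rise, if_true, if_false, Bool.false_eq_true, reduceCtorEq] at hcons ⊢ <;>
        first
        | linear_combination -(2 * N + 3) * hcons
        | linear_combination -(2 * N + 1) * hcons
        | linear_combination (-2 * N + 1) * hcons
        | linear_combination (-2 * N + 3) * hcons

/-- The intersection number of a flow with the projection itself, pushed off to one side, vanishes,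
since both are cycles in the plane. -/
theorem IsFlow.sum_sign_mul {f : D.Point → ℤ} (hf : IsFlow f) :
    ∑ v : D.Crossing, sign v * (f (overIn v) - f (underOut v)) = 0 := by
  have h := Finset.sum_range_sub
    (fun k => alexanderSum (D.up k) (levels f k) (D.width k)) D.height
  rw [Finset.sum_congr rfl fun k hk => alexanderSum_levels_succ hf (Finset.mem_range.1 hk),
    ← sum_crossing fun v => 2 * (sign v * (f (overIn v) - f (underOut v))), ← Finset.mul_sum,
    D.width_top, D.width_bot] at h
  have h0 := ((isColoring_iff f).1 hf.coloring).1
  simp only [alexanderSum, Finset.sum_range_one, alexanderCoeff, alexander, Finset.sum_range_zero,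
    mul_zero, zero_add, one_mul, levels_top, levels_bottom, h0, sub_self] at h
  omega

theorem risingIn_ne_fallingIn (v : D.Crossing) : risingIn v ≠ fallingIn v := by
  intro h
  have h := congrArg (fun x : D.Point => x.1) h
  simp only [risingIn_coe, fallingIn_coe] at h
  split_ifs at h <;> simp at h

theorem nextSlice_overIn (v : D.Crossing) : nextSlice (overIn v) = v.1 := by
  rcases overIn_cases v with ⟨e1, -⟩ | ⟨e1, -⟩ <;> rw [e1]
  · exact nextSlice_risingIn v
  · exact nextSlice_fallingIn v

theorem nextSlice_underIn (v : D.Crossing) : nextSlice (underIn v) = v.1 := by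
  rcases overIn_cases v with ⟨-, e1⟩ | ⟨-, e1⟩ <;> rw [e1]
  · exact nextSlice_fallingIn v
  · exact nextSlice_risingIn v

theorem overIn_ne_underIn (v w : D.Crossing) : overIn v ≠ underIn w := by
  intro h
  have hvw : v = w := by
    apply Subtype.ext
    apply Fin.ext
    rw [← nextSlice_overIn v, ← nextSlice_underIn w, h]
  subst hvw
  rcases overIn_cases v with ⟨e1, e2⟩ | ⟨e1, e2⟩ <;> rw [e1, e2] at h
  · exact risingIn_ne_fallingIn v h
  · exact risingIn_ne_fallingIn v h.symm

/-- For a quantity that is constant along the part arcs, the product over the incoming ends at all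
crossings equals the product over the outgoing ends. -/
theorem prod_in_eq_prod_out {g : D.Point → RatFunc ℚ} (h0 : ∀ x, g x ≠ 0)
    (hg : ∀ x : D.Point, (∀ v : D.Crossing, x ≠ overIn v ∧ x ≠ underIn v) → g (D.next x) = g x) :
    ∏ v : D.Crossing, (g (overIn v) * g (underIn v)) =
      ∏ v : D.Crossing, (g (overOut v) * g (underOut v)) := by
  have h1 : ∏ x : D.Point, g (D.next x) / g x = 1 := by
    rw [Finset.prod_div_distrib]
    have : ∏ x : D.Point, g (D.next x) = ∏ x : D.Point, g x :=
      Fintype.prod_bijective D.next (Finite.injective_iff_bijective.1 D.next_injective) _ _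
        fun _ => rfl
    rw [this, div_self]
    exact Finset.prod_ne_zero_iff.2 fun x _ => h0 x
  have hinj : Function.Injective (Sum.elim overIn underIn : D.Crossing ⊕ D.Crossing → D.Point) :=
    overIn_injective.sumElim underIn_injective overIn_ne_underIn
  have h2 := Fintype.prod_of_injective _ hinj
    (fun e => g (D.next (Sum.elim overIn underIn e)) / g (Sum.elim overIn underIn e))
    (fun x => g (D.next x) / g x) (fun x hx => by
      rw [hg x, div_self (h0 x)]
      intro v
      constructor
      · rintro rfl
        exact hx ⟨Sum.inl v, rfl⟩
      · rintro rfl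
        exact hx ⟨Sum.inr v, rfl⟩) (fun _ => rfl)
  rw [h1, Fintype.prod_sum_type] at h2
  simp only [Sum.elim_inl, Sum.elim_inr] at h2
  rw [← Finset.prod_mul_distrib] at h2
  have h3 : ∏ v : D.Crossing, (g (overOut v) * g (underOut v)) =
      (∏ v : D.Crossing, g (D.next (overIn v)) / g (overIn v) *
        (g (D.next (underIn v)) / g (underIn v))) *
        ∏ v : D.Crossing, (g (overIn v) * g (underIn v)) := by
    rw [← Finset.prod_mul_distrib]
    refine Finset.prod_congr rfl fun v _ => ?_
    have := h0 (overIn v)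
    have := h0 (underIn v)
    unfold overOut underOut
    field_simp
  rw [h3, h2, one_mul]

theorem sign_eq (v : D.Crossing) : sign v = 1 ∨ sign v = -1 := by
  unfold sign
  split_ifs <;> simp

/-- The color that passes to the overcrossing strand at `v`. -/
def jump (f : D.Point → ℤ) (v : D.Crossing) : ℤ := f (overOut v) - f (overIn v)

/-- The weight of a coloring in terms of the flow of complementary colors. -/
theorem jonesWeight_complement (n : ℕ) {f : D.Point → ℤ} (hf : IsFlow f)
    (hn : ∀ x, 0 ≤ f x ∧ f x ≤ n) :
    jonesWeight n (fun x => n - f x) = tq (-(n : ℤ) ^ 2 * D.writhe + 2 * n * D.rotation) *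
      (tq (-4 * (∑ v : D.Crossing, sign v * f (underOut v) * f (overIn v) +
        ∑ x, D.pointRot x * f x)) *
        ∏ v : D.Crossing, stateWeight n (sign v) (f (underOut v)) (f (overIn v))
          (jump f v).toNat) := by
  -- Each crossing contributes the quotient of the scaling factors of its outgoing and its incoming
  -- colors; the product of these quotients is trivial by `prod_in_eq_prod_out`.
  have hg0 : ∀ x, colorScale n (f x) ≠ 0 := fun x => colorScale_ne_zero (hn x).1 (hn x).2
  have hprod := prod_in_eq_prod_out hg0 fun x hx => by rw [hf.coloring x hx]
  have hv : ∀ v : D.Crossing,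
      crossW n (sign v) (n - f (overIn v)) (n - f (underIn v)) (n - f (overOut v))
          (n - f (underOut v)) * (colorScale n (f (overIn v)) * colorScale n (f (underIn v))) =
        tq (-(n : ℤ) ^ 2 * sign v) * tq (2 * n * (sign v * (f (overIn v) - f (underOut v)))) *
          tq (-4 * (sign v * f (underOut v) * f (overIn v))) *
          stateWeight n (sign v) (f (underOut v)) (f (overIn v)) (jump f v).toNat *
          (colorScale n (f (overOut v)) * colorScale n (f (underOut v))) := by
    intro v
    have a1 := hn (overIn v)
    have a2 := hn (underIn v)
    have a3 := hn (overOut v)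
    have a4 := hn (underOut v)
    have hle := hf.le v
    have hc := hf.conserve v
    have key := crossW_complement (sign_eq v) n (f (underOut v)).toNat (f (overIn v)).toNat
      (jump f v).toNat (by unfold jump; omega) (by unfold jump; omega)
    have e1 : ((f (underOut v)).toNat : ℤ) = f (underOut v) := Int.toNat_of_nonneg a4.1
    have e2 : ((f (overIn v)).toNat : ℤ) = f (overIn v) := Int.toNat_of_nonneg a1.1
    have e3 : ((jump f v).toNat : ℤ) = f (overOut v) - f (overIn v) := by
      rw [jump, Int.toNat_of_nonneg (by omega)]
    rw [e1, e2, e3, show f (underOut v) + (f (overOut v) - f (overIn v)) = f (underIn v) by omega,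
      show f (overIn v) + (f (overOut v) - f (overIn v)) = f (overOut v) by omega] at key
    rw [key, mul_assoc (2 * (n : ℤ))]
  have hv' := Finset.prod_congr (rfl : (univ : Finset D.Crossing) = univ) fun v _ => hv v
  simp only [Finset.prod_mul_distrib] at hv' hprod
  rw [← hprod] at hv'
  have hne : (∏ v : D.Crossing, colorScale n (f (overIn v))) *
      ∏ v : D.Crossing, colorScale n (f (underIn v)) ≠ 0 :=
    mul_ne_zero (Finset.prod_ne_zero_iff.2 fun v _ => hg0 _)
      (Finset.prod_ne_zero_iff.2 fun v _ => hg0 _)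
  have hv'' := mul_right_cancel₀ hne hv'
  rw [← tq_sum, ← tq_sum, ← tq_sum, ← Finset.mul_sum, ← Finset.mul_sum, ← Finset.mul_sum,
    hf.sum_sign_mul, mul_zero, tq_zero, mul_one] at hv''
  unfold jonesWeight
  rw [hv'']
  have hrot : ∏ x : D.Point, tq (2 * D.pointRot x * (2 * (n - f x) - n)) =
      tq (2 * n * D.rotation) * tq (-4 * ∑ x, D.pointRot x * f x) := by
    rw [← tq_sum, ← tq_add, rotation, Finset.mul_sum, Finset.mul_sum, ← Finset.sum_add_distrib]
    congr 1
    refine Finset.sum_congr rfl fun x _ => ?_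
    ring
  rw [hrot, mul_add (-4 : ℤ), tq_add, tq_add, writhe]
  ring

/-- Colorings whose complement is not a flow do not contribute. -/
theorem jonesWeight_complement_eq_zero (n : ℕ) {f : D.Point → ℤ} (hc : IsColoring f)
    (hf : ¬IsFlow f) : jonesWeight n (fun x => n - f x) = 0 := by
  have : ∃ v : D.Crossing, ¬(f (overIn v) ≤ f (overOut v) ∧
      f (overIn v) + f (underIn v) = f (overOut v) + f (underOut v)) := by
    by_contra h
    push Not at h
    exact hf ⟨hc, fun v => (h v).1, fun v => (h v).2⟩
  obtain ⟨v, hv⟩ := this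
  unfold jonesWeight
  rw [Finset.prod_eq_zero (mem_univ v), mul_zero]
  refine crossW_eq_zero ?_
  dsimp only
  omega

end LongProjection

/-! ### Overcrossing arcs -/

namespace LongProjection

variable {D : LongProjection} (h : D.NoOvercrossingCircle)

theorem stepsToEnd_underIn (u : D.Crossing) : stepsToEnd h (underIn u) = 0 :=
  (Nat.find_eq_zero _).2 ⟨u, rfl⟩

theorem arcOf_underIn (u : D.Crossing) : arcOf h (underIn u) = u := by
  have e := arcOf_spec h (underIn u)
  rw [stepsToEnd_underIn] at e
  exact (underIn_injective e).symm

theorem stepsToEnd_next {x : D.Point} (hx : ∀ u : D.Crossing, x ≠ underIn u) :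
    stepsToEnd h x = stepsToEnd h (D.next x) + 1 :=
  Nat.find_comp_succ (h x) (h (D.next x)) fun ⟨u, hu⟩ => hx u hu

theorem arcOf_next {x : D.Point} (hx : ∀ u : D.Crossing, x ≠ underIn u) :
    arcOf h (D.next x) = arcOf h x := by
  apply underIn_injective
  rw [← arcOf_spec h x, ← arcOf_spec h (D.next x), stepsToEnd_next h hx,
    Function.iterate_succ_apply]

theorem eq_of_arcOf_eq {x y : D.Point} (e : arcOf h x = arcOf h y)
    (e' : stepsToEnd h x = stepsToEnd h y) : x = y := by
  have hx := arcOf_spec h x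
  rw [e, ← arcOf_spec h y, e'] at hx
  exact D.next_injective.iterate _ hx

theorem iterate_next {y : D.Point} {k : ℕ} (hk : k ≤ stepsToEnd h y) :
    arcOf h (D.next^[k] y) = arcOf h y ∧ stepsToEnd h (D.next^[k] y) = stepsToEnd h y - k := by
  induction k with
  | zero => simp
  | succ k ih =>
    obtain ⟨h1, h2⟩ := ih (by omega)
    have hx : ∀ u : D.Crossing, D.next^[k] y ≠ underIn u := by
      intro u hu
      rw [hu, stepsToEnd_underIn] at h2
      omega
    rw [Function.iterate_succ_apply', arcOf_next h hx, h1]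
    have := stepsToEnd_next h hx
    exact ⟨rfl, by omega⟩

/-- The first point of an overcrossing arc has the largest distance from the end. -/
theorem stepsToEnd_le_underOut {x : D.Point} {v : D.Crossing}
    (e : arcOf h x = arcOf h (underOut v)) : stepsToEnd h x ≤ stepsToEnd h (underOut v) := by
  by_contra! hlt
  obtain ⟨d, hd⟩ := Nat.exists_eq_add_of_lt hlt
  have hx := arcOf_spec h x
  rw [e, ← arcOf_spec h (underOut v), hd, Nat.add_assoc, Function.iterate_add_apply,
    Function.iterate_succ_apply'] at hx
  have := D.next_injective (D.next_injective.iterate _ hx)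
  exact Nat.find_min (h x) (m := d) (by change d < stepsToEnd h x; omega) ⟨v, this⟩

/-- The crossing after which the overcrossing arc `u` begins. -/
noncomputable def startOf (u : D.Crossing) : D.Crossing := (D.sextuple h).σ⁻¹ u

theorem arcOf_underOut_startOf (u : D.Crossing) : arcOf h (underOut (startOf h u)) = u :=
  (D.sextuple h).σ.apply_symm_apply u

theorem startOf_arcOf_underOut (v : D.Crossing) : startOf h (arcOf h (underOut v)) = v :=
  (D.sextuple h).σ.symm_apply_apply v

/-- Every point is reached from the first point of its overcrossing arc. -/
theorem arc_induction (h : D.NoOvercrossingCircle) {P : D.Point → Prop}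
    (h0 : ∀ v : D.Crossing, P (underOut v))
    (hs : ∀ x, (∀ v : D.Crossing, x ≠ underIn v) → P x → P (D.next x)) (x : D.Point) : P x := by
  generalize hd : stepsToEnd h (underOut (startOf h (arcOf h x))) - stepsToEnd h x = d
  induction d using Nat.strong_induction_on generalizing x with
  | _ d ih =>
    obtain ⟨y, rfl⟩ := (Finite.injective_iff_surjective.1 D.next_injective) x
    by_cases hy : ∃ v : D.Crossing, y = underIn v
    · obtain ⟨v, rfl⟩ := hy
      exact h0 v
    · push Not at hy
      refine hs y hy (ih _ ?_ y rfl)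
      have h1 := stepsToEnd_le_underOut h (arcOf_underOut_startOf h (arcOf h y)).symm
      rw [arcOf_next h hy] at hd
      have h2 := stepsToEnd_next h hy
      omega

/-- The rotation number from `y` to the end of its arc, as a sum over points. -/
theorem rotToEnd_eq (y : D.Point) : rotToEnd h y =
    ∑ x with arcOf h x = arcOf h y ∧ stepsToEnd h x ≤ stepsToEnd h y, D.pointRot x := by
  unfold rotToEnd
  refine Finset.sum_nbij' (fun k => D.next^[k] y) (fun x => stepsToEnd h y - stepsToEnd h x)
    ?_ ?_ ?_ ?_ fun _ _ => rfl
  · intro k hk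
    obtain ⟨h1, h2⟩ := iterate_next h (Nat.lt_succ_iff.1 (Finset.mem_range.1 hk))
    simp only [Finset.mem_filter, mem_univ, true_and]
    exact ⟨h1, by omega⟩
  · intro x _
    simp only [Finset.mem_range]
    omega
  · intro k hk
    have hk := Nat.lt_succ_iff.1 (Finset.mem_range.1 hk)
    have := (iterate_next h hk).2
    omega
  · intro x hx
    simp only [Finset.mem_filter, mem_univ, true_and] at hx
    obtain ⟨h1, h2⟩ := iterate_next h (Nat.sub_le (stepsToEnd h y) (stepsToEnd h x))
    refine eq_of_arcOf_eq h (h1.trans hx.1.symm) ?_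
    omega

/-- The color of the point `x`, if the arc that follows the crossing `v` begins with color `b v` and
the jump at the overcrossing of `w` is `j w`. -/
noncomputable def arcColor (b j : D.Crossing → ℤ) (x : D.Point) : ℤ :=
  b (startOf h (arcOf h x)) +
    ∑ w with arcOf h (overOut w) = arcOf h x ∧ stepsToEnd h x ≤ stepsToEnd h (overOut w), j w

variable (b j : D.Crossing → ℤ)

theorem arcColor_underOut (v : D.Crossing) : arcColor h b j (underOut v) = b v := by
  unfold arcColor
  rw [startOf_arcOf_underOut, Finset.sum_eq_zero, add_zero]
  intro w hw
  obtain ⟨-, h1, h2⟩ := Finset.mem_filter.1 hw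
  have := eq_of_arcOf_eq h h1 (le_antisymm (stepsToEnd_le_underOut h h1) h2)
  exact absurd (D.next_injective this) (overIn_ne_underIn w v)

theorem arcColor_underIn (u : D.Crossing) : arcColor h b j (underIn u) =
    b (startOf h u) + ∑ w with arcOf h (overOut w) = u, j w := by
  unfold arcColor
  simp only [arcOf_underIn, stepsToEnd_underIn, zero_le, and_true]

theorem arcColor_next {x : D.Point} (hx : ∀ u : D.Crossing, x ≠ underIn u) :
    arcColor h b j (D.next x) = arcColor h b j x + ∑ w with overIn w = x, j w := by
  unfold arcColor
  rw [arcOf_next h hx, add_assoc, ← Finset.sum_union]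
  · congr 2
    ext w
    simp only [Finset.mem_filter, mem_univ, true_and, Finset.mem_union]
    have h1 := stepsToEnd_next h hx
    constructor
    · rintro ⟨h2, h3⟩
      by_cases h4 : stepsToEnd h x ≤ stepsToEnd h (overOut w)
      · exact Or.inl ⟨h2, h4⟩
      · have h5 : stepsToEnd h (overOut w) = stepsToEnd h (D.next x) := by omega
        exact Or.inr (D.next_injective (eq_of_arcOf_eq h (h2.trans (arcOf_next h hx).symm) h5))
    · rintro (⟨h2, h3⟩ | rfl)
      · exact ⟨h2, by omega⟩
      · exact ⟨arcOf_next h hx, le_rfl⟩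
  · rw [Finset.disjoint_left]
    intro w hw hw'
    obtain ⟨-, h2, h3⟩ := Finset.mem_filter.1 hw
    obtain rfl := (Finset.mem_filter.1 hw').2
    have h1 := stepsToEnd_next h hx
    unfold overOut at h3
    omega

theorem arcColor_overOut (v : D.Crossing) :
    arcColor h b j (overOut v) = arcColor h b j (overIn v) + j v := by
  rw [overOut, arcColor_next h b j (overIn_ne_underIn v)]
  congr 1
  have : (univ.filter fun w : D.Crossing => overIn w = overIn v) = {v} := by
    ext w
    simp [overIn_injective.eq_iff]
  rw [this, Finset.sum_singleton]

theorem arcColor_const {x : D.Point} (hx : ∀ v : D.Crossing, x ≠ overIn v ∧ x ≠ underIn v) :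
    arcColor h b j (D.next x) = arcColor h b j x := by
  rw [arcColor_next h b j fun u => (hx u).2, Finset.sum_eq_zero, add_zero]
  intro w hw
  exact absurd (Finset.mem_filter.1 hw).2.symm (hx w).1

/-- Colors do not decrease along an overcrossing arc. -/
theorem arcColor_bounds (hj : ∀ v, 0 ≤ j v) (x : D.Point) :
    b (startOf h (arcOf h x)) ≤ arcColor h b j x ∧
      arcColor h b j x ≤ arcColor h b j (underIn (arcOf h x)) := by
  rw [arcColor_underIn]
  refine ⟨le_add_of_nonneg_right (Finset.sum_nonneg fun w _ => hj w), ?_⟩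
  refine add_le_add_right (Finset.sum_le_sum_of_subset_of_nonneg ?_ fun w _ _ => hj w) _
  intro w hw
  simp only [Finset.mem_filter, mem_univ, true_and] at hw ⊢
  exact hw.1

/-- A coloring is determined by the colors after the undercrossings and by the jumps. -/
theorem arcColor_self {f : D.Point → ℤ}
    (hf : ∀ x : D.Point, (∀ v : D.Crossing, x ≠ overIn v ∧ x ≠ underIn v) → f (D.next x) = f x)
    (x : D.Point) : arcColor h (fun v => f (underOut v)) (jump f) x = f x := by
  refine arc_induction h (P := fun x => arcColor h (fun v => f (underOut v)) (jump f) x = f x)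
    (fun v => arcColor_underOut h _ _ v) ?_ x
  intro x hx hfx
  by_cases hv : ∃ v : D.Crossing, x = overIn v
  · obtain ⟨v, rfl⟩ := hv
    change arcColor h _ _ (overOut v) = f (overOut v)
    rw [arcColor_overOut, hfx, jump]
    ring
  · push Not at hv
    have hx' := fun v => And.intro (hv v) (hx v)
    rw [arcColor_const h _ _ hx', hfx, hf x hx']

/-- The rotation of a coloring, collected by overcrossing arcs. -/
theorem sum_pointRot_mul_arcColor : ∑ x, D.pointRot x * arcColor h b j x =
    ∑ v : D.Crossing, (rotToEnd h (overOut v) * j v + rotToEnd h (underOut v) * b v) := by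
  unfold arcColor
  simp only [mul_add, Finset.sum_add_distrib]
  rw [add_comm]
  congr 1
  · simp only [rotToEnd_eq, Finset.sum_filter, Finset.sum_mul, Finset.mul_sum]
    rw [Finset.sum_comm]
    refine Finset.sum_congr rfl fun w _ => Finset.sum_congr rfl fun x _ => ?_
    rw [eq_comm (a := arcOf h x)]
    split_ifs <;> simp
  · have h1 : ∀ x : D.Point, D.pointRot x * b (startOf h (arcOf h x)) =
        ∑ v : D.Crossing, if arcOf h x = arcOf h (underOut v) then D.pointRot x * b v else 0 := by
      intro x
      rw [Finset.sum_eq_single (startOf h (arcOf h x)), if_pos (arcOf_underOut_startOf h _).symm]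
      · intro v _ hv
        refine if_neg fun e => hv ?_
        rw [e, startOf_arcOf_underOut]
      · exact fun e => absurd (mem_univ _) e
    rw [Finset.sum_congr rfl fun x _ => h1 x, Finset.sum_comm]
    refine Finset.sum_congr rfl fun v _ => ?_
    rw [rotToEnd_eq, Finset.sum_filter, Finset.sum_mul]
    refine Finset.sum_congr rfl fun x _ => ?_
    by_cases e : arcOf h x = arcOf h (underOut v)
    · rw [if_pos e, if_pos ⟨e, stepsToEnd_le_underOut h e⟩]
    · rw [if_neg e, if_neg fun e' => e e'.1, zero_mul]

end LongProjection

/-! ### States -/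

namespace GraphSextuple

variable {G : GraphSextuple} {v₁ : G.V} (B : Basing v₁) (j : G.V → ℕ) (β : G.Component → ℕ)

theorem comp_σ_inv (v : G.V) : comp (G.σ⁻¹ v) = comp v :=
  Quotient.sound (Equiv.Perm.sameCycle_symm_apply_left.2 (Equiv.Perm.SameCycle.refl _ _))

theorem exists_depth (v : G.V) : {k : ℕ | (G.σ⁻¹ ^ k) v = B.base (comp v)}.Nonempty := by
  have h : G.σ⁻¹.SameCycle v (B.base (comp v)) :=
    Equiv.Perm.sameCycle_inv.2 (Quotient.exact (B.comp_base (comp v)).symm)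
  obtain ⟨k, hk⟩ := h.exists_nat_pow_eq
  exact ⟨k, hk⟩

theorem depth_base {v : G.V} (hv : v = B.base (comp v)) : depth B v = 0 :=
  Nat.sInf_eq_zero.2 (Or.inl hv)

theorem depth_succ {v : G.V} (hv : v ≠ B.base (comp v)) :
    depth B v = depth B (G.σ⁻¹ v) + 1 := by
  have key : ∀ k : ℕ, (G.σ⁻¹ ^ (k + 1)) v = B.base (comp v) ↔
      (G.σ⁻¹ ^ k) (G.σ⁻¹ v) = B.base (comp (G.σ⁻¹ v)) := by
    intro k
    rw [comp_σ_inv, pow_succ, Equiv.Perm.mul_apply]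
  apply le_antisymm
  · exact Nat.sInf_le ((key _).2 (Nat.sInf_mem (exists_depth B (G.σ⁻¹ v))))
  · have h := Nat.sInf_mem (exists_depth B v)
    change (G.σ⁻¹ ^ depth B v) v = B.base (comp v) at h
    rcases hd : depth B v with _ | d
    · rw [hd] at h
      exact absurd h hv
    · rw [hd, key] at h
      exact Nat.succ_le_succ (Nat.sInf_le h)

theorem blue_base {v : G.V} (hv : v = B.base (comp v)) : blue B j β v = β (comp v) := by
  rw [blue, depth_base B hv, Finset.sum_range_zero, add_zero]

theorem blue_step {v : G.V} (hv : v ≠ B.base (comp v)) :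
    blue B j β v + j v = blue B j β (G.σ⁻¹ v) + jumpInto j v := by
  rw [blue, blue, comp_σ_inv, depth_succ B hv, Finset.sum_range_succ']
  simp only [pow_succ, Equiv.Perm.mul_apply, pow_zero, Equiv.Perm.one_apply]
  ring

/-- The recursion along the components, from the base vertices on, determines the blue colors. -/
theorem blue_unique {b : G.V → ℤ} (hb : ∀ ℓ, b (B.base ℓ) = β ℓ)
    (hs : ∀ v, b v + j v = b (G.σ⁻¹ v) + jumpInto j v) (v : G.V) : blue B j β v = b v := by
  generalize hd : depth B v = d
  induction d generalizing v with
  | zero =>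
    have hv : v = B.base (comp v) := by
      by_contra hv
      have := depth_succ B hv
      omega
    rw [blue_base B j β hv, ← hb, ← hv]
  | succ d ih =>
    have hv : v ≠ B.base (comp v) := by
      intro hv
      have := depth_base B hv
      omega
    have h1 := blue_step B j β hv
    have h2 := ih (G.σ⁻¹ v) (by have := depth_succ B hv; omega)
    have h3 := hs v
    rw [h2] at h1
    omega

theorem inequalities_iff (n : ℕ) :
    Inequalities B n j β ↔ ∀ v, 0 ≤ blue B j β v ∧ blue B j β v + j v ≤ n := by
  have key : ∀ v, v ≠ B.base (comp v) → β (comp v) + jumpInto j v +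
      ∑ k ∈ Ico 1 (depth B v), (jumpInto j ((G.σ⁻¹ ^ k) v) - j ((G.σ⁻¹ ^ k) v)) =
        blue B j β v + j v := by
    intro v hv
    rw [blue, Finset.range_eq_Ico,
      ← Finset.sum_Ioo_add_eq_sum_Ico (a := 0) (by rw [depth_succ B hv]; omega)]
    have : Ioo 0 (depth B v) = Ico 1 (depth B v) := by
      ext k
      simp only [Finset.mem_Ioo, Finset.mem_Ico]
      omega
    rw [this, pow_zero, Equiv.Perm.one_apply]
    ring
  constructor
  · rintro ⟨h1, h2⟩ v
    by_cases hv : v = B.base (comp v)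
    · have := h2 (comp v)
      rw [← hv] at this
      rw [blue_base B j β hv]
      omega
    · have := h1 v hv
      rw [key v hv] at this
      omega
  · intro h
    refine ⟨fun v hv => ?_, fun ℓ => ?_⟩
    · rw [key v hv]
      have := h v
      omega
    · have h1 := (h (B.base ℓ)).2
      rw [blue_base B j β (by rw [B.comp_base]), B.comp_base] at h1
      exact_mod_cast h1

theorem sum_comp_jumpInto (ℓ : G.Component) :
    ∑ v with comp v = ℓ, jumpInto j v = ∑ w with comp (G.τ w) = ℓ, (j w : ℤ) := by
  unfold jumpInto
  simp only [Finset.sum_filter]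
  rw [← Finset.sum_filter, Finset.sum_comm]
  refine Finset.sum_congr rfl fun w _ => ?_
  rw [Finset.sum_filter]
  rw [Finset.sum_eq_single (G.τ w)]
  · simp
  · intro v _ hv
    rw [if_neg (Ne.symm hv), ite_self]
  · exact fun e => absurd (mem_univ _) e

theorem cycleRelation_iff (ℓ : G.Component) :
    (∑ v with comp (G.τ v) = ℓ ∧ comp v ≠ ℓ, j v) =
        ∑ v with comp v = ℓ ∧ comp (G.τ v) ≠ ℓ, j v ↔
      ∑ v with comp v = ℓ, (jumpInto j v - j v) = 0 := by
  rw [Finset.sum_sub_distrib, sum_comp_jumpInto]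
  have h1 := Finset.sum_filter_add_sum_filter_not (univ.filter fun v => comp (G.τ v) = ℓ)
    (fun v => comp v = ℓ) j
  have h2 := Finset.sum_filter_add_sum_filter_not (univ.filter fun v => comp v = ℓ)
    (fun v => comp (G.τ v) = ℓ) j
  rw [Finset.filter_filter, Finset.filter_filter] at h1 h2
  have h3 : (univ.filter fun v : G.V => comp (G.τ v) = ℓ ∧ comp v = ℓ) =
      univ.filter fun v : G.V => comp v = ℓ ∧ comp (G.τ v) = ℓ := by
    ext v
    simp only [Finset.mem_filter, and_comm]
  rw [h3] at h1
  zify at h1 h2 ⊢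
  rw [← h1, ← h2]
  constructor <;> intro h <;> linarith

/-- By the cycle relations the blue color returns to its initial value at the end of a
component. -/
theorem cycleRelations_iff :
    CycleRelations j ↔ ∀ v, blue B j β v + j v = blue B j β (G.σ⁻¹ v) + jumpInto j v := by
  have hsum : ∀ ℓ : G.Component,
      ∑ v with comp v = ℓ, (blue B j β v - blue B j β (G.σ⁻¹ v)) = 0 := by
    intro ℓ
    rw [Finset.sum_sub_distrib, sub_eq_zero]
    refine Finset.sum_nbij' (fun v => G.σ v) (fun v => G.σ⁻¹ v) ?_ ?_ ?_ ?_ ?_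
    · intro v hv
      simp only [Finset.mem_filter, mem_univ, true_and] at hv ⊢
      rw [← comp_σ_inv, Equiv.Perm.inv_def, Equiv.symm_apply_apply, hv]
    · intro v hv
      simp only [Finset.mem_filter, mem_univ, true_and] at hv ⊢
      rw [comp_σ_inv, hv]
    · intro v _
      exact G.σ.symm_apply_apply v
    · intro v _
      exact G.σ.apply_symm_apply v
    · intro v _
      rw [Equiv.Perm.inv_def, Equiv.symm_apply_apply]
  constructor
  · intro h v
    by_cases hv : v = B.base (comp v)
    · have h1 := (cycleRelation_iff j (comp v)).1 (h (comp v))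
      have hm : v ∈ univ.filter fun w : G.V => comp w = comp v := by simp
      have h2 : ∑ w with comp w = comp v, ((jumpInto j w - j w) -
          (blue B j β w - blue B j β (G.σ⁻¹ w))) = 0 := by
        rw [Finset.sum_sub_distrib, h1, hsum, sub_zero]
      rw [Finset.sum_eq_single_of_mem v hm] at h2
      · omega
      · intro w hw hwv
        have hw : comp w = comp v := (Finset.mem_filter.1 hw).2
        have := blue_step B j β (v := w) (by rw [hw, ← hv]; exact hwv)
        omega
    · exact blue_step B j β hv
  · intro h ℓ
    rw [cycleRelation_iff, ← hsum ℓ]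
    refine Finset.sum_congr rfl fun v _ => ?_
    have := h v
    omega

end GraphSextuple

/-! ### Flows and states -/

namespace LongProjection

variable {D : LongProjection}

/-- The flows with values in `0, …, n` that vanish at the ends of the long component. -/
noncomputable def flows (D : LongProjection) (n : ℕ) : Finset (D.Point → Fin (n + 1)) :=
  univ.filter fun c => c D.bottom = 0 ∧ IsFlow fun x => (c x : ℤ)

/-- The weight of a flow. -/
noncomputable def flowWeight (n : ℕ) (f : D.Point → ℤ) : RatFunc ℚ :=
  tq (-4 * (∑ v : D.Crossing, sign v * f (underOut v) * f (overIn v) +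
      ∑ x, D.pointRot x * f x)) *
    ∏ v : D.Crossing, stateWeight n (sign v) (f (underOut v)) (f (overIn v)) (jump f v).toNat

theorem isColoring_complement (n : ℤ) (f : D.Point → ℤ) :
    IsColoring (fun x => n - f x) ↔ IsColoring f := by
  unfold IsColoring
  simp only [sub_right_inj]

theorem coe_rev {n : ℕ} (a : Fin (n + 1)) : ((Fin.rev a : Fin (n + 1)) : ℤ) = n - (a : ℤ) := by
  rw [Fin.val_rev]
  have := a.2
  omega

/-- The colored Jones polynomial as a sum over flows. -/
theorem coloredJones_eq_sum_flows (n : ℕ) (hh : 0 < D.height) :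
    D.coloredJones n = tq (-(n : ℤ) ^ 2 * D.writhe + 2 * n * D.rotation) *
      ∑ c ∈ D.flows n, flowWeight n fun x => (c x : ℤ) := by
  rw [coloredJones_eq_jonesAt_last n hh, jonesAt, Finset.mul_sum]
  have h1 : ∑ c : D.Point → Fin (n + 1) with
        c D.bottom = Fin.last n ∧ IsColoring (fun x => (c x : ℤ)),
        jonesWeight n (fun x => (c x : ℤ)) =
      ∑ c : D.Point → Fin (n + 1) with c D.bottom = 0 ∧ IsColoring (fun x => (c x : ℤ)),
        jonesWeight n (fun x => n - (c x : ℤ)) := by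
    refine Finset.sum_nbij' (fun c x => Fin.rev (c x)) (fun c x => Fin.rev (c x)) ?_ ?_ ?_ ?_ ?_
    · intro c hc
      simp only [Finset.mem_filter, mem_univ, true_and, coe_rev, isColoring_complement] at hc ⊢
      exact ⟨by rw [hc.1, Fin.rev_last], hc.2⟩
    · intro c hc
      simp only [Finset.mem_filter, mem_univ, true_and, coe_rev, isColoring_complement] at hc ⊢
      exact ⟨by rw [hc.1, Fin.rev_zero], hc.2⟩
    · intro c _
      simp only [Fin.rev_rev]
    · intro c _
      simp only [Fin.rev_rev]
    · intro c _
      simp only [coe_rev, sub_sub_cancel]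
  rw [h1]
  symm
  refine Finset.sum_subset_zero_on_sdiff ?_ ?_ ?_
  · intro c hc
    simp only [flows, Finset.mem_filter, mem_univ, true_and] at hc ⊢
    exact ⟨hc.1, hc.2.coloring⟩
  · intro c hc
    simp only [flows, Finset.mem_sdiff, Finset.mem_filter, mem_univ, true_and] at hc
    exact jonesWeight_complement_eq_zero n hc.1.2 fun hf => hc.2 ⟨hc.1.1, hf⟩
  · intro c hc
    simp only [flows, Finset.mem_filter, mem_univ, true_and] at hc
    exact (jonesWeight_complement n hc.2 fun x => by have := (c x).2; omega).symm

variable (h : D.NoOvercrossingCircle)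

theorem IsFlow.arcColor {f : D.Point → ℤ} (hf : IsFlow f) (x : D.Point) :
    arcColor h (fun v => f (underOut v)) (jump f) x = f x :=
  arcColor_self h hf.coloring x

/-- The conservation law of a flow, in terms of the colors after the undercrossings. -/
theorem IsFlow.step {f : D.Point → ℤ} (hf : IsFlow f) (v : D.Crossing) :
    f (underOut v) + jump f v =
      f (underOut (startOf h v)) + ∑ w with arcOf h (overOut w) = v, jump f w := by
  have h1 := hf.arcColor h (underIn v)
  rw [arcColor_underIn] at h1
  rw [h1, jump]
  have := hf.conserve v
  omega

theorem IsFlow.jump_nonneg {f : D.Point → ℤ} (hf : IsFlow f) (v : D.Crossing) : 0 ≤ jump f v :=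
  sub_nonneg.2 (hf.le v)

/-- A flow that vanishes at the bottom end vanishes on the first overcrossing arc, since the first
crossing is an undercrossing. -/
theorem IsFlow.vanishing (hU : D.StartsUnder) {f : D.Point → ℤ} (hf : IsFlow f)
    (h0 : ∀ x, 0 ≤ f x) (hb : f D.bottom = 0) :
    f (underOut (arcOf h D.bottom)) = 0 ∧ jump f (arcOf h D.bottom) = 0 ∧
      ∀ w : D.Crossing, arcOf h (overOut w) = arcOf h D.bottom → jump f w = 0 := by
  have hz : f (underIn (arcOf h D.bottom)) = 0 := by
    obtain ⟨m, ⟨v, hv⟩, hm⟩ := hU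
    have hle : stepsToEnd h D.bottom ≤ m := Nat.find_min' (h D.bottom) ⟨v, hv⟩
    have key : ∀ l ≤ stepsToEnd h D.bottom, f (D.next^[l] D.bottom) = 0 := by
      intro l hl
      induction l with
      | zero => exact hb
      | succ l ih =>
        rw [Function.iterate_succ_apply', hf.coloring, ih (by omega)]
        exact fun w => ⟨hm l (by omega) w, fun hw =>
          Nat.find_min (h D.bottom) (m := l) (Nat.lt_of_succ_le hl) ⟨w, hw⟩⟩
    rw [← arcOf_spec h D.bottom]
    exact key _ le_rfl
  have h1 := hf.conserve (arcOf h D.bottom)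
  have h2 := hf.jump_nonneg (arcOf h D.bottom)
  have h3 := h0 (underOut (arcOf h D.bottom))
  have h4 := hf.step h (arcOf h D.bottom)
  have h5 := h0 (underOut (startOf h (arcOf h D.bottom)))
  have h6 : ∑ w with arcOf h (overOut w) = arcOf h D.bottom, jump f w = 0 := by
    apply le_antisymm
    · unfold jump at h4 ⊢
      omega
    · exact Finset.sum_nonneg fun w _ => hf.jump_nonneg w
  rw [Finset.sum_eq_zero_iff_of_nonneg fun w _ => hf.jump_nonneg w] at h6
  unfold jump at h2 ⊢
  exact ⟨by omega, by omega, fun w hw => h6 w (by simpa using hw)⟩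

variable {h}

variable (B : GraphSextuple.Basing (D.baseVertex h))

theorem mem_states_iff (n : ℕ)
    (s : ((D.sextuple h).V → Fin (n + 1)) × ((D.sextuple h).Component → Fin (n + 1))) :
    s ∈ GraphSextuple.states B n ↔
      s.2 (GraphSextuple.comp (D.baseVertex h)) = 0 ∧ s.1 (D.baseVertex h) = 0 ∧
        (∀ w, (D.sextuple h).τ w = D.baseVertex h → s.1 w = 0) ∧
        (∀ v, GraphSextuple.blue B (fun w => (s.1 w : ℕ)) (fun ℓ => (s.2 ℓ : ℕ)) v + (s.1 v : ℕ) =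
          GraphSextuple.blue B (fun w => (s.1 w : ℕ)) (fun ℓ => (s.2 ℓ : ℕ))
            ((D.sextuple h).σ⁻¹ v) + GraphSextuple.jumpInto (fun w => (s.1 w : ℕ)) v) ∧
        ∀ v, 0 ≤ GraphSextuple.blue B (fun w => (s.1 w : ℕ)) (fun ℓ => (s.2 ℓ : ℕ)) v ∧
          GraphSextuple.blue B (fun w => (s.1 w : ℕ)) (fun ℓ => (s.2 ℓ : ℕ)) v + (s.1 v : ℕ) ≤
            n := by
  rw [GraphSextuple.states, Finset.mem_filter, GraphSextuple.cycleRelations_iff B _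
    (fun ℓ => (s.2 ℓ : ℕ)), GraphSextuple.inequalities_iff]
  simp only [mem_univ, true_and]

/-- The blue colors of the state of a flow are the colors after the undercrossings. -/
theorem IsFlow.blue_eq {f : D.Point → ℤ} (hf : IsFlow f) {j : D.Crossing → ℕ}
    {β : (D.sextuple h).Component → ℕ} (hj : ∀ v, (j v : ℤ) = jump f v)
    (hβ : ∀ ℓ, (β ℓ : ℤ) = f (underOut (B.base ℓ : D.Crossing))) (v : D.Crossing) :
    GraphSextuple.blue B j β v = f (underOut v) := by
  have hs : ∀ v : D.Crossing, f (underOut v) + j v =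
      f (underOut (startOf h v)) + ∑ w with arcOf h (overOut w) = v, (j w : ℤ) := by
    intro v
    simp only [hj]
    exact hf.step h v
  exact GraphSextuple.blue_unique B j β (b := fun v : D.Crossing => f (underOut v))
    (fun ℓ => (hβ ℓ).symm) hs v

/-- The color `j̃_v` is the color with which the overcrossing strand arrives at `v`. -/
theorem jTilde_eq (j : D.Crossing → ℕ) (β : (D.sextuple h).Component → ℕ) (v : D.Crossing) :
    GraphSextuple.jTilde B j β v =
      arcColor h (GraphSextuple.blue B j β) (fun w => (j w : ℤ)) (overIn v) := by
  have e1 : arcOf h (overIn v) = arcOf h (overOut v) := (arcOf_next h (overIn_ne_underIn v)).symm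
  have e2 : stepsToEnd h (overIn v) = stepsToEnd h (overOut v) + 1 :=
    stepsToEnd_next h (overIn_ne_underIn v)
  unfold GraphSextuple.jTilde arcColor
  rw [add_comm, e1, e2]
  congr 1
  refine Finset.sum_nbij (fun w => w.1) ?_ ?_ ?_ fun _ _ => rfl
  · intro w hw
    exact Finset.mem_filter.2 ⟨mem_univ _, w.2, (Finset.mem_filter.1 hw).2⟩
  · intro w _ w' _ e
    exact Subtype.ext e
  · intro w hw
    obtain ⟨-, h1, h2⟩ := Finset.mem_filter.1 hw
    exact ⟨⟨w, h1⟩, Finset.mem_coe.2 (Finset.mem_filter.2 ⟨mem_univ _, h2⟩), rfl⟩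

theorem stateWeight_zero (n : ℕ) (ε i j : ℤ) (hi : i = 0) : stateWeight n ε i j 0 = 1 := by
  subst hi
  simp [stateWeight, qBinom, qPochSign, qFactorial, tq_zero]

/-- The weight of a flow in terms of its state. -/
theorem flowWeight_eq (n : ℕ) {f : D.Point → ℤ} (hf : IsFlow f) {j : D.Crossing → ℕ}
    {β : (D.sextuple h).Component → ℕ} (hj : ∀ v, (j v : ℤ) = jump f v)
    (hβ : ∀ ℓ, (β ℓ : ℤ) = f (underOut (B.base ℓ : D.Crossing)))
    (h1 : f (underOut (arcOf h D.bottom)) = 0) (h2 : jump f (arcOf h D.bottom) = 0) :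
    flowWeight n f = tq (4 * GraphSextuple.delta B j β) *
      ∏ v with v ≠ D.baseVertex h, GraphSextuple.vertexWeight B n j β v := by
  have hblue := hf.blue_eq B hj hβ
  have htilde : ∀ v : D.Crossing, GraphSextuple.jTilde B j β v = f (overIn v) := by
    intro v
    rw [jTilde_eq, funext hblue, funext hj]
    exact hf.arcColor h _
  have hnat : ∀ v, (jump f v).toNat = j v := fun v => by have := hj v; omega
  have hbase : ∀ v : (D.sextuple h).V, v ∉ (univ.filter fun v => v ≠ D.baseVertex h) →
      v = arcOf h D.bottom := fun v hv => by
    by_contra hne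
    exact hv (Finset.mem_filter.2 ⟨mem_univ _, hne⟩)
  have hw : ∀ v : D.Crossing, GraphSextuple.vertexWeight B n j β v =
      stateWeight n (sign v) (f (underOut v)) (f (overIn v)) (jump f v).toNat := by
    intro v
    rw [hnat, ← hblue, ← htilde]
    rfl
  have hprod : ∏ v with v ≠ D.baseVertex h, GraphSextuple.vertexWeight B n j β v =
      ∏ v : D.Crossing, stateWeight n (sign v) (f (underOut v)) (f (overIn v))
        (jump f v).toNat := by
    refine (Finset.prod_subset (Finset.filter_subset _ _) fun v _ hv => ?_).trans
      (Finset.prod_congr rfl fun v _ => hw v)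
    obtain rfl := hbase v hv
    rw [hw, h2]
    exact stateWeight_zero _ _ _ _ h1
  have hexcess : GraphSextuple.excess B j β =
      ∑ v : D.Crossing, sign v * f (underOut v) * f (overIn v) := by
    refine (Finset.sum_subset (Finset.filter_subset _ _) fun v _ hv => ?_).trans
      (Finset.sum_congr rfl fun v _ => ?_)
    · obtain rfl := hbase v hv
      rw [hblue, h1, mul_zero, zero_mul]
    · exact congrArg₂ (fun a b => sign v * a * b) (hblue v) (htilde v)
  have hrot : GraphSextuple.stateRot B j β = ∑ x, D.pointRot x * f x := by
    have hsum := sum_pointRot_mul_arcColor h (fun v => f (underOut v)) (jump f)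
    simp only [hf.arcColor h] at hsum
    rw [hsum]
    refine (Finset.sum_subset (Finset.filter_subset _ _) fun v _ hv => ?_).trans
      (Finset.sum_congr rfl fun v _ => ?_)
    · obtain rfl := hbase v hv
      rw [hblue, h1, hj, h2, mul_zero, mul_zero, add_zero]
    · exact congrArg₂ (fun a b => rotToEnd h (overOut v) * a + rotToEnd h (underOut v) * b)
        (hj v) (hblue v)
  have hdelta : GraphSextuple.delta B j β =
      -(GraphSextuple.excess B j β + GraphSextuple.stateRot B j β) := rfl
  rw [hprod, hdelta, hexcess, hrot, flowWeight, mul_neg, neg_mul]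

/-- The state of a flow: the jumps, and the colors after the undercrossings at which the base arcs
end. The jumps of a flow lie between `0` and `n`, so that their reduction modulo `n + 1` by
`Fin.ofNat` has no effect. -/
noncomputable def stateOf (n : ℕ) (c : D.Point → Fin (n + 1)) :
    ((D.sextuple h).V → Fin (n + 1)) × ((D.sextuple h).Component → Fin (n + 1)) :=
  (fun v => Fin.ofNat (n + 1) (jump (fun x => (c x : ℤ)) v).toNat,
    fun ℓ => c (underOut (B.base ℓ : D.Crossing)))

theorem stateOf_jump {n : ℕ} {c : D.Point → Fin (n + 1)} (hc : IsFlow fun x => (c x : ℤ))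
    (v : D.Crossing) : (((stateOf B n c).1 v : ℕ) : ℤ) = jump (fun x => (c x : ℤ)) v := by
  have h1 := hc.jump_nonneg v
  have h2 : (jump (fun x => (c x : ℤ)) v).toNat < n + 1 := by
    have := (c (overOut v)).2
    change ((c (overOut v) : ℤ) - (c (overIn v) : ℤ)).toNat < n + 1
    omega
  have h3 : ((stateOf B n c).1 v : ℕ) = (jump (fun x => (c x : ℤ)) v).toNat % (n + 1) := rfl
  rw [h3, Nat.mod_eq_of_lt h2, Int.toNat_of_nonneg h1]

theorem stateOf_blue {n : ℕ} {c : D.Point → Fin (n + 1)} (hc : IsFlow fun x => (c x : ℤ))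
    (v : D.Crossing) : GraphSextuple.blue B (fun w => ((stateOf B n c).1 w : ℕ))
      (fun ℓ => ((stateOf B n c).2 ℓ : ℕ)) v = (c (underOut v) : ℤ) :=
  hc.blue_eq B (stateOf_jump B hc) (fun _ => rfl) v

theorem stateOf_mem (hU : D.StartsUnder) {n : ℕ} {c : D.Point → Fin (n + 1)}
    (hc : c ∈ D.flows n) : stateOf B n c ∈ GraphSextuple.states B n := by
  obtain ⟨-, hb, hf⟩ := Finset.mem_filter.1 hc
  obtain ⟨h1, h2, h3⟩ := hf.vanishing h hU (fun x => by omega) (by simp [hb])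
  have hz : ∀ v : D.Crossing, jump (fun x => (c x : ℤ)) v = 0 → (stateOf B n c).1 v = 0 := by
    intro v hv
    apply Fin.ext
    have := stateOf_jump B hf v
    rw [hv] at this
    exact Int.natCast_eq_zero.1 this
  rw [mem_states_iff]
  refine ⟨?_, hz _ h2, fun w hw => hz w (h3 w hw), fun (v : D.Crossing) => ?_,
    fun (v : D.Crossing) => ?_⟩
  · apply Fin.ext
    change (c (underOut (B.base (GraphSextuple.comp (D.baseVertex h)) : D.Crossing)) : ℕ) = 0
    rw [B.base_first]
    exact_mod_cast h1
  · have hs := hf.step h v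
    simp only [← stateOf_jump B hf] at hs
    rw [← stateOf_blue B hf, ← stateOf_blue B hf] at hs
    exact hs
  · have hj := stateOf_jump B hf v
    have h4 := (c (underIn v)).2
    have h5 := hf.conserve v
    have h6 := stateOf_blue B hf v
    simp only [jump] at h5 hj
    constructor <;> omega

theorem stateOf_injOn (n : ℕ) : Set.InjOn (stateOf B n) (D.flows n) := by
  intro c hc c' hc' e
  have hf := (Finset.mem_filter.1 hc).2.2
  have hf' := (Finset.mem_filter.1 hc').2.2
  funext x
  apply Fin.ext
  have h1 : jump (fun x => (c x : ℤ)) = jump (fun x => (c' x : ℤ)) := by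
    funext v
    rw [← stateOf_jump B hf, ← stateOf_jump B hf', e]
  have h2 : (fun v : D.Crossing => (c (underOut v) : ℤ)) = fun v => (c' (underOut v) : ℤ) := by
    funext v
    rw [← stateOf_blue B hf, ← stateOf_blue B hf', e]
  have h3 := hf.arcColor h x
  rw [h1, h2, hf'.arcColor h x] at h3
  exact_mod_cast h3.symm

/-- Every contributing state comes from a flow. -/
theorem stateOf_surjOn (n : ℕ) :
    Set.SurjOn (stateOf B n) (D.flows n) (GraphSextuple.states B n) := by
  intro s hs
  obtain ⟨h1, h2, h3, h4, h5⟩ := (mem_states_iff B n s).1 (Finset.mem_coe.1 hs)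
  -- The flow is rebuilt from the blue colors `b` and the jumps `j`; by monotonicity along the arcs
  -- the inequalities at the undercrossings bound all of its colors.
  set b : D.Crossing → ℤ :=
    GraphSextuple.blue B (fun w => (s.1 w : ℕ)) (fun ℓ => (s.2 ℓ : ℕ)) with hb
  set j : D.Crossing → ℤ := fun w => ((s.1 w : ℕ) : ℤ) with hj
  have hj0 : ∀ v, 0 ≤ j v := fun v => Int.natCast_nonneg _
  have hstep : ∀ v : D.Crossing, b v + j v = arcColor h b j (underIn v) := fun v =>
    (h4 v).trans (arcColor_underIn h b j v).symm
  have hbound : ∀ x, 0 ≤ arcColor h b j x ∧ arcColor h b j x ≤ n := by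
    intro x
    obtain ⟨h6, h7⟩ := arcColor_bounds h b j hj0 x
    rw [← hstep] at h7
    exact ⟨(h5 (startOf h (arcOf h x))).1.trans h6, h7.trans (h5 (arcOf h x)).2⟩
  let c : D.Point → Fin (n + 1) := fun x => ⟨(arcColor h b j x).toNat, by have := hbound x; omega⟩
  have hc : (fun x => ((c x : ℕ) : ℤ)) = arcColor h b j :=
    funext fun x => Int.toNat_of_nonneg (hbound x).1
  have hjump : jump (arcColor h b j) = j := by
    funext v
    rw [jump, arcColor_overOut]
    ring
  have hflow : IsFlow (arcColor h b j) := by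
    refine ⟨fun x hx => arcColor_const h b j hx, fun v => ?_, fun v => ?_⟩
    · have := hj0 v
      rw [arcColor_overOut]
      omega
    · rw [arcColor_overOut, arcColor_underOut, ← hstep]
      ring
  have hbase : b (arcOf h D.bottom) = 0 := by
    have e : D.baseVertex h = B.base (GraphSextuple.comp (D.baseVertex h)) := B.base_first.symm
    refine (GraphSextuple.blue_base B _ _ e).trans ?_
    simp only [h1]
    rfl
  have hbot : c D.bottom = 0 := by
    have h6 := (arcColor_bounds h b j hj0 D.bottom).2
    have h7 : j (arcOf h D.bottom) = 0 := by
      change ((s.1 (D.baseVertex h) : ℕ) : ℤ) = 0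
      rw [h2]
      rfl
    rw [← hstep, hbase, h7] at h6
    apply Fin.ext
    change (arcColor h b j D.bottom).toNat = 0
    omega
  rw [← hc] at hflow
  refine ⟨c, Finset.mem_coe.2 (Finset.mem_filter.2 ⟨mem_univ _, hbot, hflow⟩), ?_⟩
  refine Prod.ext ?_ ?_
  · funext v
    apply Fin.ext
    have := stateOf_jump B hflow v
    rw [hc, hjump] at this
    exact Int.natCast_inj.1 this
  · funext ℓ
    apply Fin.ext
    have e : B.base ℓ = B.base (GraphSextuple.comp (B.base ℓ)) := by rw [B.comp_base]
    have h6 := GraphSextuple.blue_base B (fun w => (s.1 w : ℕ)) (fun ℓ => (s.2 ℓ : ℕ)) e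
    rw [B.comp_base] at h6
    have h7 : ((c (underOut (B.base ℓ : D.Crossing)) : ℕ) : ℤ) = b (B.base ℓ) := by
      rw [← arcColor_underOut h b j (B.base ℓ : D.Crossing)]
      exact congrFun hc _
    exact_mod_cast h7.trans h6

end LongProjection

theorem mainTheorem5 (D : LongProjection) (hD : D.NoOvercrossingCircle) (hU : D.StartsUnder)
    (B : GraphSextuple.Basing (D.baseVertex hD)) (n : ℕ) :
    D.coloredJones n =
      tq (-(n : ℤ) ^ 2 * D.writhe + 2 * n * D.rotation) *
        ∑ s ∈ GraphSextuple.states B n,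
          tq (4 * GraphSextuple.delta B (fun v => (s.1 v : ℕ)) (fun ℓ => (s.2 ℓ : ℕ))) *
            ∏ v with v ≠ D.baseVertex hD,
              GraphSextuple.vertexWeight B n (fun w => (s.1 w : ℕ)) (fun ℓ => (s.2 ℓ : ℕ)) v := by
  have hh : 0 < D.height := (Nat.zero_le _).trans_lt (D.baseVertex hD).1.2
  rw [LongProjection.coloredJones_eq_sum_flows n hh]
  congr 1
  refine Finset.sum_nbij (LongProjection.stateOf B n)
    (fun c hc => LongProjection.stateOf_mem B hU hc) (LongProjection.stateOf_injOn B n)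
    (LongProjection.stateOf_surjOn B n) fun c hc => ?_
  obtain ⟨-, hb, hf⟩ := Finset.mem_filter.1 hc
  obtain ⟨h1, h2, -⟩ := hf.vanishing hD hU (fun x => by omega) (by simp [hb])
  exact LongProjection.flowWeight_eq B n hf (LongProjection.stateOf_jump B hf) (fun _ => rfl) h1 h2
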